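/- Let $A$ be a Dedekind domain with fraction field $K$, and let $\deg x_i=m^{(i)}\in\mathbb Z^r$ define a $\mathbb Z^r$-grading on $K[x_1,\dots,x_N]$. Let $f_1,\dots,f_m,g_1,\dots,g_s\in A[x_1,\dots,x_N]$ be $\mathbb Z^r$-homogeneous, $I_1=(g_1,\dots,g_s)$, $I_2=(f_1,\dots,f_m)$, and $Y=V(I_1)\smallsetminus V(I_2)\subseteq\mathbb A^N_A$, with the action of $\mathbb G_m^r$ given on points by $t*(a_1,\dots,a_N)=(t^{m^{(1)}}a_1,\dots,t^{m^{(N)}}a_N)$, where $t^m=t_1^{m_1}\cdots t_r^{m_r}$. Let $X$ be a separated scheme of finite type over $A$ and let $\pi:Y\to X$ be a morphism of $A$-schemes that is a torsor under $\mathbb G_{m,X}^r$ for this action. For an $r$-tuple $\mathfrak a=(\mathfrak a_1,\dots,\mathfrak a_r)$ of nonzero fractional ideals of $A$ and $m\in\mathbb Z^r$ put $\mathfrak a^m=\mathfrak a_1^{m_1}\cdots\mathfrak a_r^{m_r}$. Let ${}_{\mathfrak a}R=\bigoplus_{m}\mathfrak a^{-m}R_m\subseteq K[x_1,\dots,x_N]$,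 where $R_m$ is the degree-$m$ part of $A[x_1,\dots,x_N]$, let ${}_{\mathfrak a}I_j=\bigoplus_m\mathfrak a^{-m}I_{j,m}\subseteq{}_{\mathfrak a}R$, where $I_{j,m}$ is the degree-$m$ part of $I_j$, and let ${}_{\mathfrak a}Y=V({}_{\mathfrak a}I_1)\smallsetminus V({}_{\mathfrak a}I_2)\subseteq\operatorname{Spec}({}_{\mathfrak a}R)$, with the action of $\mathbb G_m^r$ defined by the grading. Then there is a unique morphism ${}_{\mathfrak a}\pi:{}_{\mathfrak a}Y\to X$ such that for every nonempty affine open $U=\operatorname{Spec}(A_U)\subseteq\operatorname{Spec}(A)$ over which all $\mathfrak a_jA_U$ are principal, and all generators $\rho_j$ of $\mathfrak a_jA_U$, the restriction of ${}_{\mathfrak a}\pi$ over $U$ is the composition of $\pi$ with the isomorphism ${}_{\mathfrak a}Y\times_AU\to Y\times_AU$ given by $x_i\mapsto\rho^{-m^{(i)}}x_i$; it is a morphism of $A$-schemes. Moreover: (i) ${}_{\mathfrak a}\pi:{}_{\mathfrak a}Y\to X$ is a torsor under $\mathbb G_{m,X}^r$ of class $[Y]-[\mathfrak a]\in H^1_{\text{ét}}(X,\mathbb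 G_{m,X}^r)$. Here the class of a torsor is that of the cocycle $(g_{ij})$ with $s_i=g_{ij}s_j$ for local sections $s_i$, and $[\mathfrak a]$ is the image of $(\mathfrak a_1,\dots,\mathfrak a_r)$ under $\operatorname{Pic}(A)^r\cong H^1_{\text{ét}}(\operatorname{Spec}A,\mathbb G_m^r)\to H^1_{\text{ét}}(X,\mathbb G_{m,X}^r)$, where the class of a line bundle is that of its transition functions $\theta_i\circ\theta_j^{-1}$ for local trivializations $\theta_i$ (isomorphisms to the structure sheaf). (ii) If $X$ is proper over $A$ and $\mathcal C$ is a system of representatives, consisting of nonzero fractional ideals, for the class group of $A$, then, with $X_K=X\times_A\operatorname{Spec}K$ and under base extension, $$X_K(K)=\bigsqcup_{\mathfrak c\in\mathcal C^r}{}_{\mathfrak c}\pi({}_{\mathfrak c}Y(A)).$$ (iii) For every $r$-tuple $\mathfrak c$ of nonzero fractional ideals of $A$ (in particular for every $\mathfrak c\in\mathcal C^r$), base extension to $K$ and the inclusion ${}_{\mathfrak c}R\subseteq K[x_1,\dots,x_N]$ identify the set ${}_{\mathfrak c}Y(A)$ with the set of all $a=(a_1,\dots,a_N)\in K^N$ such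 that $a_i\in\mathfrak c^{m^{(i)}}$ for all $i$, $$\sum_{i=1}^m f_i(a)\,\mathfrak c^{-\deg f_i}=A,$$ and $g_j(a)=0$ for all $j\in\{1,\dots,s\}$. -/

import Mathlib

open CategoryTheory AlgebraicGeometry Limits
open scoped nonZeroDivisors

universe u

namespace TwistedTorsor

noncomputable section

/-! ### The split torus and its actions -/

/-- The `T`-points of the split torus `𝔾_m^r`. -/
abbrev Torus (r : ℕ) (T : Scheme.{u}) : Type u := Fin r → Γ(T, ⊤)ˣ

/-- Functoriality of `T ↦ 𝔾_m^r(T)`. -/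
def Torus.res {r : ℕ} {T T' : Scheme.{u}} (h : T' ⟶ T) : Torus r T →* Torus r T' :=
  MonoidHom.compLeft (Units.map (h.appTop.hom : Γ(T, ⊤) →* Γ(T', ⊤))) (Fin r)

/-- The character `s ↦ s^m = s_1^{m_1} ⋯ s_r^{m_r}` of the torus. -/
def Torus.char {r : ℕ} {T : Scheme.{u}} (s : Torus r T) (m : Fin r → ℤ) : Γ(T, ⊤)ˣ :=
  ∏ j, s j ^ m j

theorem Torus.char_zero {r : ℕ} {T : Scheme.{u}} (s : Torus r T) : s.char 0 = 1 := by
  simp [Torus.char]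

theorem Torus.char_add {r : ℕ} {T : Scheme.{u}} (s : Torus r T) (m n : Fin r → ℤ) :
    s.char (m + n) = s.char m * s.char n := by
  simp [Torus.char, zpow_add, Finset.prod_mul_distrib]

theorem Torus.one_char {r : ℕ} {T : Scheme.{u}} (m : Fin r → ℤ) :
    Torus.char (1 : Torus r T) m = 1 := by
  simp [Torus.char]

theorem Torus.mul_char {r : ℕ} {T : Scheme.{u}} (s t : Torus r T) (m : Fin r → ℤ) :
    Torus.char (s * t) m = s.char m * t.char m := by
  simp [Torus.char, mul_zpow, Finset.prod_mul_distrib]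

theorem Torus.res_char {r : ℕ} {T T' : Scheme.{u}} (h : T' ⟶ T) (s : Torus r T)
    (m : Fin r → ℤ) :
    (((Torus.res h s).char m : Γ(T', ⊤)ˣ) : Γ(T', ⊤)) = h.appTop.hom (s.char m : Γ(T, ⊤)) := by
  have : (Torus.res h s).char m
      = Units.map (h.appTop.hom : Γ(T, ⊤) →* Γ(T', ⊤)) (s.char m) := by
    simp [Torus.char, Torus.res, map_prod, map_zpow]
  rw [this]; rfl

/-- An action of `𝔾_m^r` on a scheme `Y`, given on `T`-points functorially in `T`. -/
structure TorusAction (r : ℕ) (Y : Scheme.{u}) where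
  act : ∀ {T : Scheme.{u}}, Torus r T → (T ⟶ Y) → (T ⟶ Y)
  one_act : ∀ {T : Scheme.{u}} (y : T ⟶ Y), act 1 y = y
  mul_act : ∀ {T : Scheme.{u}} (s t : Torus r T) (y : T ⟶ Y), act (s * t) y = act s (act t y)
  comp_act : ∀ {T T' : Scheme.{u}} (h : T' ⟶ T) (s : Torus r T) (y : T ⟶ Y),
    h ≫ act s y = act (Torus.res h s) (h ≫ y)

/-- `π : Y ⟶ X` is a torsor under `𝔾_{m,X}^r`: it is faithfully flat and locally of finite
presentation, the action preserves the fibres of `π`, and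
`𝔾_m^r × Y ⟶ Y ×_X Y`, `(s, y) ↦ (y, s y)` is an isomorphism (expressed on `T`-points). -/
structure IsTorsor {r : ℕ} {Y X : Scheme.{u}} (α : TorusAction r Y) (π : Y ⟶ X) : Prop where
  flat : Flat π
  surjective : Surjective π
  locallyOfFinitePresentation : LocallyOfFinitePresentation π
  act_comp : ∀ {T : Scheme.{u}} (s : Torus r T) (y : T ⟶ Y), α.act s y ≫ π = y ≫ π
  existsUnique_act_eq : ∀ {T : Scheme.{u}} (y y' : T ⟶ Y), y ≫ π = y' ≫ π →
    ∃! s : Torus r T, α.act s y = y'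

/-! ### Open subschemes of closed subschemes of affine schemes -/

/-- The scheme `V(I₁) ∖ V(I₂)` inside `Spec B`: the open subscheme of the closed subscheme
`Spec (B ⧸ I₁)` where the functions in `I₂` do not all vanish. -/
def locus (B : Type u) [CommRing B] (I₁ I₂ : Ideal B) : Scheme.{u} :=
  Scheme.Opens.toScheme (X := Spec (CommRingCat.of (B ⧸ I₁)))
    ⟨(PrimeSpectrum.zeroLocus (Ideal.Quotient.mk I₁ '' (I₂ : Set B)))ᶜ,
      (PrimeSpectrum.isClosed_zeroLocus _).isOpen_compl⟩

namespace locus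

variable {B : Type u} [CommRing B] {I₁ I₂ : Ideal B}

/-- The immersion of `V(I₁) ∖ V(I₂)` in `V(I₁)`. -/
def ι (I₁ I₂ : Ideal B) : locus B I₁ I₂ ⟶ Spec (CommRingCat.of (B ⧸ I₁)) :=
  Scheme.Opens.ι _

instance : IsOpenImmersion (ι I₁ I₂) := inferInstanceAs (IsOpenImmersion (Scheme.Opens.ι _))

/-- The immersion of `V(I₁) ∖ V(I₂)` in `Spec B`. -/
def toSpec (I₁ I₂ : Ideal B) : locus B I₁ I₂ ⟶ Spec (CommRingCat.of B) :=
  ι I₁ I₂ ≫ Spec.map (CommRingCat.ofHom (Ideal.Quotient.mk I₁))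

instance : Mono (toSpec I₁ I₂) := by
  have : Mono (Spec.map (CommRingCat.ofHom (Ideal.Quotient.mk I₁))) := by
    have : IsClosedImmersion (Spec.map (CommRingCat.ofHom (Ideal.Quotient.mk I₁))) :=
      IsClosedImmersion.spec_of_surjective _ Ideal.Quotient.mk_surjective
    infer_instance
  unfold toSpec
  infer_instance

/-- The homomorphism `B → Γ(T, 𝒪)` of evaluation of functions at a `T`-point. -/
def eval {T : Scheme.{u}} (y : T ⟶ Spec (CommRingCat.of B)) : B →+* Γ(T, ⊤) :=
  (y.appTop.hom).comp (Scheme.ΓSpecIso (CommRingCat.of B)).inv.hom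

/-- The `T`-point of `Spec B` given by a homomorphism `B → Γ(T, 𝒪)`. -/
def ofEval {T : Scheme.{u}} (φ : B →+* Γ(T, ⊤)) : T ⟶ Spec (CommRingCat.of B) :=
  T.toSpecΓ ≫ Spec.map (CommRingCat.ofHom φ)

theorem ofEval_eval {T : Scheme.{u}} (y : T ⟶ Spec (CommRingCat.of B)) : ofEval (eval y) = y := by
  unfold ofEval eval
  rw [CommRingCat.ofHom_comp, CommRingCat.ofHom_hom, CommRingCat.ofHom_hom, Spec.map_comp,
    ← Scheme.toSpecΓ_naturality_assoc]
  simp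

theorem eval_ofEval {T : Scheme.{u}} (φ : B →+* Γ(T, ⊤)) : eval (ofEval φ) = φ := by
  have : CommRingCat.ofHom (eval (ofEval φ)) = CommRingCat.ofHom φ := by
    unfold ofEval eval
    rw [CommRingCat.ofHom_comp, CommRingCat.ofHom_hom, CommRingCat.ofHom_hom]
    simp
  exact congrArg CommRingCat.Hom.hom this

theorem eval_comp {T T' : Scheme.{u}} (h : T' ⟶ T) (y : T ⟶ Spec (CommRingCat.of B)) (b : B) :
    eval (h ≫ y) b = h.appTop.hom (eval y b) := by
  unfold eval
  rw [Scheme.Hom.comp_appTop]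
  rfl


/-- The homomorphism `B → Γ(T, 𝒪)` of evaluation of functions at a `T`-point of `V(I₁) ∖ V(I₂)`. -/
def comorphism {T : Scheme.{u}} (y : T ⟶ locus B I₁ I₂) : B →+* Γ(T, ⊤) :=
  eval (y ≫ toSpec I₁ I₂)

theorem comorphism_comp {T T' : Scheme.{u}} (h : T' ⟶ T) (y : T ⟶ locus B I₁ I₂) (b : B) :
    comorphism (h ≫ y) b = h.appTop.hom (comorphism y b) := by
  unfold comorphism
  rw [Category.assoc, eval_comp]

theorem comorphism_injective {T : Scheme.{u}} {y y' : T ⟶ locus B I₁ I₂}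
    (h : comorphism y = comorphism y') : y = y' := by
  rw [← cancel_mono (toSpec I₁ I₂), ← ofEval_eval (y ≫ toSpec I₁ I₂), ← ofEval_eval (y' ≫ _)]
  exact congrArg ofEval h

theorem mem_basicOpen_eval {T : Scheme.{u}} (y : T ⟶ Spec (CommRingCat.of B)) (t : T) (b : B) :
    t ∈ T.basicOpen (eval y b) ↔ y t ∈ (PrimeSpectrum.basicOpen b : (Spec (.of B)).Opens) := by
  have h := Scheme.preimage_basicOpen_top y ((Scheme.ΓSpecIso (CommRingCat.of B)).inv b)
  rw [basicOpen_eq_of_affine] at h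
  exact (SetLike.ext_iff.mp h t).symm

theorem comorphism_eq_eval {T : Scheme.{u}} (y : T ⟶ locus B I₁ I₂) (b : B) :
    comorphism y b = eval (y ≫ ι I₁ I₂) (Ideal.Quotient.mk I₁ b) := by
  unfold comorphism toSpec
  rw [← Category.assoc]
  generalize y ≫ ι I₁ I₂ = z
  unfold eval
  rw [Scheme.Hom.comp_appTop]
  simp only [RingHom.comp_apply, CommRingCat.hom_comp]
  congr 1
  exact (congrArg (fun f => f.hom b) (Scheme.ΓSpecIso_inv_naturality
    (CommRingCat.ofHom (Ideal.Quotient.mk I₁)))).symm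

theorem comorphism_eq_zero {T : Scheme.{u}} (y : T ⟶ locus B I₁ I₂) {b : B} (hb : b ∈ I₁) :
    comorphism y b = 0 := by
  rw [comorphism_eq_eval, Ideal.Quotient.eq_zero_iff_mem.mpr hb, map_zero]

theorem exists_mem_basicOpen {T : Scheme.{u}} (y : T ⟶ locus B I₁ I₂) (t : T) :
    ∃ b ∈ I₂, t ∈ T.basicOpen (comorphism y b) := by
  have h : (y ≫ ι I₁ I₂) t ∈ Set.range (ι I₁ I₂) := ⟨y t, by simp⟩
  have h' : (y ≫ ι I₁ I₂) t ∈ (PrimeSpectrum.zeroLocus (Ideal.Quotient.mk I₁ '' (I₂ : Set B)))ᶜ := by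
    have e := Scheme.Opens.range_ι (X := Spec (CommRingCat.of (B ⧸ I₁)))
      ⟨(PrimeSpectrum.zeroLocus (Ideal.Quotient.mk I₁ '' (I₂ : Set B)))ᶜ,
        (PrimeSpectrum.isClosed_zeroLocus _).isOpen_compl⟩
    exact e.subset h
  obtain ⟨_, ⟨b, hb, rfl⟩, hb'⟩ := Set.not_subset.mp h'
  refine ⟨b, hb, ?_⟩
  rw [comorphism_eq_eval, mem_basicOpen_eval]
  exact hb'

theorem exists_comorphism_eq {T : Scheme.{u}} (φ : B →+* Γ(T, ⊤)) (h₁ : ∀ b ∈ I₁, φ b = 0)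
    (h₂ : ∀ t : T, ∃ b ∈ I₂, t ∈ T.basicOpen (φ b)) :
    ∃ y : T ⟶ locus B I₁ I₂, comorphism y = φ := by
  let z : T ⟶ Spec (CommRingCat.of (B ⧸ I₁)) := ofEval (Ideal.Quotient.lift I₁ φ h₁)
  have hz : ∀ b, eval z (Ideal.Quotient.mk I₁ b) = φ b := fun b => by
    rw [eval_ofEval, Ideal.Quotient.lift_mk]
  have hr : Set.range z ⊆ Set.range (ι I₁ I₂) := by
    have e := Scheme.Opens.range_ι (X := Spec (CommRingCat.of (B ⧸ I₁)))
      ⟨(PrimeSpectrum.zeroLocus (Ideal.Quotient.mk I₁ '' (I₂ : Set B)))ᶜ,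
        (PrimeSpectrum.isClosed_zeroLocus _).isOpen_compl⟩
    refine subset_of_subset_of_eq ?_ e.symm
    rintro _ ⟨t, rfl⟩
    obtain ⟨b, hb, ht⟩ := h₂ t
    rw [← hz, mem_basicOpen_eval] at ht
    exact fun h => ht (h ⟨b, hb, rfl⟩)
  refine ⟨IsOpenImmersion.lift (ι I₁ I₂) z hr, RingHom.ext fun b => ?_⟩
  rw [comorphism_eq_eval, IsOpenImmersion.lift_fac, hz]

/-- The `T`-point of `V(I₁) ∖ V(I₂)` with a given homomorphism `B → Γ(T, 𝒪)`. -/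
def ofComorphism {T : Scheme.{u}} (φ : B →+* Γ(T, ⊤)) (h₁ : ∀ b ∈ I₁, φ b = 0)
    (h₂ : ∀ t : T, ∃ b ∈ I₂, t ∈ T.basicOpen (φ b)) : T ⟶ locus B I₁ I₂ :=
  (exists_comorphism_eq φ h₁ h₂).choose

theorem comorphism_ofComorphism {T : Scheme.{u}} (φ : B →+* Γ(T, ⊤)) (h₁ : ∀ b ∈ I₁, φ b = 0)
    (h₂ : ∀ t : T, ∃ b ∈ I₂, t ∈ T.basicOpen (φ b)) :
    comorphism (ofComorphism (I₁ := I₁) (I₂ := I₂) φ h₁ h₂) = φ :=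
  (exists_comorphism_eq φ h₁ h₂).choose_spec

end locus

/-! ### The torus action defined by a grading -/

section Grading

variable {r : ℕ} {B : Type u} [CommRing B] {σ : Type*} [SetLike σ B] [AddSubgroupClass σ B]
  (𝒜 : (Fin r → ℤ) → σ) [GradedRing 𝒜] {I₁ I₂ : Ideal B}

/-- Given `φ : B → Γ(T, 𝒪)` and `s ∈ 𝔾_m^r(T)`, the homomorphism `b ↦ s^m φ(b)` for `b`
homogeneous of degree `m`. -/
def scale {T : Scheme.{u}} (s : Torus r T) (φ : B →+* Γ(T, ⊤)) : B →+* Γ(T, ⊤) :=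
  (DirectSum.toSemiring
    (fun m => (AddMonoidHom.mulLeft (s.char m : Γ(T, ⊤))).comp
      ((φ : B →+ Γ(T, ⊤)).comp (AddSubmonoidClass.subtype (𝒜 m))))
    (by
      change (s.char 0 : Γ(T, ⊤)) * φ 1 = 1
      simp [Torus.char_zero])
    (by
      intro m n b c
      change (s.char (m + n) : Γ(T, ⊤)) * φ ((b : B) * (c : B))
        = (s.char m * φ b) * (s.char n * φ c)
      rw [Torus.char_add, map_mul, Units.val_mul]
      ring)).comp (DirectSum.decomposeRingEquiv 𝒜 : B →+* _)

theorem scale_apply {T : Scheme.{u}} (s : Torus r T) (φ : B →+* Γ(T, ⊤)) {m : Fin r → ℤ} {b : B}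
    (hb : b ∈ 𝒜 m) : scale 𝒜 s φ b = s.char m * φ b := by
  have : DirectSum.decomposeRingEquiv 𝒜 b = DirectSum.of (fun m => 𝒜 m) m ⟨b, hb⟩ :=
    DirectSum.decompose_of_mem 𝒜 hb
  simp only [scale, RingHom.comp_apply, RingHom.coe_coe, this, DirectSum.toSemiring_of]
  rfl

theorem hom_ext_of_homogeneous {R : Type*} [CommRing R] {φ ψ : B →+* R}
    (h : ∀ (m : Fin r → ℤ) (b : B), b ∈ 𝒜 m → φ b = ψ b) : φ = ψ := by
  refine RingHom.ext fun b => ?_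
  induction b using DirectSum.Decomposition.inductionOn 𝒜 with
  | zero => simp
  | homogeneous b => exact h _ _ b.2
  | add b c hb hc => rw [map_add, map_add, hb, hc]

theorem scale_eq_zero {T : Scheme.{u}} (s : Torus r T) (φ : B →+* Γ(T, ⊤))
    (hI : I₁.IsHomogeneous 𝒜) (h₁ : ∀ b ∈ I₁, φ b = 0) : ∀ b ∈ I₁, scale 𝒜 s φ b = 0 := by
  classical
  intro b hb
  rw [← DirectSum.sum_support_decompose 𝒜 b, map_sum]
  refine Finset.sum_eq_zero fun m _ => ?_
  rw [scale_apply 𝒜 s φ (SetLike.coe_mem _), h₁ _ (hI m hb), mul_zero]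

theorem scale_mem_basicOpen {T : Scheme.{u}} (s : Torus r T) (φ : B →+* Γ(T, ⊤))
    (hI : I₂.IsHomogeneous 𝒜) (h₂ : ∀ t : T, ∃ b ∈ I₂, t ∈ T.basicOpen (φ b)) :
    ∀ t : T, ∃ b ∈ I₂, t ∈ T.basicOpen (scale 𝒜 s φ b) := by
  classical
  intro t
  by_contra! hcon
  obtain ⟨b, hb, ht⟩ := h₂ t
  rw [Scheme.mem_basicOpen_top, ← DirectSum.sum_support_decompose 𝒜 b, map_sum, map_sum] at ht
  refine (IsLocalRing.mem_maximalIdeal _).mp (Ideal.sum_mem _ fun m _ => ?_) ht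
  rw [IsLocalRing.mem_maximalIdeal]
  intro hu
  refine hcon _ (hI m hb) ?_
  rw [scale_apply 𝒜 s φ (SetLike.coe_mem _), Scheme.mem_basicOpen_top, map_mul]
  exact ((s.char m).isUnit.map _).mul hu

/-- The action of `𝔾_m^r` on `V(I₁) ∖ V(I₂) ⊆ Spec B` for a `ℤ^r`-graded ring `B` and homogeneous
ideals `I₁`, `I₂`: on functions, `b(s * y) = s^m b(y)` for `b` homogeneous of degree `m`. -/
def gradedAction (h₁ : I₁.IsHomogeneous 𝒜) (h₂ : I₂.IsHomogeneous 𝒜) :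
    TorusAction r (locus B I₁ I₂) where
  act s y := locus.ofComorphism (scale 𝒜 s (locus.comorphism y))
    (scale_eq_zero 𝒜 s _ h₁ fun _ => locus.comorphism_eq_zero y)
    (scale_mem_basicOpen 𝒜 s _ h₂ (locus.exists_mem_basicOpen y))
  one_act y := locus.comorphism_injective <| hom_ext_of_homogeneous 𝒜 fun m b hb => by
    rw [locus.comorphism_ofComorphism, scale_apply 𝒜 _ _ hb, Torus.one_char, Units.val_one, one_mul]
  mul_act s t y := locus.comorphism_injective <| hom_ext_of_homogeneous 𝒜 fun m b hb => by
    simp only [locus.comorphism_ofComorphism, scale_apply 𝒜 _ _ hb, Torus.mul_char, Units.val_mul,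
      mul_assoc]
  comp_act h s y := locus.comorphism_injective <| hom_ext_of_homogeneous 𝒜 fun m b hb => by
    simp only [locus.comorphism_ofComorphism, locus.comorphism_comp, scale_apply 𝒜 _ _ hb,
      Torus.res_char, map_mul]

theorem gradedAction_apply (h₁ : I₁.IsHomogeneous 𝒜) (h₂ : I₂.IsHomogeneous 𝒜) {T : Scheme.{u}}
    (s : Torus r T) (y : T ⟶ locus B I₁ I₂) {m : Fin r → ℤ} {b : B} (hb : b ∈ 𝒜 m) :
    locus.comorphism ((gradedAction 𝒜 h₁ h₂).act s y) b = s.char m * locus.comorphism y b := by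
  simp only [gradedAction, locus.comorphism_ofComorphism, scale_apply 𝒜 _ _ hb]

end Grading

/-! ### Twisted affine spaces and their subschemes -/

section Twist

open MvPolynomial

variable {A K : Type u} [CommRing A] [Field K] [Algebra A K]
  {r N : ℕ}

/-- For nonzero fractional ideals `𝔞_1, …, 𝔞_r` and `m ∈ ℤ^r`, the fractional ideal
`𝔞^m = 𝔞_1^{m_1} ⋯ 𝔞_r^{m_r}`. -/
def idealPow (a : Fin r → (FractionalIdeal A⁰ K)ˣ) (m : Fin r → ℤ) : FractionalIdeal A⁰ K :=
  ((∏ j, a j ^ m j : (FractionalIdeal A⁰ K)ˣ) : FractionalIdeal A⁰ K)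

theorem idealPow_zero (a : Fin r → (FractionalIdeal A⁰ K)ˣ) : idealPow a 0 = 1 := by
  simp [idealPow]

theorem idealPow_add (a : Fin r → (FractionalIdeal A⁰ K)ˣ) (m n : Fin r → ℤ) :
    idealPow a (m + n) = idealPow a m * idealPow a n := by
  simp [idealPow, zpow_add, Finset.prod_mul_distrib]

variable (deg : Fin N → Fin r → ℤ) (a : Fin r → (FractionalIdeal A⁰ K)ˣ)

/-- The ring `⨁_m 𝔞^{-m} R_m ⊆ K[x_1, …, x_N]`, where `R_m` is the degree-`m`-part of
`A[x_1, …, x_N]`, graded by `deg x_i = deg i`: since `R_m` is free over `A` on the monomials of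
degree `m`, it consists of the polynomials whose coefficient at each monomial of degree `m` lies in
`𝔞^{-m}`. -/
def twistRing : Subalgebra A (MvPolynomial (Fin N) K) where
  carrier := {p | ∀ d, coeff d p ∈ idealPow a (-(Finsupp.weight deg d))}
  mul_mem' {p q} hp hq d := by
    rw [coeff_mul]
    refine Submodule.sum_mem (idealPow a (-(Finsupp.weight deg d)) : Submodule A K) ?_
    rintro ⟨d₁, d₂⟩ hd
    obtain rfl : d₁ + d₂ = d := Finset.HasAntidiagonal.mem_antidiagonal.mp hd
    rw [map_add, neg_add, idealPow_add]
    exact FractionalIdeal.mul_mem_mul (hp d₁) (hq d₂)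
  add_mem' {p q} hp hq d := by
    rw [coeff_add]
    exact Submodule.add_mem (idealPow a (-(Finsupp.weight deg d)) : Submodule A K) (hp d) (hq d)
  algebraMap_mem' c d := by
    rw [MvPolynomial.algebraMap_apply, coeff_C]
    split_ifs with h
    · subst h
      rw [map_zero, neg_zero, idealPow_zero]
      exact FractionalIdeal.coe_mem_one _ c
    · exact Submodule.zero_mem (idealPow a (-(Finsupp.weight deg d)) : Submodule A K)

/-- The degree-`m`-part of the twisted ring. -/
def twistGrading (m : Fin r → ℤ) : Submodule A (twistRing deg a) :=
  ((weightedHomogeneousSubmodule K deg m).restrictScalars A).comap (twistRing deg a).val.toLinearMap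

theorem mem_twistGrading {m : Fin r → ℤ} {p : twistRing deg a} :
    p ∈ twistGrading deg a m ↔ IsWeightedHomogeneous deg (p : MvPolynomial (Fin N) K) m :=
  Iff.rfl

theorem twistGrading_isInternal : DirectSum.IsInternal (twistGrading deg a) := by
  classical
  have key (x : DirectSum (Fin r → ℤ) fun m => twistGrading deg a m) (m : Fin r → ℤ) :
      weightedHomogeneousComponent deg m
        (DirectSum.coeAddMonoidHom (twistGrading deg a) x : MvPolynomial (Fin N) K)
        = ((x m : twistRing deg a) : MvPolynomial (Fin N) K) := by
    induction x using DirectSum.induction_on with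
    | zero => simp
    | of n p =>
      have hp : IsWeightedHomogeneous deg (p : MvPolynomial (Fin N) K) n := p.2
      rw [DirectSum.coeAddMonoidHom_of]
      by_cases h : n = m
      · subst h
        rw [DirectSum.of_eq_same, IsWeightedHomogeneous.weightedHomogeneousComponent_same hp]
      · rw [DirectSum.of_eq_of_ne _ _ _ (Ne.symm h),
          IsWeightedHomogeneous.weightedHomogeneousComponent_ne m hp (Ne.symm h)]
        rfl
    | add x y hx hy => simp [hx, hy]
  constructor
  · intro x y hxy
    refine DFinsupp.ext fun m => Subtype.ext (Subtype.ext ?_)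
    rw [← key x m, ← key y m, hxy]
  · intro p
    have hc (m : Fin r → ℤ) : weightedHomogeneousComponent deg m (p : MvPolynomial (Fin N) K)
        ∈ twistRing deg a := fun d => by
      rw [coeff_weightedHomogeneousComponent]
      split_ifs
      · exact p.2 d
      · exact Submodule.zero_mem (idealPow a (-(Finsupp.weight deg d)) : Submodule A K)
    refine ⟨∑ m ∈ (p : MvPolynomial (Fin N) K).support.image (Finsupp.weight deg),
      DirectSum.of (fun m => twistGrading deg a m) m ⟨⟨_, hc m⟩,
        weightedHomogeneousComponent_isWeightedHomogeneous m (p : MvPolynomial (Fin N) K)⟩, ?_⟩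
    simp only [map_sum, DirectSum.coeAddMonoidHom_of]
    refine Subtype.ext (MvPolynomial.ext _ _ fun d => ?_)
    rw [AddSubmonoidClass.coe_finsetSum, coeff_sum]
    simp only [coeff_weightedHomogeneousComponent]
    rw [Finset.sum_ite_eq]
    split_ifs with h
    · rfl
    · by_contra hd
      exact h (Finset.mem_image_of_mem _ (mem_support_iff.mpr (Ne.symm hd)))

instance twistGradedAlgebra : GradedAlgebra (twistGrading deg a) where
  one_mem := isWeightedHomogeneous_one K deg
  mul_mem _ _ _ _ hp hq := IsWeightedHomogeneous.mul hp hq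
  toDecomposition := (twistGrading_isInternal deg a).chooseDecomposition

/-- For a homogeneous ideal `I` of `A[x_1, …, x_N]`, the ideal `⨁_m 𝔞^{-m} I_m` of the twisted ring.
It is generated by the products `c f` with `c ∈ 𝔞^{-m}` and `f ∈ I` homogeneous of degree `m`. -/
def twistIdeal (I : Ideal (MvPolynomial (Fin N) A)) : Ideal (twistRing deg a) :=
  Ideal.span {p | ∃ m, ∃ c ∈ idealPow a (-m), ∃ f ∈ I, IsWeightedHomogeneous deg f m ∧
    (p : MvPolynomial (Fin N) K) = C c * map (algebraMap A K) f}

theorem twistIdeal_isHomogeneous (I : Ideal (MvPolynomial (Fin N) A)) :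
    (twistIdeal deg a I).IsHomogeneous (twistGrading deg a) := by
  refine Ideal.homogeneous_span _ _ ?_
  rintro p ⟨m, c, -, f, -, hf, hp⟩
  refine ⟨m, (mem_twistGrading deg a).mpr ?_⟩
  rw [hp]
  have hf' : IsWeightedHomogeneous deg (map (algebraMap A K) f) m := fun d hd =>
    hf fun h => hd (by rw [coeff_map, h, map_zero])
  simpa using (isWeightedHomogeneous_C deg c).mul hf'

/-! ### The torsor and its twists -/

variable {m s : ℕ} (g : Fin s → MvPolynomial (Fin N) A) (f : Fin m → MvPolynomial (Fin N) A)

/-- The scheme `Y = V(g_1, …, g_s) ∖ V(f_1, …, f_m) ⊆ 𝔸^N_A`. -/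
def torsorSpace : Scheme.{u} :=
  locus (MvPolynomial (Fin N) A) (Ideal.span (Set.range g)) (Ideal.span (Set.range f))

/-- The structure morphism `Y ⟶ Spec A`. -/
def torsorSpaceStr : torsorSpace g f ⟶ Spec (CommRingCat.of A) :=
  locus.toSpec _ _ ≫ Spec.map (CommRingCat.ofHom (algebraMap A (MvPolynomial (Fin N) A)))

theorem span_isHomogeneous {n : ℕ} {f : Fin n → MvPolynomial (Fin N) A} {df : Fin n → Fin r → ℤ}
    (hf : ∀ i, IsWeightedHomogeneous deg (f i) (df i)) :
    letI := weightedGradedAlgebra A deg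
    (Ideal.span (Set.range f)).IsHomogeneous (weightedHomogeneousSubmodule A deg) := by
  let := weightedGradedAlgebra A deg
  refine Ideal.homogeneous_span _ _ ?_
  rintro _ ⟨i, rfl⟩
  exact ⟨df i, hf i⟩

/-- The action of `𝔾_m^r` on `Y` by `s * (a_1, …, a_N) = (s^{deg x_1} a_1, …, s^{deg x_N} a_N)`. -/
def torsorAction {dg : Fin s → Fin r → ℤ} {df : Fin m → Fin r → ℤ}
    (hg : ∀ i, IsWeightedHomogeneous deg (g i) (dg i))
    (hf : ∀ i, IsWeightedHomogeneous deg (f i) (df i)) : TorusAction r (torsorSpace g f) :=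
  letI := weightedGradedAlgebra A deg
  gradedAction (weightedHomogeneousSubmodule A deg) (span_isHomogeneous deg hg)
    (span_isHomogeneous deg hf)

/-- The action of `𝔾_m^r` on `Y` in coordinates. -/
theorem torsorAction_X {dg : Fin s → Fin r → ℤ} {df : Fin m → Fin r → ℤ}
    (hg : ∀ i, IsWeightedHomogeneous deg (g i) (dg i))
    (hf : ∀ i, IsWeightedHomogeneous deg (f i) (df i)) {T : Scheme.{u}} (t : Torus r T)
    (y : T ⟶ torsorSpace g f) (i : Fin N) :
    locus.comorphism ((torsorAction deg g f hg hf).act t y) (X i)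
      = t.char (deg i) * locus.comorphism y (X i) :=
  letI := weightedGradedAlgebra A deg
  gradedAction_apply (weightedHomogeneousSubmodule A deg) (span_isHomogeneous deg hg)
    (span_isHomogeneous deg hf) t y (isWeightedHomogeneous_X A deg i)

/-- The twist of `Y` by `𝔞`. -/
def twist : Scheme.{u} :=
  locus (twistRing deg a) (twistIdeal deg a (Ideal.span (Set.range g)))
    (twistIdeal deg a (Ideal.span (Set.range f)))

/-- The structure morphism of the twist over `Spec A`. -/
def twistStr : twist deg a g f ⟶ Spec (CommRingCat.of A) :=
  locus.toSpec _ _ ≫ Spec.map (CommRingCat.ofHom (algebraMap A (twistRing deg a)))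

/-- The action of `𝔾_m^r` on the twist, defined by the grading of the twisted ring. -/
def twistAction : TorusAction r (twist deg a g f) :=
  gradedAction (twistGrading deg a) (twistIdeal_isHomogeneous deg a _)
    (twistIdeal_isHomogeneous deg a _)

/-- Let `U = Spec B` with `A ⊆ B ⊆ K` be an open subscheme of `Spec A` over which `𝔞_j` is generated
by `ρ_j`. A point `y` of the twist lying over a point `t` of `U` is sent to the point `y'` of `Y`
by the isomorphism `φ_ρ` over `U` that is given on coordinates by `x_i ↦ ρ^{-deg x_i} x_i`. As
`𝔞^{-deg x_i} B = ρ^{-deg x_i} B`, this means that `(c x_i)(y) = (c ρ^{deg x_i})(t) · x_i(y')` for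
all `c ∈ 𝔞^{-deg x_i}`, where `c ρ^{deg x_i} ∈ B`. -/
def IsChartImage (B : Subalgebra A K) (ρ : Fin r → Kˣ) {T : Scheme.{u}}
    (t : T ⟶ Spec (CommRingCat.of B)) (y : T ⟶ twist deg a g f) (y' : T ⟶ torsorSpace g f) :
    Prop :=
  y' ≫ torsorSpaceStr g f = y ≫ twistStr deg a g f ∧
  ∀ (i : Fin N) (c : K), c ∈ idealPow a (-(deg i)) →
    ∀ (p : twistRing deg a) (b : B), (p : MvPolynomial (Fin N) K) = C c * X i →
      (b : K) = c * ((∏ j, ρ j ^ deg i j : Kˣ) : K) →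
      locus.comorphism y p = locus.eval t b * locus.comorphism y' (X i)

/-- `ψ` is the `𝔞`-twist of `π : Y ⟶ X`: for every affine open subscheme `U = Spec B` of `Spec A`
over which the fractional ideals `𝔞_j` are principal, and all generators `ρ_j` of `𝔞_j B`, the
restriction of `ψ` over `U` is `π ∘ φ_ρ`. -/
def IsTwistedProjection {S : Scheme.{u}} (π : torsorSpace g f ⟶ S) (ψ : twist deg a g f ⟶ S) :
    Prop :=
  ∀ (B : Subalgebra A K), IsOpenImmersion (Spec.map (CommRingCat.ofHom (algebraMap A B))) →
    ∀ ρ : Fin r → Kˣ,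
    (∀ j, Submodule.span B {x : K | x ∈ (a j : FractionalIdeal A⁰ K)}
      = Submodule.span B {(ρ j : K)}) →
    ∀ (T : Scheme.{u}) (t : T ⟶ Spec (CommRingCat.of B)) (y : T ⟶ twist deg a g f),
      t ≫ Spec.map (CommRingCat.ofHom (algebraMap A B)) = y ≫ twistStr deg a g f →
      ∃ y' : T ⟶ torsorSpace g f, IsChartImage deg a g f B ρ t y y' ∧ y ≫ ψ = y' ≫ π

/-- The set of `A`-points of an `A`-scheme. -/
def IntegralPoint (A : Type u) [CommRing A] {Y : Scheme.{u}}
    (p : Y ⟶ Spec (CommRingCat.of A)) : Type u :=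
  {y : Spec (CommRingCat.of A) ⟶ Y // y ≫ p = 𝟙 _}

/-- The inclusion `Spec K ⟶ Spec A` of the generic point. -/
def genericPt (A K : Type u) [CommRing A] [Field K] [Algebra A K] :
    Spec (CommRingCat.of K) ⟶ Spec (CommRingCat.of A) :=
  Spec.map (CommRingCat.ofHom (algebraMap A K))

/-- The set `X_K(K)` of rational points of the generic fibre `X_K = X ×_A K`. -/
def RationalPoint (A K : Type u) [CommRing A] [Field K] [Algebra A K] {X : Scheme.{u}}
    (p : X ⟶ Spec (CommRingCat.of A)) : Type u :=
  {x : Spec (CommRingCat.of K) ⟶ pullback p (genericPt A K) // x ≫ pullback.snd _ _ = 𝟙 _}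

/-- The image in `X_K(K)` of the set of `A`-points of `Y` under a morphism `ψ : Y ⟶ X`, by base
extension. -/
def imageOfIntegralPoints (A K : Type u) [CommRing A] [Field K] [Algebra A K] {X Y : Scheme.{u}}
    (pX : X ⟶ Spec (CommRingCat.of A)) (pY : Y ⟶ Spec (CommRingCat.of A)) (ψ : Y ⟶ X) :
    Set (RationalPoint A K pX) :=
  {x | ∃ y : IntegralPoint A pY, x.1 ≫ pullback.fst _ _ = genericPt A K ≫ y.1 ≫ ψ}

/-- `v ∈ K^N` is the coordinate vector of the `A`-point `y` of the twist, that is, the `K`-point of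
`𝔸^N_K = Spec K[x_1, …, x_N]` obtained from `y` by base extension. -/
def IsCoordinateVector (y : IntegralPoint A (twistStr deg a g f)) (v : Fin N → K) : Prop :=
  ∀ p : twistRing deg a,
    algebraMap A K ((Scheme.ΓSpecIso (CommRingCat.of A)).hom.hom (locus.comorphism y.1 p))
      = MvPolynomial.eval v (p : MvPolynomial (Fin N) K)

/-- The set of all `v ∈ K^N` with `v_i ∈ 𝔞^{deg x_i}`, satisfying the coprimality condition
`∑ f_i(v) 𝔞^{-deg f_i} = A` and the torsor equations `g_j(v) = 0`. -/
def integralCoordinates [IsFractionRing A K] (df : Fin m → Fin r → ℤ) : Set (Fin N → K) :=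
  {v | (∀ i, v i ∈ idealPow a (deg i)) ∧
    (∑ i, FractionalIdeal.spanSingleton A⁰ (aeval v (f i)) * idealPow a (-(df i))) = 1 ∧
    ∀ j, aeval v (g j) = 0}

end Twist

/-! ### Étale cohomology of the torus in degree one -/

section Cohomology

variable (r : ℕ) {X : Scheme.{u}}

/-- Étale coverings of `X`. -/
abbrev EtaleCover (X : Scheme.{u}) : Type (u + 1) := Scheme.Cover.{u} Scheme.etalePrecoverage X

/-- Čech 1-cochains of an étale covering with values in `𝔾_m^r`. -/
abbrev Cochain (𝒰 : EtaleCover X) : Type u :=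
  ∀ i j : 𝒰.I₀, Torus r (pullback (𝒰.f i) (𝒰.f j))

/-- Čech 1-cocycles: `g_ij g_jk = g_ik` on `U_i ×_X U_j ×_X U_k`. -/
def cocycles (𝒰 : EtaleCover X) : Subgroup (Cochain r 𝒰) where
  carrier := {g | ∀ (i j k : 𝒰.I₀) (T : Scheme.{u}) (x : T ⟶ 𝒰.X i) (y : T ⟶ 𝒰.X j)
    (z : T ⟶ 𝒰.X k) (hxy : x ≫ 𝒰.f i = y ≫ 𝒰.f j) (hyz : y ≫ 𝒰.f j = z ≫ 𝒰.f k),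
    Torus.res (pullback.lift x y hxy) (g i j) * Torus.res (pullback.lift y z hyz) (g j k)
      = Torus.res (pullback.lift x z (hxy.trans hyz)) (g i k)}
  one_mem' := by intro i j k T x y z hxy hyz; simp
  mul_mem' {g h} hg hh := by
    intro i j k T x y z hxy hyz
    simp only [Pi.mul_apply, map_mul]
    rw [mul_mul_mul_comm, hg, hh]
  inv_mem' {g} hg := by
    intro i j k T x y z hxy hyz
    simp only [Pi.inv_apply, map_inv]
    rw [← hg i j k T x y z hxy hyz, mul_inv]

/-- Čech 1-coboundaries. -/
def coboundaries (𝒰 : EtaleCover X) : Subgroup (cocycles r 𝒰) where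
  carrier := {g | ∃ w : ∀ i, Torus r (𝒰.X i), ∀ i j,
    g.1 i j = Torus.res (pullback.fst _ _) (w i) * (Torus.res (pullback.snd _ _) (w j))⁻¹}
  one_mem' := ⟨fun _ => 1, fun i j => by simp⟩
  mul_mem' {g h} := by
    rintro ⟨v, hv⟩ ⟨w, hw⟩
    refine ⟨fun i => v i * w i, fun i j => ?_⟩
    simp only [Subgroup.coe_mul, Pi.mul_apply, map_mul, hv, hw, mul_inv]
    exact mul_mul_mul_comm _ _ _ _
  inv_mem' {g} := by
    rintro ⟨v, hv⟩
    refine ⟨fun i => (v i)⁻¹, fun i j => ?_⟩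
    simp only [Subgroup.coe_inv, Pi.inv_apply, map_inv, hv, mul_inv, inv_inv]

/-- The Čech cohomology group of an étale covering with values in `𝔾_m^r`, in degree one. -/
def CechH1 (𝒰 : EtaleCover X) : Type u := cocycles r 𝒰 ⧸ coboundaries r 𝒰

instance (𝒰 : EtaleCover X) : CommGroup (CechH1 r 𝒰) :=
  inferInstanceAs (CommGroup (cocycles r 𝒰 ⧸ coboundaries r 𝒰))

theorem Torus.res_res {r : ℕ} {T T' T'' : Scheme.{u}} (h' : T'' ⟶ T') (h : T' ⟶ T)
    (s : Torus r T) : Torus.res h' (Torus.res h s) = Torus.res (h' ≫ h) s := by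
  funext j
  refine Units.ext ?_
  change h'.appTop.hom (h.appTop.hom (s j)) = (h' ≫ h).appTop.hom (s j)
  rw [Scheme.Hom.comp_appTop]
  rfl

/-- A refinement of an étale covering `𝒰` by an étale covering `𝒱`. -/
abbrev Refinement (𝒰 𝒱 : EtaleCover X) : Type u :=
  𝒱.toPreZeroHypercover.Hom 𝒰.toPreZeroHypercover

/-- The map between the overlaps of two étale coverings given by a refinement. -/
def Refinement.overlap {𝒰 𝒱 : EtaleCover X} (h : Refinement 𝒰 𝒱) (i j : 𝒱.I₀) :
    pullback (𝒱.f i) (𝒱.f j) ⟶ pullback (𝒰.f (h.s₀ i)) (𝒰.f (h.s₀ j)) :=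
  pullback.lift (pullback.fst _ _ ≫ h.h₀ i) (pullback.snd _ _ ≫ h.h₀ j)
    (by simp [pullback.condition])

theorem Refinement.overlap_fst {𝒰 𝒱 : EtaleCover X} (h : Refinement 𝒰 𝒱) (i j : 𝒱.I₀) :
    h.overlap i j ≫ pullback.fst _ _ = pullback.fst _ _ ≫ h.h₀ i :=
  pullback.lift_fst _ _ _

theorem Refinement.overlap_snd {𝒰 𝒱 : EtaleCover X} (h : Refinement 𝒰 𝒱) (i j : 𝒱.I₀) :
    h.overlap i j ≫ pullback.snd _ _ = pullback.snd _ _ ≫ h.h₀ j :=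
  pullback.lift_snd _ _ _

theorem Refinement.lift_overlap {𝒰 𝒱 : EtaleCover X} (h : Refinement 𝒰 𝒱) {i j : 𝒱.I₀}
    {T : Scheme.{u}} (x : T ⟶ 𝒱.X i) (y : T ⟶ 𝒱.X j) (hxy : x ≫ 𝒱.f i = y ≫ 𝒱.f j)
    (hxy' : (x ≫ h.h₀ i) ≫ 𝒰.f (h.s₀ i) = (y ≫ h.h₀ j) ≫ 𝒰.f (h.s₀ j)) :
    pullback.lift x y hxy ≫ h.overlap i j = pullback.lift (x ≫ h.h₀ i) (y ≫ h.h₀ j) hxy' := by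
  refine pullback.hom_ext ?_ ?_
  · rw [Category.assoc, h.overlap_fst, pullback.lift_fst, ← Category.assoc, pullback.lift_fst]
  · rw [Category.assoc, h.overlap_snd, pullback.lift_snd, ← Category.assoc, pullback.lift_snd]

/-- Restriction of cocycles along a refinement of étale coverings. -/
def refineCocycles {𝒰 𝒱 : EtaleCover X} (h : Refinement 𝒰 𝒱) : cocycles r 𝒰 →* cocycles r 𝒱 where
  toFun g := ⟨fun i j => Torus.res (h.overlap i j) (g.1 (h.s₀ i) (h.s₀ j)), by
    intro i j k T x y z hxy hyz
    have hxy' : (x ≫ h.h₀ i) ≫ 𝒰.f (h.s₀ i) = (y ≫ h.h₀ j) ≫ 𝒰.f (h.s₀ j) := by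
      simpa using hxy
    have hyz' : (y ≫ h.h₀ j) ≫ 𝒰.f (h.s₀ j) = (z ≫ h.h₀ k) ≫ 𝒰.f (h.s₀ k) := by
      simpa using hyz
    rw [Torus.res_res, Torus.res_res, Torus.res_res, h.lift_overlap x y hxy hxy',
      h.lift_overlap y z hyz hyz', h.lift_overlap x z (hxy.trans hyz) (hxy'.trans hyz')]
    exact g.2 (h.s₀ i) (h.s₀ j) (h.s₀ k) T _ _ _ hxy' hyz'⟩
  map_one' := by ext : 1; funext i j; exact map_one (Torus.res (h.overlap i j))
  map_mul' g g' := by ext : 1; funext i j; exact map_mul (Torus.res (h.overlap i j)) _ _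

/-- Restriction of Čech cohomology classes along a refinement of étale coverings. -/
def refineH1 {𝒰 𝒱 : EtaleCover X} (h : Refinement 𝒰 𝒱) : CechH1 r 𝒰 →* CechH1 r 𝒱 :=
  QuotientGroup.map (coboundaries r 𝒰) (coboundaries r 𝒱) (refineCocycles r h) (by
    rintro g ⟨w, hw⟩
    refine ⟨fun i => Torus.res (h.h₀ i) (w (h.s₀ i)), fun i j => ?_⟩
    change Torus.res (h.overlap i j) (g.1 (h.s₀ i) (h.s₀ j)) = _
    rw [hw, map_mul, map_inv, Torus.res_res, Torus.res_res, h.overlap_fst, h.overlap_snd,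
      Torus.res_res, Torus.res_res])

/-- Étale coverings are ordered by refinement. -/
instance : Preorder (EtaleCover X) where
  le 𝒰 𝒱 := Nonempty (Refinement 𝒰 𝒱)
  le_refl _ := ⟨PreZeroHypercover.Hom.id _⟩
  le_trans _ _ _ := fun ⟨h⟩ ⟨h'⟩ => ⟨h'.comp h⟩

/-- The transition maps between the Čech cohomology groups. They do not depend on the chosen
refinement. -/
def transition (X : Scheme.{u}) (𝒰 𝒱 : EtaleCover X) (h : 𝒰 ≤ 𝒱) :
    Additive (CechH1 r 𝒰) →+ Additive (CechH1 r 𝒱) :=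
  MonoidHom.toAdditive (refineH1 r (Classical.choice h))

open Classical in
/-- The étale cohomology group `H^1_ét(X, 𝔾_m^r)`, written additively: the direct limit of the Čech
cohomology groups over all étale coverings of `X`. -/
def EtaleH1 (X : Scheme.{u}) : Type (u + 1) :=
  AddCommGroup.DirectLimit (fun 𝒰 : EtaleCover X => Additive (CechH1 r 𝒰)) (transition r X)

open Classical in
instance (X : Scheme.{u}) : AddCommGroup (EtaleH1 r X) :=
  inferInstanceAs (AddCommGroup (AddCommGroup.DirectLimit
    (fun 𝒰 : EtaleCover X => Additive (CechH1 r 𝒰)) (transition r X)))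

open Classical in
/-- The class in `H^1_ét(X, 𝔾_m^r)` of a Čech cocycle. -/
def EtaleH1.mk {r : ℕ} (𝒰 : EtaleCover X) (g : cocycles r 𝒰) : EtaleH1 r X :=
  AddCommGroup.DirectLimit.of (fun 𝒰 : EtaleCover X => Additive (CechH1 r 𝒰)) (transition r X) 𝒰
    (Additive.ofMul (QuotientGroup.mk g : cocycles r 𝒰 ⧸ coboundaries r 𝒰))

/-- `z` is the class of the torsor `π : Y ⟶ X`: for some étale covering `(U_i)` with sections `s_i`
of `Y` over `U_i`, it is the class of the cocycle `(g_ij)` with `s_i = g_ij s_j`. -/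
def IsTorsorClass {r : ℕ} {Y : Scheme.{u}} (α : TorusAction r Y) (π : Y ⟶ X) (z : EtaleH1 r X) :
    Prop :=
  ∃ (𝒰 : EtaleCover X) (σ : ∀ i, 𝒰.X i ⟶ Y) (g : cocycles r 𝒰),
    (∀ i, σ i ≫ π = 𝒰.f i) ∧
    (∀ i j, pullback.fst (𝒰.f i) (𝒰.f j) ≫ σ i
      = α.act (g.1 i j) (pullback.snd (𝒰.f i) (𝒰.f j) ≫ σ j)) ∧
    z = EtaleH1.mk 𝒰 g

/-- For a point `t : T ⟶ Spec A`, an isomorphism of line bundles from the pullback of the fractional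
ideal `I` to `𝒪_T`: an `A`-linear map from `I` to `Γ(T, 𝒪)` whose values generate `𝒪_T`. -/
structure Trivialization {A K : Type u} [CommRing A] [Field K] [Algebra A K]
    (I : FractionalIdeal A⁰ K) {T : Scheme.{u}} (t : T ⟶ Spec (CommRingCat.of A)) where
  toLinearMap : (I : Submodule A K) →ₛₗ[locus.eval t] Γ(T, ⊤)
  generates : ∀ x : T, ∃ c, x ∈ T.basicOpen (toLinearMap c)

/-- `z` is the class `[𝔞]` in `H^1_ét(X, 𝔾_m^r)`, that is, the image under
`Pic(A)^r ≅ H^1_ét(Spec A, 𝔾_m^r) → H^1_ét(X, 𝔾_m^r)` of the classes of `𝔞_1, …, 𝔞_r`: for some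
étale covering `(U_i)` and trivializations `θ_i` of the pullbacks of `𝔞_1, …, 𝔞_r` to `U_i`, it is
the class of the cocycle of transition functions `g_ij = θ_i ∘ θ_j⁻¹`. -/
def IsIdealClass {A K : Type u} [CommRing A] [Field K] [Algebra A K] {r : ℕ}
    (a : Fin r → (FractionalIdeal A⁰ K)ˣ) (p : X ⟶ Spec (CommRingCat.of A)) (z : EtaleH1 r X) :
    Prop :=
  ∃ (𝒰 : EtaleCover X)
    (θ : ∀ i k, Trivialization (a k : FractionalIdeal A⁰ K) (𝒰.f i ≫ p)) (g : cocycles r 𝒰),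
    (∀ i j k c, (pullback.fst (𝒰.f i) (𝒰.f j)).appTop.hom ((θ i k).toLinearMap c)
      = (g.1 i j k : Γ(pullback (𝒰.f i) (𝒰.f j), ⊤))
        * (pullback.snd (𝒰.f i) (𝒰.f j)).appTop.hom ((θ j k).toLinearMap c)) ∧
    z = EtaleH1.mk 𝒰 g

end Cohomology

end

end TwistedTorsor

namespace TwistedTorsor

noncomputable section

open MvPolynomial

/-! ### Frames of tuples of fractional ideals -/

section Frames

variable {A K : Type u} [CommRing A] [Field K] [Algebra A K] {r N : ℕ}

/-! A frame along `φ : A → R` is a multiplicative family `Θ_m` of trivializations of the pullbacks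
of all the ideals `𝔞^m`. Once a frame is given, the twist has the same points as `Y`: the
homomorphisms over `φ` from the twisted ring to `R` are exactly the maps `c x^d ↦ Θ_{-deg d}(c)
ψ(x^d)`, where `ψ` is a homomorphism over `φ` from the polynomial ring (`Frame.lift`,
`Frame.exists_lift_eq`). As the values of each `Θ_m` generate the unit ideal, the equations and the
nonvanishing conditions correspond as well (`Frame.exists_matches_right`,
`Frame.exists_matches_left`). Two frames along the same `φ` differ by a point of the torus
(`Frame.exists_ratio`), and changing the frame moves the matched point of `Y` by that point. Since
`π` is invariant, its value at the matched point does not depend on the frame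
(`Frame.Matches.comp_eq`). Invertible ideals are locally principal, so frames exist locally on `Spec
A` (`exists_chart`), and the local values of `π` glue to the twisted projection.

(i) Over a chart the twist is equivariantly isomorphic to `Y` over `X`, and being a torsor is a
local property. If local sections of `Y` satisfy `σ_i = γ_ij σ_j` and local frames satisfy `Θ_i =
η_ij Θ_j` on the ideals `𝔞_k`, then the matched sections of the twist satisfy `y_i = γ_ij η_ij⁻¹
y_j` (`Frame.Matches.eq_act`). This is the class `[Y] - [𝔞]`.

(iii) Over `K` there is the tautological frame `c ↦ c`, which turns an `A`-point of the twist into a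
vector `v`. A vector arises from a homomorphism of the twisted ring to `A` exactly when every `c
v_i` with `c ∈ 𝔞^{-deg x_i}` is in `A`, that is, `v_i ∈ 𝔞^{deg x_i}`. Coprimality says that modulo
every maximal ideal some `c f_i` is nonzero.

(ii) A `K`-point of `X` lifts to a point `z` of `Y`, unique up to `(Kˣ)^r`, because the torsor has
sections Zariski-locally: Laurent monomials in the coordinates that are nonzero at a point define an
equivariant map to the torus near that point (`IsTorsor.exists_local_section`). At a prime `w` the
conditions of (iii) involve only the orders `e` of the `𝔞_j` (`IsPrimitiveAt`), and for `e = 0` they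
say that `z` extends to `Y` over the valuation ring at `w`. Properness of `X` yields some `e`,
separatedness its uniqueness, and `e = 0` is possible at almost all primes. So `z` has integral
coordinates for exactly one tuple `𝔞(z)`. As `𝔞(ρ z) = ρ 𝔞(z)`, the class of this tuple depends only
on the point of `X`, and exactly one tuple of representatives has this class. -/

theorem algebraMap_mul_mem_idealPow {a : Fin r → (FractionalIdeal A⁰ K)ˣ} {m : Fin r → ℤ} (x : A)
    {c : K} (hc : c ∈ idealPow a m) : algebraMap A K x * c ∈ idealPow a m := by
  rw [← Algebra.smul_def]
  exact Submodule.smul_mem (idealPow a m : Submodule A K) x hc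

theorem algebraMap_mem_idealPow_zero (a : Fin r → (FractionalIdeal A⁰ K)ˣ) (x : A) :
    algebraMap A K x ∈ idealPow a 0 := by
  rw [idealPow_zero]
  exact FractionalIdeal.coe_mem_one _ x

theorem mul_mem_idealPow {a : Fin r → (FractionalIdeal A⁰ K)ˣ} {m n : Fin r → ℤ}
    {c d : K} (hc : c ∈ idealPow a m) (hd : d ∈ idealPow a n) : c * d ∈ idealPow a (m + n) := by
  rw [idealPow_add]
  exact FractionalIdeal.mul_mem_mul hc hd

theorem add_mem_idealPow {a : Fin r → (FractionalIdeal A⁰ K)ˣ} {m : Fin r → ℤ}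
    {c d : K} (hc : c ∈ idealPow a m) (hd : d ∈ idealPow a m) : c + d ∈ idealPow a m :=
  Submodule.add_mem (idealPow a m : Submodule A K) hc hd

theorem zero_mem_idealPow (a : Fin r → (FractionalIdeal A⁰ K)ˣ) (m : Fin r → ℤ) :
    (0 : K) ∈ idealPow a m :=
  Submodule.zero_mem (idealPow a m : Submodule A K)

/-- An additive property of the elements of `𝔞^{m+n}` can be checked on products. -/
theorem idealPow_add_induction {a : Fin r → (FractionalIdeal A⁰ K)ˣ} {m n : Fin r → ℤ}
    {P : K → Prop} (hmul : ∀ c ∈ idealPow a m, ∀ d ∈ idealPow a n, P (c * d))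
    (hadd : ∀ c ∈ idealPow a (m + n), ∀ d ∈ idealPow a (m + n), P c → P d → P (c + d))
    {x : K} (hx : x ∈ idealPow a (m + n)) : P x := by
  have hx' : x ∈ (idealPow a m : Submodule A K) * (idealPow a n : Submodule A K) := by
    rw [← FractionalIdeal.coe_mul, ← idealPow_add]
    exact hx
  refine (Submodule.mul_induction_on (C := fun x => x ∈ idealPow a (m + n) ∧ P x) hx'
    (fun c hc d hd => ⟨mul_mem_idealPow hc hd, hmul c hc d hd⟩) ?_).2
  rintro c d ⟨hc, hc'⟩ ⟨hd, hd'⟩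
  exact ⟨add_mem_idealPow hc hd, hadd c hc d hd hc' hd'⟩

/-- A frame of the pullbacks of `𝔞_1, …, 𝔞_r` along `φ : A → R`: compatible trivializations of
the pullbacks of all the fractional ideals `𝔞^m`. -/
structure Frame (a : Fin r → (FractionalIdeal A⁰ K)ˣ) {R : Type*} [CommRing R] (φ : A →+* R) where
  toFun : (Fin r → ℤ) → K → R
  map_algebraMap : ∀ x, toFun 0 (algebraMap A K x) = φ x
  map_add : ∀ {m c d}, c ∈ idealPow a m → d ∈ idealPow a m →
    toFun m (c + d) = toFun m c + toFun m d
  map_mul : ∀ {m n c d}, c ∈ idealPow a m → d ∈ idealPow a n →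
    toFun (m + n) (c * d) = toFun m c * toFun n d

namespace Frame

variable {a : Fin r → (FractionalIdeal A⁰ K)ˣ} {R S : Type*} [CommRing R] [CommRing S]
  {φ : A →+* R} (Θ : Frame a φ)

include Θ in
theorem map_smul {m : Fin r → ℤ} {c : K} (x : A) (hc : c ∈ idealPow a m) :
    Θ.toFun m (algebraMap A K x * c) = φ x * Θ.toFun m c := by
  have := Θ.map_mul (algebraMap_mem_idealPow_zero a x) hc
  rwa [zero_add, Θ.map_algebraMap] at this

theorem map_zero (m : Fin r → ℤ) : Θ.toFun m 0 = 0 := by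
  have := Θ.map_smul 0 (zero_mem_idealPow a m)
  rwa [RingHom.map_zero, RingHom.map_zero, zero_mul, zero_mul] at this

theorem map_one : Θ.toFun 0 1 = 1 := by
  have := Θ.map_algebraMap 1
  rwa [RingHom.map_one, RingHom.map_one] at this

/-- The image of a frame under a ring homomorphism. -/
def map (ψ : R →+* S) : Frame a (ψ.comp φ) where
  toFun m c := ψ (Θ.toFun m c)
  map_algebraMap x := by rw [Θ.map_algebraMap]; rfl
  map_add hc hd := by rw [Θ.map_add hc hd, _root_.map_add]
  map_mul hc hd := by rw [Θ.map_mul hc hd, _root_.map_mul]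

/-- Semilinear maps on `𝔞^m` are multiples of the trivialization in the frame. -/
theorem exists_factor (m : Fin r → ℤ) {l : K → R}
    (hadd : ∀ c ∈ idealPow a m, ∀ d ∈ idealPow a m, l (c + d) = l c + l d)
    (hsmul : ∀ (x : A), ∀ c ∈ idealPow a m, l (algebraMap A K x * c) = φ x * l c) :
    ∃ w, ∀ c ∈ idealPow a m, l c = Θ.toFun m c * w := by
  have key : ∀ x : K, x ∈ idealPow a (-m + m) →
      ∃ w, ∀ c ∈ idealPow a m, l (x * c) = Θ.toFun m c * w := by
    intro x hx
    refine idealPow_add_induction (P := fun x => ∃ w, ∀ c ∈ idealPow a m, l (x * c)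
      = Θ.toFun m c * w) ?_ ?_ hx
    · intro e he z hz
      -- Since `c e ∈ A`, semilinearity gives `l(e z c) = φ(c e) l(z)`, and `φ(c e)` splits as
      -- `Θ_m(c) Θ_{-m}(e)`.
      refine ⟨Θ.toFun (-m) e * l z, fun c hc => ?_⟩
      have hce := mul_mem_idealPow hc he
      rw [add_neg_cancel, idealPow_zero, FractionalIdeal.mem_one_iff] at hce
      obtain ⟨b, hb⟩ := hce
      rw [← mul_assoc, ← Θ.map_mul hc he, add_neg_cancel, ← hb, Θ.map_algebraMap, ← hsmul _ _ hz,
        hb]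
      congr 1
      ring
    · rintro x hx y hy ⟨w, hw⟩ ⟨w', hw'⟩
      refine ⟨w + w', fun c hc => ?_⟩
      have h : ∀ x ∈ idealPow a (-m + m), x * c ∈ idealPow a m := fun x hx => by
        simpa using mul_mem_idealPow hx hc
      rw [add_mul, hadd _ (h x hx) _ (h y hy), hw c hc, hw' c hc, mul_add]
  have h1 : (1 : K) ∈ idealPow a (-m + m) := by
    rw [neg_add_cancel, ← RingHom.map_one (algebraMap A K)]
    exact algebraMap_mem_idealPow_zero a 1
  simpa using key 1 h1

/-- The values of the trivializations in a frame generate the unit ideal. -/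
theorem exists_notMem (m : Fin r → ℤ) {I : Ideal R} (hI : I ≠ ⊤) :
    ∃ c ∈ idealPow a m, Θ.toFun m c ∉ I := by
  by_contra! h
  have key : ∀ x : K, x ∈ idealPow a (-m + m) → Θ.toFun 0 x ∈ I := by
    intro x hx
    refine idealPow_add_induction (P := fun x => Θ.toFun 0 x ∈ I) ?_ ?_ hx
    · intro e he z hz
      have := Θ.map_mul he hz
      rw [neg_add_cancel] at this
      rw [this]
      exact I.mul_mem_left _ (h z hz)
    · intro x hx y hy hx' hy'
      rw [neg_add_cancel] at hx hy
      rw [Θ.map_add hx hy]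
      exact I.add_mem hx' hy'
  refine hI ((Ideal.eq_top_iff_one I).mpr ?_)
  rw [← Θ.map_one]
  refine key 1 ?_
  rw [neg_add_cancel, ← RingHom.map_one (algebraMap A K)]
  exact algebraMap_mem_idealPow_zero a 1

/-- An element of the target is determined by its products with the values of a frame. -/
theorem eq_of_forall_mul_eq (m : Fin r → ℤ) {w w' : R}
    (h : ∀ c ∈ idealPow a m, Θ.toFun m c * w = Θ.toFun m c * w') : w = w' := by
  by_contra hne
  -- The annihilator of `w - w'` contains all values of `Θ_m` on `𝔞^m`, so it cannot be a proper
  -- ideal.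
  let I : Ideal R := (Submodule.span R {w - w'}).annihilator
  have hI : ∀ x, x ∈ I ↔ x * (w - w') = 0 := fun x => by
    rw [Submodule.mem_annihilator_span_singleton, smul_eq_mul]
  obtain ⟨c, hc, hc'⟩ := Θ.exists_notMem (I := I) m (fun htop => hne (sub_eq_zero.mp (by
    have := (hI 1).mp (htop ▸ Submodule.mem_top)
    rwa [one_mul] at this)))
  exact hc' ((hI _).mpr (by rw [mul_sub, h c hc, sub_self]))

/-- The factors `w m` with `Θ'_m = Θ_m · w m` are unique, hence multiplicative in `m`. A character
of `ℤ^r` takes values in units and is determined by its values at the basis vectors. -/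
theorem exists_ratio (Θ' : Frame a φ) :
    ∃ s : Fin r → Rˣ, ∀ (m : Fin r → ℤ), ∀ c ∈ idealPow a m,
      Θ'.toFun m c = Θ.toFun m c * ((∏ j, s j ^ m j : Rˣ) : R) := by
  have h (Θ Θ' : Frame a φ) (m : Fin r → ℤ) :
      ∃ w, ∀ c ∈ idealPow a m, Θ'.toFun m c = Θ.toFun m c * w :=
    Θ.exists_factor m (fun c hc d hd => Θ'.map_add hc hd) (fun x c hc => Θ'.map_smul x hc)
  choose w hw using h Θ Θ'
  have hzero : w 0 = 1 := Θ.eq_of_forall_mul_eq 0 fun c hc => by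
    rw [← hw 0 c hc, mul_one]
    rw [idealPow_zero, FractionalIdeal.mem_one_iff] at hc
    obtain ⟨x, rfl⟩ := hc
    rw [Θ.map_algebraMap, Θ'.map_algebraMap]
  have hadd (m n : Fin r → ℤ) : w (m + n) = w m * w n := by
    refine Θ.eq_of_forall_mul_eq m fun c hc => Θ.eq_of_forall_mul_eq n fun d hd => ?_
    have h1 := Θ'.map_mul hc hd
    rw [hw _ _ (mul_mem_idealPow hc hd), hw _ _ hc, hw _ _ hd, Θ.map_mul hc hd] at h1
    linear_combination h1
  let W : Multiplicative (Fin r → ℤ) →* Rˣ := MonoidHom.toHomUnits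
    { toFun := fun m => w m.toAdd, map_one' := hzero, map_mul' := fun m n => hadd _ _ }
  have hW (m : Fin r → ℤ) : ((W (Multiplicative.ofAdd m) : Rˣ) : R) = w m := rfl
  refine ⟨fun j => W (Multiplicative.ofAdd (Pi.single j 1)), fun m c hc => ?_⟩
  rw [hw m c hc]
  congr 1
  rw [← hW]
  congr 1
  have hm : m = ∑ j, m j • (Pi.single j 1 : Fin r → ℤ) := by
    funext k
    simp [Finset.sum_apply, Pi.single_apply]
  conv_lhs => rw [hm]
  rw [ofAdd_sum, map_prod]
  refine Finset.prod_congr rfl fun j _ => ?_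
  rw [ofAdd_zsmul, map_zpow]

end Frame

/-! ### Homomorphisms from the twisted ring -/

variable (deg : Fin N → Fin r → ℤ) (a : Fin r → (FractionalIdeal A⁰ K)ˣ)

theorem monomial_mem_twistRing {d : Fin N →₀ ℕ} {c : K}
    (hc : c ∈ idealPow a (-(Finsupp.weight deg d))) : monomial d c ∈ twistRing deg a := by
  classical
  intro d'
  rw [coeff_monomial]
  split_ifs with h
  · rwa [← h]
  · exact zero_mem_idealPow _ _

theorem C_mul_X_mem_twistRing {i : Fin N} {c : K} (hc : c ∈ idealPow a (-(deg i))) :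
    C c * X i ∈ twistRing deg a := by
  rw [C_mul_X_eq_monomial]
  refine monomial_mem_twistRing deg a ?_
  rwa [Finsupp.weight_single, one_smul]

theorem twistRing_induction {P : twistRing deg a → Prop}
    (hmon : ∀ (d : Fin N →₀ ℕ) (c : K) (hc : c ∈ idealPow a (-(Finsupp.weight deg d))),
      P ⟨monomial d c, monomial_mem_twistRing deg a hc⟩)
    (hadd : ∀ p q, P p → P q → P (p + q)) (p : twistRing deg a) : P p := by
  have h0 : P 0 := by
    have := hmon 0 0 (zero_mem_idealPow _ _)
    convert this
    simp
  have hp : p = ∑ d ∈ (p : MvPolynomial (Fin N) K).support,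
      ⟨monomial d (coeff d (p : MvPolynomial (Fin N) K)),
        monomial_mem_twistRing deg a (p.2 d)⟩ := by
    refine Subtype.ext ?_
    rw [AddSubmonoidClass.coe_finsetSum]
    exact (p : MvPolynomial (Fin N) K).as_sum
  rw [hp]
  exact Finset.sum_induction _ P hadd h0 fun d _ => hmon d _ (p.2 d)

variable {deg a}

/-- A single `c x^(d + d')` need not factor, but `𝔞^{-deg(d + d')}` is additively generated by
products from `𝔞^{-deg d}` and `𝔞^{-deg d'}`. This allows an induction on the exponent. -/
theorem twistRing_hom_ext {R : Type*} [CommRing R] {α β : twistRing deg a →+* R}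
    (hA : ∀ x : A, α (algebraMap A _ x) = β (algebraMap A _ x))
    (hX : ∀ (i : Fin N) (c : K) (hc : c ∈ idealPow a (-(deg i))),
      α ⟨C c * X i, C_mul_X_mem_twistRing deg a hc⟩
        = β ⟨C c * X i, C_mul_X_mem_twistRing deg a hc⟩) : α = β := by
  let Q (d : Fin N →₀ ℕ) : Prop := ∀ (c : K) (hc : c ∈ idealPow a (-(Finsupp.weight deg d))),
    α ⟨monomial d c, monomial_mem_twistRing deg a hc⟩
      = β ⟨monomial d c, monomial_mem_twistRing deg a hc⟩
  have h0 : Q 0 := by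
    intro c hc
    have hc' := hc
    rw [_root_.map_zero, neg_zero, idealPow_zero, FractionalIdeal.mem_one_iff] at hc'
    obtain ⟨x, rfl⟩ := hc'
    exact hA x
  have hadd (d d' : Fin N →₀ ℕ) (hd : Q d) (hd' : Q d') : Q (d + d') := by
    intro c hc
    have hw : -(Finsupp.weight deg (d + d')) = -(Finsupp.weight deg d) + -(Finsupp.weight deg d') := by
      rw [map_add, neg_add]
    -- Quantifying over all `p` with the given underlying polynomial keeps membership proofs out of
    -- the additive induction on `c`.
    have key : ∀ c ∈ idealPow a (-(Finsupp.weight deg d) + -(Finsupp.weight deg d')),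
        ∀ p : twistRing deg a, (p : MvPolynomial (Fin N) K) = monomial (d + d') c → α p = β p := by
      intro c hc
      refine idealPow_add_induction (P := fun c => ∀ p : twistRing deg a,
        (p : MvPolynomial (Fin N) K) = monomial (d + d') c → α p = β p) ?_ ?_ hc
      · intro c hc c' hc' p hp
        have : p = ⟨monomial d c, monomial_mem_twistRing deg a hc⟩
            * ⟨monomial d' c', monomial_mem_twistRing deg a hc'⟩ := by
          refine Subtype.ext ?_
          rw [hp]
          exact monomial_mul.symm
        rw [this, map_mul, map_mul, hd c hc, hd' c' hc']
      · intro c hc c' hc' h h' p hp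
        rw [← hw] at hc hc'
        have : p = ⟨monomial (d + d') c, monomial_mem_twistRing deg a hc⟩
            + ⟨monomial (d + d') c', monomial_mem_twistRing deg a hc'⟩ := by
          refine Subtype.ext ?_
          rw [hp, map_add]
          rfl
        rw [this, map_add, map_add, h _ rfl, h' _ rfl]
    exact key c (hw ▸ hc) _ rfl
  have h1 (i : Fin N) : Q (Finsupp.single i 1) := by
    intro c hc
    have hc' := hc
    rw [Finsupp.weight_single, one_smul] at hc'
    have := hX i c hc'
    simpa only [C_mul_X_eq_monomial] using this
  have hQ (d : Fin N →₀ ℕ) : Q d := by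
    refine Finsupp.induction_linear d h0 (fun d d' => hadd d d') fun i n => ?_
    induction n with
    | zero => rw [Finsupp.single_zero]; exact h0
    | succ n ih => rw [Finsupp.single_add]; exact hadd _ _ ih (h1 i)
  refine RingHom.ext fun p => ?_
  refine twistRing_induction deg a (P := fun p => α p = β p) (fun d c hc => hQ d c hc) ?_ p
  intro p q hp hq
  rw [map_add, map_add, hp, hq]

namespace Frame

variable {R : Type*} [CommRing R] {φ : A →+* R} (Θ : Frame a φ)

/-- The homomorphism from the twisted ring given by a frame and a point of affine space. -/
def lift (ψ : MvPolynomial (Fin N) A →+* R) (_hψ : ∀ x, ψ (C x) = φ x) : twistRing deg a →+* R :=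
  let F (p : twistRing deg a) : R := ∑ d ∈ (p : MvPolynomial (Fin N) K).support,
    Θ.toFun (-(Finsupp.weight deg d)) (coeff d (p : MvPolynomial (Fin N) K)) * ψ (monomial d 1)
  -- The sum may run over any finite set containing the support, so that sums for different elements
  -- can be compared.
  have hF (p : twistRing deg a) (s : Finset (Fin N →₀ ℕ))
      (hs : (p : MvPolynomial (Fin N) K).support ⊆ s) :
      F p = ∑ d ∈ s, Θ.toFun (-(Finsupp.weight deg d)) (coeff d (p : MvPolynomial (Fin N) K))
        * ψ (monomial d 1) := by
    refine Finset.sum_subset hs fun d _ hd => ?_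
    rw [notMem_support_iff.mp hd, Θ.map_zero, zero_mul]
  have hadd (p q : twistRing deg a) : F (p + q) = F p + F q := by
    classical
    rw [hF (p + q) (_ ∪ _) support_add, hF p _ Finset.subset_union_left,
      hF q _ Finset.subset_union_right, ← Finset.sum_add_distrib]
    refine Finset.sum_congr rfl fun d _ => ?_
    rw [← add_mul, ← Θ.map_add (p.2 d) (q.2 d), ← coeff_add]
    rfl
  have hmon (d : Fin N →₀ ℕ) (c : K) (hc : c ∈ idealPow a (-(Finsupp.weight deg d))) :
      F ⟨monomial d c, monomial_mem_twistRing deg a hc⟩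
        = Θ.toFun (-(Finsupp.weight deg d)) c * ψ (monomial d 1) := by
    classical
    rw [hF _ {d} support_monomial_subset, Finset.sum_singleton, coeff_monomial, if_pos rfl]
  have hone : F 1 = 1 := by
    have h := hmon 0 1 (by
      rw [_root_.map_zero, neg_zero, ← RingHom.map_one (algebraMap A K)]
      exact algebraMap_mem_idealPow_zero a 1)
    refine h.trans ?_
    rw [_root_.map_zero, neg_zero, Θ.map_one, one_mul]
    exact _root_.map_one ψ
  have hmul (p q : twistRing deg a) : F (p * q) = F p * F q := by
    refine twistRing_induction deg a (P := fun p => ∀ q, F (p * q) = F p * F q) ?_ ?_ p q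
    · intro d c hc q
      refine twistRing_induction deg a
        (P := fun q => F (⟨monomial d c, monomial_mem_twistRing deg a hc⟩ * q)
          = F ⟨monomial d c, monomial_mem_twistRing deg a hc⟩ * F q) ?_ ?_ q
      · intro d' c' hc'
        have hcc := mul_mem_idealPow hc hc'
        rw [← neg_add, ← _root_.map_add] at hcc
        have e : (⟨monomial d c, monomial_mem_twistRing deg a hc⟩
            * ⟨monomial d' c', monomial_mem_twistRing deg a hc'⟩ : twistRing deg a)
            = ⟨monomial (d + d') (c * c'), monomial_mem_twistRing deg a hcc⟩ :=
          Subtype.ext monomial_mul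
        have e' : (monomial (d + d') 1 : MvPolynomial (Fin N) A)
            = monomial d 1 * monomial d' 1 := by simp
        rw [e, hmon _ _ hcc, hmon d c hc, hmon d' c' hc', e', _root_.map_mul, _root_.map_add, neg_add,
          Θ.map_mul hc hc']
        ring
      · intro q q' hq hq'
        rw [mul_add, hadd, hadd, hq, hq', mul_add]
    · intro p p' hp hp' q
      rw [add_mul, hadd, hadd, hp, hp', add_mul]
  { toFun := F
    map_one' := hone
    map_mul' := hmul
    map_zero' := by simp [F]
    map_add' := hadd }

theorem lift_monomial (ψ : MvPolynomial (Fin N) A →+* R) (hψ : ∀ x, ψ (C x) = φ x)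
    {d : Fin N →₀ ℕ} {c : K} (hc : c ∈ idealPow a (-(Finsupp.weight deg d))) :
    Θ.lift ψ hψ ⟨monomial d c, monomial_mem_twistRing deg a hc⟩
      = Θ.toFun (-(Finsupp.weight deg d)) c * ψ (monomial d 1) := by
  classical
  change ∑ d' ∈ (monomial d c).support, _ = _
  rw [Finset.sum_subset support_monomial_subset, Finset.sum_singleton]
  · simp only [coeff_monomial, if_true]
  · intro d' _ hd
    simp only [notMem_support_iff.mp hd, Θ.map_zero, zero_mul]

theorem lift_algebraMap (ψ : MvPolynomial (Fin N) A →+* R) (hψ : ∀ x, ψ (C x) = φ x) (x : A) :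
    Θ.lift ψ hψ (algebraMap A (twistRing deg a) x) = φ x := by
  have hx : algebraMap A K x ∈ idealPow a (-(Finsupp.weight deg (0 : Fin N →₀ ℕ))) := by
    rw [_root_.map_zero, neg_zero]
    exact algebraMap_mem_idealPow_zero a x
  refine (Θ.lift_monomial ψ hψ hx).trans ?_
  rw [_root_.map_zero, neg_zero, Θ.map_algebraMap]
  exact (congrArg _ (_root_.map_one ψ)).trans (mul_one _)

theorem lift_C_mul_X (ψ : MvPolynomial (Fin N) A →+* R) (hψ : ∀ x, ψ (C x) = φ x) {i : Fin N}
    {c : K} (hc : c ∈ idealPow a (-(deg i))) :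
    Θ.lift ψ hψ ⟨C c * X i, C_mul_X_mem_twistRing deg a hc⟩
      = Θ.toFun (-(deg i)) c * ψ (X i) := by
  have hw : Finsupp.weight deg (Finsupp.single i 1) = deg i := by rw [Finsupp.weight_single, one_smul]
  have hc' : c ∈ idealPow a (-(Finsupp.weight deg (Finsupp.single i 1))) := by rwa [hw]
  have := Θ.lift_monomial ψ hψ hc'
  rw [hw] at this
  simp only [C_mul_X_eq_monomial]
  exact this

/-- The value of the lift on a multiple of a homogeneous polynomial over `A`. -/
theorem lift_C_mul_map (ψ : MvPolynomial (Fin N) A →+* R) (hψ : ∀ x, ψ (C x) = φ x)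
    {m : Fin r → ℤ} {c : K} (hc : c ∈ idealPow a (-m)) {f : MvPolynomial (Fin N) A}
    (hf : IsWeightedHomogeneous deg f m) (p : twistRing deg a)
    (hp : (p : MvPolynomial (Fin N) K) = C c * MvPolynomial.map (algebraMap A K) f) :
    Θ.lift ψ hψ p = Θ.toFun (-m) c * ψ f := by
  have hmem (d : Fin N →₀ ℕ) : algebraMap A K (coeff d f) * c
      ∈ idealPow a (-(Finsupp.weight deg d)) := by
    by_cases hd : coeff d f = 0
    · rw [hd, RingHom.map_zero, zero_mul]
      exact zero_mem_idealPow _ _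
    · rw [hf hd]
      exact algebraMap_mul_mem_idealPow _ hc
  have e : p = ∑ d ∈ f.support, ⟨monomial d (algebraMap A K (coeff d f) * c),
      monomial_mem_twistRing deg a (hmem d)⟩ := by
    refine Subtype.ext ?_
    rw [AddSubmonoidClass.coe_finsetSum, hp]
    conv_lhs => rw [f.as_sum, map_sum, Finset.mul_sum]
    refine Finset.sum_congr rfl fun d _ => ?_
    rw [map_monomial, C_mul_monomial, mul_comm]
  rw [e, map_sum]
  conv_rhs => rw [f.as_sum, map_sum, Finset.mul_sum]
  refine Finset.sum_congr rfl fun d hd => ?_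
  rw [Θ.lift_monomial ψ hψ (hmem d), hf (mem_support_iff.mp hd), Θ.map_smul _ hc]
  have : (monomial d (coeff d f) : MvPolynomial (Fin N) A) = C (coeff d f) * monomial d 1 := by
    rw [C_mul_monomial, mul_one]
  rw [this, _root_.map_mul ψ, hψ]
  ring

/-- All homomorphisms from the twisted ring are lifts. -/
theorem exists_lift_eq (χ : twistRing deg a →+* R) (hχ : ∀ x : A, χ (algebraMap A _ x) = φ x) :
    ∃ (ψ : MvPolynomial (Fin N) A →+* R) (hψ : ∀ x, ψ (C x) = φ x), Θ.lift ψ hψ = χ := by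
  have h (i : Fin N) : ∃ w, ∀ (c : K) (hc : c ∈ idealPow a (-(deg i))),
      χ ⟨C c * X i, C_mul_X_mem_twistRing deg a hc⟩ = Θ.toFun (-(deg i)) c * w := by
    classical
    -- The map `c ↦ χ(c x_i)` on `𝔞^{-deg x_i}`, extended by zero. Its factor relative to the frame
    -- serves as the value of `x_i`.
    let l (c : K) : R := if hc : c ∈ idealPow a (-(deg i)) then
      χ ⟨C c * X i, C_mul_X_mem_twistRing deg a hc⟩ else 0
    have hl {c : K} (hc : c ∈ idealPow a (-(deg i))) :
        l c = χ ⟨C c * X i, C_mul_X_mem_twistRing deg a hc⟩ := dif_pos hc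
    obtain ⟨w, hw⟩ := Θ.exists_factor (-(deg i)) (l := l) (by
        intro c hc d hd
        rw [hl hc, hl hd, hl (add_mem_idealPow hc hd), ← _root_.map_add]
        congr 1
        exact Subtype.ext (by simp [add_mul])) (by
        intro x c hc
        rw [hl hc, hl (algebraMap_mul_mem_idealPow x hc), ← hχ, ← _root_.map_mul]
        congr 1
        refine Subtype.ext ?_
        change C _ * X i = C (algebraMap A K x) * (C c * X i)
        rw [C_mul, mul_assoc])
    exact ⟨w, fun c hc => by rw [← hw c hc, hl hc]⟩
  choose w hw using h
  refine ⟨eval₂Hom φ w, fun x => eval₂Hom_C φ w x, twistRing_hom_ext (fun x => ?_) fun i c hc => ?_⟩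
  · rw [lift_algebraMap, hχ]
  · rw [lift_C_mul_X _ _ _ hc, hw i c hc, eval₂Hom_X']

/-- The lift only sees the products `Θ(c) ψ(x_i)`, but these determine `ψ(x_i)` by
`eq_of_forall_mul_eq`. -/
theorem lift_injective {ψ ψ' : MvPolynomial (Fin N) A →+* R} {hψ : ∀ x, ψ (C x) = φ x}
    {hψ' : ∀ x, ψ' (C x) = φ x}
    (h : ∀ (i : Fin N) (c : K) (hc : c ∈ idealPow a (-(deg i))),
      Θ.lift ψ hψ ⟨C c * X i, C_mul_X_mem_twistRing deg a hc⟩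
        = Θ.lift ψ' hψ' ⟨C c * X i, C_mul_X_mem_twistRing deg a hc⟩) : ψ = ψ' := by
  refine MvPolynomial.ringHom_ext (fun x => by rw [hψ, hψ']) fun i => ?_
  refine Θ.eq_of_forall_mul_eq (-(deg i)) fun c hc => ?_
  rw [← Θ.lift_C_mul_X ψ hψ hc, ← Θ.lift_C_mul_X ψ' hψ' hc, h i c hc]

end Frame

end Frames

/-! ### Comparison of the points of a twist with the points of the torsor -/

/-- The functions on `T` that vanish at the point `t`. -/
def vanishingAt {T : Scheme.{u}} (t : T) : Ideal Γ(T, ⊤) :=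
  (IsLocalRing.maximalIdeal (T.presheaf.stalk t)).comap (T.presheaf.germ ⊤ t trivial).hom

instance {T : Scheme.{u}} (t : T) : (vanishingAt t).IsPrime := by
  unfold vanishingAt
  infer_instance

theorem notMem_vanishingAt {T : Scheme.{u}} (t : T) (b : Γ(T, ⊤)) :
    b ∉ vanishingAt t ↔ t ∈ T.basicOpen b := by
  rw [Scheme.mem_basicOpen_top, vanishingAt, Ideal.mem_comap, IsLocalRing.mem_maximalIdeal,
    mem_nonunits_iff, not_not]

/-- Nonvanishing modulo a prime of some element of an ideal can be checked on generators. -/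
theorem exists_mem_notMem_of_span {B R : Type*} [CommRing B] [CommRing R] {s : Set B}
    (χ : B →+* R) {I : Ideal R} (h : ∃ b ∈ Ideal.span s, χ b ∉ I) : ∃ b ∈ s, χ b ∉ I := by
  by_contra! hcon
  obtain ⟨b, hb, hb'⟩ := h
  exact hb' ((Ideal.span_le (I := I.comap χ)).mpr (fun b hb => hcon b hb) hb)

section Comparison

variable {A K : Type u} [CommRing A] [Field K] [Algebra A K] {r N : ℕ}
  {deg : Fin N → Fin r → ℤ} {a : Fin r → (FractionalIdeal A⁰ K)ˣ}

theorem C_mul_map_mem_twistRing {n : Fin r → ℤ} {c : K} (hc : c ∈ idealPow a (-n))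
    {f : MvPolynomial (Fin N) A} (hf : IsWeightedHomogeneous deg f n) :
    C c * MvPolynomial.map (algebraMap A K) f ∈ twistRing deg a := by
  intro d
  rw [coeff_C_mul, coeff_map, mul_comm]
  by_cases hd : coeff d f = 0
  · rw [hd, map_zero, zero_mul]
    exact zero_mem_idealPow _ _
  · rw [hf hd]
    exact algebraMap_mul_mem_idealPow _ hc

variable {m s : ℕ} {g : Fin s → MvPolynomial (Fin N) A} {f : Fin m → MvPolynomial (Fin N) A}

/-- The homomorphism of evaluation of polynomials at a `T`-point of `Y`. -/
def pointHom {T : Scheme.{u}} (z : T ⟶ torsorSpace g f) : MvPolynomial (Fin N) A →+* Γ(T, ⊤) :=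
  locus.comorphism (I₁ := Ideal.span (Set.range g)) (I₂ := Ideal.span (Set.range f)) z

/-- The homomorphism of evaluation of functions at a `T`-point of the twist. -/
def twistHom {T : Scheme.{u}} (y : T ⟶ twist deg a g f) : twistRing deg a →+* Γ(T, ⊤) :=
  locus.comorphism (I₁ := twistIdeal deg a (Ideal.span (Set.range g)))
    (I₂ := twistIdeal deg a (Ideal.span (Set.range f))) y

theorem pointHom_injective {T : Scheme.{u}} {z z' : T ⟶ torsorSpace g f}
    (h : pointHom z = pointHom z') : z = z' :=
  locus.comorphism_injective (I₁ := Ideal.span (Set.range g)) (I₂ := Ideal.span (Set.range f)) h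

theorem twistHom_injective {T : Scheme.{u}} {y y' : T ⟶ twist deg a g f}
    (h : twistHom y = twistHom y') : y = y' :=
  locus.comorphism_injective (I₁ := twistIdeal deg a (Ideal.span (Set.range g)))
    (I₂ := twistIdeal deg a (Ideal.span (Set.range f))) h

theorem pointHom_comp {T T' : Scheme.{u}} (k : T' ⟶ T) (z : T ⟶ torsorSpace g f)
    (p : MvPolynomial (Fin N) A) : pointHom (k ≫ z) p = k.appTop.hom (pointHom z p) :=
  locus.comorphism_comp (I₁ := Ideal.span (Set.range g)) (I₂ := Ideal.span (Set.range f)) k z p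

theorem twistHom_comp {T T' : Scheme.{u}} (k : T' ⟶ T) (y : T ⟶ twist deg a g f)
    (p : twistRing deg a) : twistHom (k ≫ y) p = k.appTop.hom (twistHom y p) :=
  locus.comorphism_comp (I₁ := twistIdeal deg a (Ideal.span (Set.range g)))
    (I₂ := twistIdeal deg a (Ideal.span (Set.range f))) k y p

theorem pointHom_eq_zero {T : Scheme.{u}} (z : T ⟶ torsorSpace g f) {p : MvPolynomial (Fin N) A}
    (hp : p ∈ Ideal.span (Set.range g)) : pointHom z p = 0 :=
  locus.comorphism_eq_zero (I₂ := Ideal.span (Set.range f)) z hp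

theorem twistHom_eq_zero {T : Scheme.{u}} (y : T ⟶ twist deg a g f) {p : twistRing deg a}
    (hp : p ∈ twistIdeal deg a (Ideal.span (Set.range g))) : twistHom y p = 0 :=
  locus.comorphism_eq_zero (I₂ := twistIdeal deg a (Ideal.span (Set.range f))) y hp

theorem exists_pointHom_notMem {T : Scheme.{u}} (z : T ⟶ torsorSpace g f) (t : T) :
    ∃ i, pointHom z (f i) ∉ vanishingAt t := by
  obtain ⟨p, hp, hpt⟩ := locus.exists_mem_basicOpen (I₁ := Ideal.span (Set.range g))
    (I₂ := Ideal.span (Set.range f)) z t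
  obtain ⟨_, ⟨i, rfl⟩, hi⟩ := exists_mem_notMem_of_span (pointHom z)
    ⟨p, hp, (notMem_vanishingAt t _).mpr hpt⟩
  exact ⟨i, hi⟩

theorem exists_twistHom_notMem {T : Scheme.{u}} (y : T ⟶ twist deg a g f) (t : T) :
    ∃ (n : Fin r → ℤ) (c : K) (_ : c ∈ idealPow a (-n)) (h : MvPolynomial (Fin N) A)
      (_ : h ∈ Ideal.span (Set.range f)) (_ : IsWeightedHomogeneous deg h n),
      ∀ p : twistRing deg a, (p : MvPolynomial (Fin N) K)
        = C c * MvPolynomial.map (algebraMap A K) h → twistHom y p ∉ vanishingAt t := by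
  obtain ⟨p, hp, hpt⟩ := locus.exists_mem_basicOpen
    (I₁ := twistIdeal deg a (Ideal.span (Set.range g)))
    (I₂ := twistIdeal deg a (Ideal.span (Set.range f))) y t
  obtain ⟨q, ⟨n, c, hc, h, hh, hhn, hq⟩, hqt⟩ := exists_mem_notMem_of_span (twistHom y)
    ⟨p, hp, (notMem_vanishingAt t _).mpr hpt⟩
  exact ⟨n, c, hc, h, hh, hhn, fun p hp => by rwa [show p = q from Subtype.ext (hp.trans hq.symm)]⟩

theorem exists_pointHom_eq {T : Scheme.{u}} (ψ : MvPolynomial (Fin N) A →+* Γ(T, ⊤))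
    (hg : ∀ j, ψ (g j) = 0)
    (hf : ∀ t : T, ∃ p ∈ Ideal.span (Set.range f), ψ p ∉ vanishingAt t) :
    ∃ z : T ⟶ torsorSpace g f, pointHom z = ψ := by
  refine locus.exists_comorphism_eq (I₁ := Ideal.span (Set.range g))
    (I₂ := Ideal.span (Set.range f)) ψ (fun b hb => ?_) fun t => ?_
  · refine (Ideal.span_le (I := RingHom.ker ψ)).mpr ?_ hb
    rintro _ ⟨j, rfl⟩
    exact RingHom.mem_ker.mpr (hg j)
  · obtain ⟨p, hp, hpt⟩ := hf t
    exact ⟨p, hp, (notMem_vanishingAt t _).mp hpt⟩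

theorem exists_twistHom_eq {T : Scheme.{u}} (χ : twistRing deg a →+* Γ(T, ⊤))
    (hg : ∀ (n : Fin r → ℤ), ∀ c ∈ idealPow a (-n), ∀ h ∈ Ideal.span (Set.range g),
      IsWeightedHomogeneous deg h n → ∀ p : twistRing deg a,
      (p : MvPolynomial (Fin N) K) = C c * MvPolynomial.map (algebraMap A K) h → χ p = 0)
    (hf : ∀ t : T, ∃ p ∈ twistIdeal deg a (Ideal.span (Set.range f)), χ p ∉ vanishingAt t) :
    ∃ y : T ⟶ twist deg a g f, twistHom y = χ := by
  refine locus.exists_comorphism_eq (I₁ := twistIdeal deg a (Ideal.span (Set.range g)))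
    (I₂ := twistIdeal deg a (Ideal.span (Set.range f))) χ (fun b hb => ?_) fun t => ?_
  · refine (Ideal.span_le (I := RingHom.ker χ)).mpr ?_ hb
    rintro p ⟨n, c, hc, h, hh, hhn, hp⟩
    exact RingHom.mem_ker.mpr (hg n c hc h hh hhn p hp)
  · obtain ⟨p, hp, hpt⟩ := hf t
    exact ⟨p, hp, (notMem_vanishingAt t _).mp hpt⟩

theorem eval_specMap_comp {B B' : Type u} [CommRing B] [CommRing B'] {T : Scheme.{u}}
    (y : T ⟶ Spec (CommRingCat.of B')) (ψ : B →+* B') :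
    locus.eval (y ≫ Spec.map (CommRingCat.ofHom ψ)) = (locus.eval y).comp ψ := by
  refine RingHom.ext fun b => ?_
  unfold locus.eval
  rw [Scheme.Hom.comp_appTop]
  simp only [RingHom.comp_apply, CommRingCat.hom_comp]
  congr 1
  exact (congrArg (fun f => f.hom b) (Scheme.ΓSpecIso_inv_naturality
    (CommRingCat.ofHom ψ))).symm

theorem eval_injective {B : Type u} [CommRing B] {T : Scheme.{u}}
    {y y' : T ⟶ Spec (CommRingCat.of B)} (h : locus.eval y = locus.eval y') : y = y' := by
  rw [← locus.ofEval_eval y, ← locus.ofEval_eval y', h]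

theorem eval_toSpec_specMap {B B' : Type u} [CommRing B] [CommRing B'] {I₁ I₂ : Ideal B'}
    {T : Scheme.{u}} (y : T ⟶ locus B' I₁ I₂) (ψ : B →+* B') :
    locus.eval (y ≫ locus.toSpec I₁ I₂ ≫ Spec.map (CommRingCat.ofHom ψ))
      = (locus.comorphism y).comp ψ := by
  rw [← Category.assoc, eval_specMap_comp]
  rfl

theorem eval_comp_torsorSpaceStr {T : Scheme.{u}} (z : T ⟶ torsorSpace g f) :
    locus.eval (z ≫ torsorSpaceStr g f) = (pointHom z).comp C :=
  eval_toSpec_specMap (I₁ := Ideal.span (Set.range g)) (I₂ := Ideal.span (Set.range f)) z _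

theorem eval_comp_twistStr {T : Scheme.{u}} (y : T ⟶ twist deg a g f) :
    locus.eval (y ≫ twistStr deg a g f)
      = (twistHom y).comp (algebraMap A (twistRing deg a)) :=
  eval_toSpec_specMap (I₁ := twistIdeal deg a (Ideal.span (Set.range g)))
    (I₂ := twistIdeal deg a (Ideal.span (Set.range f))) y _

/-- The point `y` of the twist corresponds to the point `z` of `Y` under the frame `Θ`. -/
structure Frame.Matches {T : Scheme.{u}} {φ : A →+* Γ(T, ⊤)} (Θ : Frame a φ)
    (y : T ⟶ twist deg a g f) (z : T ⟶ torsorSpace g f) : Prop where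
  left : ∀ x : A, twistHom y (algebraMap A _ x) = φ x
  right : ∀ x : A, pointHom z (C x) = φ x
  apply : ∀ (i : Fin N) (c : K) (hc : c ∈ idealPow a (-(deg i))),
    twistHom y ⟨C c * X i, C_mul_X_mem_twistRing deg a hc⟩
      = Θ.toFun (-(deg i)) c * pointHom z (X i)

namespace Frame

variable {T : Scheme.{u}} {φ : A →+* Γ(T, ⊤)} {Θ : Frame a φ}
  {y y' : T ⟶ twist deg a g f} {z z' : T ⟶ torsorSpace g f}

theorem Matches.hom_eq (h : Θ.Matches y z) :
    twistHom y = Θ.lift (pointHom z) h.right := by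
  refine twistRing_hom_ext (fun x => ?_) fun i c hc => ?_
  · rw [h.left, lift_algebraMap]
  · rw [h.apply i c hc, lift_C_mul_X _ _ _ hc]

theorem Matches.of_hom_eq {ψ : MvPolynomial (Fin N) A →+* Γ(T, ⊤)} {hψ : ∀ x, ψ (C x) = φ x}
    (hy : twistHom y = Θ.lift ψ hψ) (hz : pointHom z = ψ) : Θ.Matches y z where
  left x := by rw [hy, lift_algebraMap]
  right x := by rw [hz, hψ]
  apply i c hc := by rw [hy, hz, lift_C_mul_X _ _ _ hc]

theorem Matches.left_unique (h : Θ.Matches y z) (h' : Θ.Matches y' z) : y = y' :=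
  twistHom_injective (by rw [h.hom_eq, h'.hom_eq])

theorem Matches.right_unique (h : Θ.Matches y z) (h' : Θ.Matches y z') : z = z' := by
  refine pointHom_injective (Θ.lift_injective (deg := deg) (hψ := h.right) (hψ' := h'.right)
    fun i c hc => ?_)
  rw [← h.hom_eq, ← h'.hom_eq]

/-- Relative to `Θ`, the homomorphism of `y` is the lift of some `ψ`. All products `Θ(c) ψ(g_j)`
vanish because `c g_j` is in the twisted ideal, hence `ψ(g_j) = 0`; and where `c h` is nonzero on
`y`, so is `ψ(h)`. -/
theorem exists_matches_right {dg : Fin s → Fin r → ℤ}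
    (hg : ∀ i, IsWeightedHomogeneous deg (g i) (dg i)) (Θ : Frame a φ)
    (y : T ⟶ twist deg a g f) (hy : ∀ x : A, twistHom y (algebraMap A _ x) = φ x) :
    ∃ z : T ⟶ torsorSpace g f, Θ.Matches y z := by
  obtain ⟨ψ, hψ, hψy⟩ := Θ.exists_lift_eq (twistHom y) hy
  suffices h : ∃ z : T ⟶ torsorSpace g f, pointHom z = ψ by
    obtain ⟨z, hz⟩ := h
    exact ⟨z, .of_hom_eq hψy.symm hz⟩
  refine exists_pointHom_eq ψ (fun j => ?_) (fun t => ?_)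
  · refine Θ.eq_of_forall_mul_eq (-(dg j)) fun c hc => ?_
    rw [← Θ.lift_C_mul_map ψ hψ hc (hg j) ⟨_, C_mul_map_mem_twistRing hc (hg j)⟩ rfl, hψy,
      mul_zero]
    exact twistHom_eq_zero y (Ideal.subset_span
      ⟨dg j, c, hc, g j, Ideal.subset_span ⟨j, rfl⟩, hg j, rfl⟩)
  · obtain ⟨n, c, hc, h, hh, hhn, ht⟩ := exists_twistHom_notMem y t
    refine ⟨h, hh, fun hmem => ht ⟨_, C_mul_map_mem_twistRing hc hhn⟩ rfl ?_⟩
    rw [← hψy, Θ.lift_C_mul_map ψ hψ hc hhn _ rfl]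
    exact Ideal.mul_mem_left _ _ hmem

/-- Where `f_i` is nonzero at `z`, some `c ∈ 𝔞^{-deg f_i}` has `Θ(c)` nonzero at the same point.
Functions vanishing at a point form a prime ideal, so `c f_i` does not vanish there either. -/
theorem exists_matches_left {df : Fin m → Fin r → ℤ}
    (hf : ∀ i, IsWeightedHomogeneous deg (f i) (df i)) (Θ : Frame a φ)
    (z : T ⟶ torsorSpace g f) (hz : ∀ x : A, pointHom z (C x) = φ x) :
    ∃ y : T ⟶ twist deg a g f, Θ.Matches y z := by
  suffices h : ∃ y : T ⟶ twist deg a g f, twistHom y = Θ.lift (pointHom z) hz by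
    obtain ⟨y, hy⟩ := h
    exact ⟨y, .of_hom_eq hy rfl⟩
  refine exists_twistHom_eq (Θ.lift (pointHom z) hz) (fun n c hc h hh hhn p hp => ?_)
    (fun t => ?_)
  · rw [Θ.lift_C_mul_map _ hz hc hhn p hp, pointHom_eq_zero z hh, mul_zero]
  · obtain ⟨i, hit⟩ := exists_pointHom_notMem z t
    obtain ⟨c, hc, hct⟩ := Θ.exists_notMem (-(df i)) (I := vanishingAt t) Ideal.IsPrime.ne_top'
    refine ⟨⟨_, C_mul_map_mem_twistRing hc (hf i)⟩, Ideal.subset_span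
      ⟨df i, c, hc, f i, Ideal.subset_span ⟨i, rfl⟩, hf i, rfl⟩, ?_⟩
    rw [Θ.lift_C_mul_map _ hz hc (hf i) _ rfl]
    exact fun hmem => (Ideal.IsPrime.mem_or_mem inferInstance hmem).elim hct hit

theorem Matches.comp (h : Θ.Matches y z) {T' : Scheme.{u}} (k : T' ⟶ T) :
    (Θ.map k.appTop.hom).Matches (k ≫ y) (k ≫ z) where
  left x := by rw [twistHom_comp, h.left]; rfl
  right x := by rw [pointHom_comp, h.right]; rfl
  apply i c hc := by
    rw [twistHom_comp, pointHom_comp, h.apply i c hc, _root_.map_mul]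
    rfl

theorem twistHom_twistAction_C_mul_X (t : Torus r T) (y : T ⟶ twist deg a g f) {i : Fin N} {c : K}
    (hc : c ∈ idealPow a (-(deg i))) :
    twistHom ((twistAction deg a g f).act t y) ⟨C c * X i, C_mul_X_mem_twistRing deg a hc⟩
      = t.char (deg i) * twistHom y ⟨C c * X i, C_mul_X_mem_twistRing deg a hc⟩ := by
  refine gradedAction_apply (twistGrading deg a) (twistIdeal_isHomogeneous deg a _)
    (twistIdeal_isHomogeneous deg a _) t y ((mem_twistGrading deg a).mpr ?_)
  simpa using (isWeightedHomogeneous_C deg c).mul (isWeightedHomogeneous_X K deg i)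

theorem twistHom_twistAction_algebraMap (t : Torus r T) (y : T ⟶ twist deg a g f) (x : A) :
    twistHom ((twistAction deg a g f).act t y) (algebraMap A (twistRing deg a) x)
      = twistHom y (algebraMap A (twistRing deg a) x) := by
  refine (gradedAction_apply (twistGrading deg a) (twistIdeal_isHomogeneous deg a _)
    (twistIdeal_isHomogeneous deg a _) t y (m := 0) (((mem_twistGrading deg a).mpr ?_))).trans ?_
  · exact isWeightedHomogeneous_C deg (algebraMap A K x)
  · rw [Torus.char_zero, Units.val_one, one_mul]
    rfl

variable {dg : Fin s → Fin r → ℤ} {df : Fin m → Fin r → ℤ}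
  (hg : ∀ i, IsWeightedHomogeneous deg (g i) (dg i))
  (hf : ∀ i, IsWeightedHomogeneous deg (f i) (df i))

theorem pointHom_torsorAction_X (t : Torus r T) (z : T ⟶ torsorSpace g f) (i : Fin N) :
    pointHom ((torsorAction deg g f hg hf).act t z) (X i) = t.char (deg i) * pointHom z (X i) :=
  torsorAction_X deg g f hg hf t z i

theorem pointHom_torsorAction_C (t : Torus r T) (z : T ⟶ torsorSpace g f) (x : A) :
    pointHom ((torsorAction deg g f hg hf).act t z) (C x) = pointHom z (C x) := by
  let := weightedGradedAlgebra A deg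
  refine (gradedAction_apply (weightedHomogeneousSubmodule A deg) (span_isHomogeneous deg hg)
    (span_isHomogeneous deg hf) t z (m := 0) (isWeightedHomogeneous_C deg x)).trans ?_
  rw [Torus.char_zero, Units.val_one, one_mul]
  rfl

/-- Both actions multiply the `i`-th coordinate by `t^{deg x_i}`: the factor `c` in `c x_i` does not
contribute to the degree. -/
theorem Matches.act (h : Θ.Matches y z) (t : Torus r T) :
    Θ.Matches ((twistAction deg a g f).act t y) ((torsorAction deg g f hg hf).act t z) where
  left x := by rw [twistHom_twistAction_algebraMap, h.left]
  right x := by rw [pointHom_torsorAction_C, h.right]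
  apply i c hc := by
    rw [twistHom_twistAction_C_mul_X _ _ hc, pointHom_torsorAction_X, h.apply i c hc]
    ring

/-- Changing the frame changes the correspondence by the action of the torus. -/
theorem Matches.act_of_ratio {Θ Θ' : Frame a φ} (h : Θ'.Matches y z) (t : Torus r T)
    (ht : ∀ (n : Fin r → ℤ), ∀ c ∈ idealPow a n,
      Θ'.toFun n c = Θ.toFun n c * (t.char n : Γ(T, ⊤)ˣ)) :
    Θ.Matches ((twistAction deg a g f).act t y) z where
  left x := by rw [twistHom_twistAction_algebraMap, h.left]
  right x := h.right x
  apply i c hc := by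
    rw [twistHom_twistAction_C_mul_X _ _ hc, h.apply i c hc, ht _ c hc]
    -- The factor `t^{-deg x_i}` from the change of frame cancels the factor `t^{deg x_i}` from the
    -- action.
    have := congrArg Units.val (t.char_add (deg i) (-(deg i)))
    rw [add_neg_cancel, Torus.char_zero, Units.val_one, Units.val_mul] at this
    linear_combination (-(Θ.toFun (-(deg i)) c * pointHom z (X i))) * this

end Frame

end Comparison

theorem hom_ext_of_pullback {T T' X : Scheme.{u}} (𝒱 : Scheme.OpenCover.{u} T) (k : T' ⟶ T)
    {x y : T' ⟶ X} (h : ∀ i, pullback.fst k (𝒱.f i) ≫ x = pullback.fst k (𝒱.f i) ≫ y) : x = y :=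
  Scheme.Cover.hom_ext (𝒱.pullback₁ k) x y h

/-! ### Charts -/

section Charts

/-- The product `ρ_1^{m_1} ⋯ ρ_r^{m_r}`. -/
def multiPow {r : ℕ} {G : Type*} [CommGroup G] (ρ : Fin r → G) (m : Fin r → ℤ) : G :=
  ∏ j, ρ j ^ m j

theorem multiPow_zero {r : ℕ} {G : Type*} [CommGroup G] (ρ : Fin r → G) : multiPow ρ 0 = 1 := by
  simp [multiPow]

theorem multiPow_add {r : ℕ} {G : Type*} [CommGroup G] (ρ : Fin r → G) (m n : Fin r → ℤ) :
    multiPow ρ (m + n) = multiPow ρ m * multiPow ρ n := by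
  simp [multiPow, zpow_add, Finset.prod_mul_distrib]

theorem multiPow_neg {r : ℕ} {G : Type*} [CommGroup G] (ρ : Fin r → G) (m : Fin r → ℤ) :
    multiPow ρ (-m) = (multiPow ρ m)⁻¹ := by
  simp [multiPow]

variable {A K : Type u} [CommRing A] [Field K] [Algebra A K] {r N : ℕ}
  {deg : Fin N → Fin r → ℤ} {a : Fin r → (FractionalIdeal A⁰ K)ˣ}

/-- The fractional ideals `𝔞_j` are generated by `ρ_j` over `B`. -/
def IsGenerator (a : Fin r → (FractionalIdeal A⁰ K)ˣ) (B : Subalgebra A K) (ρ : Fin r → Kˣ) :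
    Prop :=
  ∀ j, Submodule.span B {x : K | x ∈ (a j : FractionalIdeal A⁰ K)}
    = Submodule.span B {(ρ j : K)}

/-- Negative exponents require `𝔞_j⁻¹ ρ_j ⊆ B` in addition to `𝔞_j ρ_j⁻¹ ⊆ B`. The pairs `(I, u)`
with both inclusions form a subgroup, so the claim follows from the pairs `(𝔞_j, ρ_j)`. -/
theorem IsGenerator.mul_mem {B : Subalgebra A K} {ρ : Fin r → Kˣ} (h : IsGenerator a B ρ)
    {m : Fin r → ℤ} {c : K} (hc : c ∈ idealPow a m) :
    c * ((multiPow ρ (-m) : Kˣ) : K) ∈ B := by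
  let H : Subgroup ((FractionalIdeal A⁰ K)ˣ × Kˣ) :=
    { carrier := {p | (∀ x ∈ (p.1 : FractionalIdeal A⁰ K), x * ((p.2⁻¹ : Kˣ) : K) ∈ B) ∧
        ∀ x ∈ ((p.1⁻¹ : (FractionalIdeal A⁰ K)ˣ) : FractionalIdeal A⁰ K), x * (p.2 : K) ∈ B}
      one_mem' := by
        constructor <;>
        · intro x hx
          simp only [Prod.fst_one, inv_one, Units.val_one, FractionalIdeal.mem_one_iff] at hx
          obtain ⟨y, rfl⟩ := hx
          simp [B.algebraMap_mem y]
      mul_mem' := by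
        have key (I J : FractionalIdeal A⁰ K) (u v : K) (hI : ∀ x ∈ I, x * u ∈ B)
            (hJ : ∀ x ∈ J, x * v ∈ B) : ∀ x ∈ I * J, x * (u * v) ∈ B := by
          intro x hx
          have hx' : x ∈ (I : Submodule A K) * (J : Submodule A K) := by
            rw [← FractionalIdeal.coe_mul]; exact hx
          refine Submodule.mul_induction_on hx' (fun y hy z hz => ?_) fun y z hy hz => ?_
          · rw [mul_mul_mul_comm]
            exact B.mul_mem (hI y hy) (hJ z hz)
          · rw [add_mul]
            exact B.add_mem hy hz
        rintro p q ⟨hp, hp'⟩ ⟨hq, hq'⟩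
        constructor
        · simpa [mul_comm] using key _ _ _ _ hp hq
        · simpa [mul_comm] using key _ _ _ _ hp' hq'
      inv_mem' := by
        rintro p ⟨hp, hp'⟩
        refine ⟨?_, ?_⟩
        · simpa using hp'
        · simpa using hp }
  have hH (j : Fin r) : (a j, ρ j) ∈ H := by
    constructor
    · intro x hx
      have hx' : x ∈ Submodule.span B {(ρ j : K)} := by
        rw [← h j]
        exact Submodule.subset_span hx
      obtain ⟨b, rfl⟩ := Submodule.mem_span_singleton.mp hx'
      have : (b • (ρ j : K)) * (((ρ j)⁻¹ : Kˣ) : K) = b := by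
        rw [Subalgebra.smul_def, smul_eq_mul, mul_assoc, Units.mul_inv, mul_one]
      change (b • (ρ j : K)) * (((ρ j)⁻¹ : Kˣ) : K) ∈ B
      rw [this]
      exact b.2
    · intro x hx
      -- Here the containment `ρ_j ∈ 𝔞_j B` is needed: with `𝔞_j⁻¹ 𝔞_j ⊆ A` it gives `𝔞_j⁻¹ ρ_j ⊆
      -- B`.
      have hρ : (ρ j : K) ∈ Submodule.span B {x : K | x ∈ (a j : FractionalIdeal A⁰ K)} := by
        rw [h j]
        exact Submodule.mem_span_singleton_self _
      change x * (ρ j : K) ∈ B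
      refine Submodule.span_induction (p := fun y _ => x * y ∈ B) ?_ ?_ ?_ ?_ hρ
      · intro y hy
        have := FractionalIdeal.mul_mem_mul hx hy
        rw [Units.inv_mul, FractionalIdeal.mem_one_iff] at this
        obtain ⟨z, hz⟩ := this
        rw [← hz]
        exact B.algebraMap_mem z
      · rw [mul_zero]
        exact B.zero_mem
      · intro y z _ _ hy hz
        rw [mul_add]
        exact B.add_mem hy hz
      · intro b y _ hy
        rw [Subalgebra.smul_def, smul_eq_mul, mul_left_comm]
        exact B.mul_mem b.2 hy
  have hm := H.prod_mem (t := Finset.univ) (fun j _ => H.zpow_mem (hH j) (m j))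
  have e : (∏ j, (a j, ρ j) ^ m j) = (∏ j, a j ^ m j, multiPow ρ m) := by
    refine Prod.ext ?_ ?_
    · rw [Prod.fst_prod]; rfl
    · rw [Prod.snd_prod]; rfl
  rw [e] at hm
  rw [multiPow_neg]
  exact hm.1 c hc

open Classical in
/-- The frame over a ring given by generators of the fractional ideals. -/
def chartFrame {B : Subalgebra A K} {ρ : Fin r → Kˣ} (h : IsGenerator a B ρ) {R : Type*}
    [CommRing R] (t : B →+* R) : Frame a (t.comp (algebraMap A B)) where
  toFun m c := if hc : c * ((multiPow ρ (-m) : Kˣ) : K) ∈ B then t ⟨_, hc⟩ else 0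
  map_algebraMap x := by
    have e : algebraMap A K x * ((multiPow ρ (-0) : Kˣ) : K) = algebraMap A K x := by
      rw [neg_zero, multiPow_zero, Units.val_one, mul_one]
    have hx : algebraMap A K x * ((multiPow ρ (-0) : Kˣ) : K) ∈ B := by
      rw [e]
      exact B.algebraMap_mem x
    rw [dif_pos hx]
    exact congrArg t (Subtype.ext e)
  map_add hc hd := by
    have hc' := h.mul_mem hc
    have hd' := h.mul_mem hd
    rw [dif_pos hc', dif_pos hd', dif_pos (h.mul_mem (add_mem_idealPow hc hd)), ← map_add]
    exact congrArg t (Subtype.ext (add_mul _ _ _))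
  map_mul hc hd := by
    have hc' := h.mul_mem hc
    have hd' := h.mul_mem hd
    rw [dif_pos hc', dif_pos hd', dif_pos (h.mul_mem (mul_mem_idealPow hc hd)), ← map_mul]
    refine congrArg t (Subtype.ext ?_)
    change _ * _ * _ = (_ * _) * (_ * _)
    rw [neg_add, multiPow_add, Units.val_mul, mul_mul_mul_comm]

theorem chartFrame_apply {B : Subalgebra A K} {ρ : Fin r → Kˣ} (h : IsGenerator a B ρ) {R : Type*}
    [CommRing R] (t : B →+* R) {m : Fin r → ℤ} {c : K} (b : B)
    (hb : (b : K) = c * ((multiPow ρ (-m) : Kˣ) : K)) : (chartFrame h t).toFun m c = t b := by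
  classical
  have hc : c * ((multiPow ρ (-m) : Kˣ) : K) ∈ B := hb ▸ b.2
  change (if hc : c * ((multiPow ρ (-m) : Kˣ) : K) ∈ B then t ⟨_, hc⟩ else 0) = _
  rw [dif_pos hc]
  exact congrArg t (Subtype.ext hb.symm)

/-- The frame over the fraction field. -/
def fieldFrame (a : Fin r → (FractionalIdeal A⁰ K)ˣ) {R : Type*} [CommRing R] (t : K →+* R) :
    Frame a (t.comp (algebraMap A K)) where
  toFun _ c := t c
  map_algebraMap _ := rfl
  map_add _ _ := map_add t _ _
  map_mul _ _ := map_mul t _ _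

/-- As `I⁻¹ I = A` is not contained in `p`, some product `h = e z` with `e ∈ I⁻¹` and `z ∈ I` lies
outside `p`. Then `h x = (e x) z` with `e x ∈ A` for all `x ∈ I`. -/
theorem exists_mul_notMem [IsFractionRing A K] (I : (FractionalIdeal A⁰ K)ˣ) (p : Ideal A)
    [hp : p.IsPrime] : ∃ (z : K) (h : A), z ∈ (I : FractionalIdeal A⁰ K) ∧ h ∉ p ∧
      ∀ x ∈ (I : FractionalIdeal A⁰ K), ∃ y : A, algebraMap A K h * x = algebraMap A K y * z := by
  by_contra! hcon
  have hinj := IsFractionRing.injective A K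
  have key : ∀ x ∈ (((I⁻¹ : (FractionalIdeal A⁰ K)ˣ) : FractionalIdeal A⁰ K) : Submodule A K)
      * ((I : FractionalIdeal A⁰ K) : Submodule A K), ∃ h ∈ p, algebraMap A K h = x := by
    intro x hx
    refine Submodule.mul_induction_on hx (fun e he z hz => ?_) ?_
    · have hez := FractionalIdeal.mul_mem_mul he hz
      rw [Units.inv_mul, FractionalIdeal.mem_one_iff] at hez
      obtain ⟨h, hh⟩ := hez
      refine ⟨h, ?_, hh⟩
      by_contra hhp
      obtain ⟨x, hx, hx'⟩ := hcon z h hz hhp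
      have hex := FractionalIdeal.mul_mem_mul he hx
      rw [Units.inv_mul, FractionalIdeal.mem_one_iff] at hex
      obtain ⟨y, hy⟩ := hex
      refine hx' y ?_
      rw [hh, hy]
      ring
    · rintro x y ⟨h, hh, rfl⟩ ⟨h', hh', rfl⟩
      exact ⟨h + h', p.add_mem hh hh', map_add _ _ _⟩
  obtain ⟨h, hh, h1⟩ := key 1 (by
    rw [← FractionalIdeal.coe_mul, Units.inv_mul]
    exact FractionalIdeal.one_mem_one _)
  rw [← map_one (algebraMap A K)] at h1
  exact hp.ne_top ((Ideal.eq_top_iff_one p).mpr (hinj h1 ▸ hh))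

/-- Locally on `Spec A`, the fractional ideals are principal. -/
theorem exists_chart [IsDomain A] [IsFractionRing A K] (a : Fin r → (FractionalIdeal A⁰ K)ˣ)
    (p : Spec (CommRingCat.of A)) :
    ∃ (B : Subalgebra A K) (ρ : Fin r → Kˣ),
      IsOpenImmersion (Spec.map (CommRingCat.ofHom (algebraMap A B))) ∧ IsGenerator a B ρ ∧
      ∃ q, Spec.map (CommRingCat.ofHom (algebraMap A B)) q = p := by
  have hinj := IsFractionRing.injective A K
  choose z h hz hhp hgen using fun j => 
    exists_mul_notMem (a j) p.asIdeal (hp := PrimeSpectrum.isPrime p)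
  -- Inverting all the `h_j` at once makes each `z_j` a generator of `𝔞_j`, while `H ∉ p` keeps `p`
  -- in the chart.
  let H : A := ∏ j, h j
  have hH : H ∉ p.asIdeal := by
    simp only [H]
    rw [p.isPrime.prod_mem_iff]
    push Not
    exact fun j _ => hhp j
  have hH0 : H ≠ 0 := fun h0 => hH (h0 ▸ p.asIdeal.zero_mem)
  have hS : Submonoid.powers H ≤ A⁰ := powers_le_nonZeroDivisors_of_noZeroDivisors hH0
  let B : Subalgebra A K := Localization.subalgebra.ofField K (Submonoid.powers H) hS
  have hB : IsLocalization.Away H B :=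
    Localization.subalgebra.isLocalization_ofField K (Submonoid.powers H) hS
  have hHB : (algebraMap A K H)⁻¹ ∈ B :=
    ⟨1, H, Submonoid.mem_powers H, by rw [map_one, one_mul]⟩
  have hhB (j : Fin r) : (algebraMap A K (h j))⁻¹ ∈ B := by
    have e : (algebraMap A K (h j))⁻¹
        = algebraMap A K (∏ i ∈ Finset.univ.erase j, h i) * (algebraMap A K H)⁻¹ := by
      have hj : H = h j * ∏ i ∈ Finset.univ.erase j, h i :=
        (Finset.mul_prod_erase _ _ (Finset.mem_univ j)).symm
      have hne : algebraMap A K (∏ i ∈ Finset.univ.erase j, h i) ≠ 0 := fun h0 => by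
        rw [map_eq_zero_iff _ hinj] at h0
        exact hH0 (by rw [hj, h0, mul_zero])
      rw [hj, map_mul, mul_inv, mul_left_comm, mul_inv_cancel₀ hne, mul_one]
    rw [e]
    exact B.mul_mem (B.algebraMap_mem _) hHB
  have hh0 (j : Fin r) : algebraMap A K (h j) ≠ 0 := fun h0 => by
    rw [map_eq_zero_iff _ hinj] at h0
    exact hhp j (h0 ▸ p.asIdeal.zero_mem)
  have hz0 (j : Fin r) : z j ≠ 0 := by
    intro h0
    have hI : (a j : FractionalIdeal A⁰ K) = 0 := by
      rw [← FractionalIdeal.coeToSubmodule_inj, FractionalIdeal.coe_zero, eq_bot_iff]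
      intro x hx
      obtain ⟨y, hy⟩ := hgen j x hx
      rw [h0, mul_zero, mul_eq_zero] at hy
      exact hy.resolve_left (hh0 j)
    exact (a j).ne_zero hI
  refine ⟨B, fun j => Units.mk0 (z j) (hz0 j), IsOpenImmersion.of_isLocalization H, fun j => ?_, ?_⟩
  · refine le_antisymm (Submodule.span_le.mpr fun x hx => ?_)
      (Submodule.span_mono (Set.singleton_subset_iff.mpr (hz j)))
    obtain ⟨y, hy⟩ := hgen j x hx
    refine Submodule.mem_span_singleton.mpr
      ⟨⟨algebraMap A K y * (algebraMap A K (h j))⁻¹, B.mul_mem (B.algebraMap_mem _) (hhB j)⟩, ?_⟩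
    rw [Subalgebra.smul_def, smul_eq_mul, Units.val_mk0]
    change algebraMap A K y * (algebraMap A K (h j))⁻¹ * z j = x
    rw [mul_right_comm, ← hy, mul_comm, ← mul_assoc, inv_mul_cancel₀ (hh0 j), one_mul]
  · have := PrimeSpectrum.localization_away_comap_range B H
    have hp : p ∈ Set.range (PrimeSpectrum.comap (algebraMap A B)) := by
      rw [this]
      exact hH
    exact hp

variable [IsDomain A] [IsFractionRing A K]

/-- A chart of `Spec A` at a point, over which the fractional ideals are principal. -/
def chartRing (a : Fin r → (FractionalIdeal A⁰ K)ˣ) (p : Spec (CommRingCat.of A)) :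
    Subalgebra A K :=
  (exists_chart a p).choose

/-- Generators of the fractional ideals over a chart. -/
def chartGen (a : Fin r → (FractionalIdeal A⁰ K)ˣ) (p : Spec (CommRingCat.of A)) : Fin r → Kˣ :=
  (exists_chart a p).choose_spec.choose

theorem chartGen_isGenerator (a : Fin r → (FractionalIdeal A⁰ K)ˣ) (p : Spec (CommRingCat.of A)) :
    IsGenerator a (chartRing a p) (chartGen a p) :=
  (exists_chart a p).choose_spec.choose_spec.2.1

/-- The immersion of a chart in `Spec A`. -/
def chartMap (a : Fin r → (FractionalIdeal A⁰ K)ˣ) (p : Spec (CommRingCat.of A)) :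
    Spec (CommRingCat.of (chartRing a p)) ⟶ Spec (CommRingCat.of A) :=
  Spec.map (CommRingCat.ofHom (algebraMap A (chartRing a p)))

instance (a : Fin r → (FractionalIdeal A⁰ K)ˣ) (p : Spec (CommRingCat.of A)) :
    IsOpenImmersion (chartMap a p) :=
  (exists_chart a p).choose_spec.choose_spec.1

/-- The covering of `Spec A` by charts. -/
def chartCover (a : Fin r → (FractionalIdeal A⁰ K)ˣ) : (Spec (CommRingCat.of A)).OpenCover :=
  Scheme.Cover.mkOfCovers (Spec (CommRingCat.of A)) (fun p => Spec (CommRingCat.of (chartRing a p)))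
    (chartMap a) (fun p => ⟨p, (exists_chart a p).choose_spec.choose_spec.2.2⟩) inferInstance

/-- The covering of a scheme over `Spec A` by the preimages of charts. -/
def chartPullback (a : Fin r → (FractionalIdeal A⁰ K)ˣ) {T : Scheme.{u}}
    (t : T ⟶ Spec (CommRingCat.of A)) : T.OpenCover :=
  (chartCover a).pullback₁ t

/-- The preimage of a chart. -/
abbrev chartPreimage (a : Fin r → (FractionalIdeal A⁰ K)ˣ) {T : Scheme.{u}}
    (t : T ⟶ Spec (CommRingCat.of A)) (p : Spec (CommRingCat.of A)) : Scheme.{u} :=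
  pullback t (chartMap a p)

/-- The immersion of the preimage of a chart. -/
def chartPreimageι (a : Fin r → (FractionalIdeal A⁰ K)ˣ) {T : Scheme.{u}}
    (t : T ⟶ Spec (CommRingCat.of A)) (p : Spec (CommRingCat.of A)) : chartPreimage a t p ⟶ T :=
  pullback.fst t (chartMap a p)

theorem chart_hom_ext (a : Fin r → (FractionalIdeal A⁰ K)ˣ) {T X : Scheme.{u}}
    (t : T ⟶ Spec (CommRingCat.of A)) {x y : T ⟶ X}
    (h : ∀ p, chartPreimageι a t p ≫ x = chartPreimageι a t p ≫ y) : x = y :=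
  (chartPullback a t).hom_ext x y h

/-- The frame over the preimage of a chart. -/
def preimageFrame (a : Fin r → (FractionalIdeal A⁰ K)ˣ) {T : Scheme.{u}}
    (t : T ⟶ Spec (CommRingCat.of A)) (p : Spec (CommRingCat.of A)) :
    Frame a ((locus.eval (pullback.snd t (chartMap a p))).comp (algebraMap A (chartRing a p))) :=
  chartFrame (chartGen_isGenerator a p) _

theorem eval_chartPreimageι (a : Fin r → (FractionalIdeal A⁰ K)ˣ) {T : Scheme.{u}}
    (t : T ⟶ Spec (CommRingCat.of A)) (p : Spec (CommRingCat.of A)) :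
    (locus.eval (pullback.snd t (chartMap a p))).comp (algebraMap A (chartRing a p))
      = locus.eval (chartPreimageι a t p ≫ t) := by
  rw [← eval_specMap_comp]
  exact congrArg locus.eval pullback.condition.symm

end Charts

/-! ### Twists of an invariant morphism -/

section TwistedProjection

variable {A K : Type u} [CommRing A] [IsDomain A] [Field K] [Algebra A K] [IsFractionRing A K]
  {r N : ℕ} {deg : Fin N → Fin r → ℤ} {a : Fin r → (FractionalIdeal A⁰ K)ˣ}
  {m s : ℕ} {g : Fin s → MvPolynomial (Fin N) A} {f : Fin m → MvPolynomial (Fin N) A}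
  {dg : Fin s → Fin r → ℤ} {df : Fin m → Fin r → ℤ}
  (hg : ∀ i, IsWeightedHomogeneous deg (g i) (dg i))
  (hf : ∀ i, IsWeightedHomogeneous deg (f i) (df i))
  {X : Scheme.{u}} {π : torsorSpace g f ⟶ X}
  (hinv : ∀ {T : Scheme.{u}} (t : Torus r T) (z : T ⟶ torsorSpace g f),
    (torsorAction deg g f hg hf).act t z ≫ π = z ≫ π)

omit [IsDomain A] [IsFractionRing A K] in
include hinv in
-- With `t` the ratio of the frames, `Θ` matches `t y` both with `z'` and with `t z`, so `z' = t z`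
-- and invariance of `π` applies. This makes the twisted projection independent of the frame.
theorem Frame.Matches.comp_eq {T : Scheme.{u}} {φ φ' : A →+* Γ(T, ⊤)} {Θ : Frame a φ}
    {Θ' : Frame a φ'} {y : T ⟶ twist deg a g f} {z z' : T ⟶ torsorSpace g f}
    (h : Θ.Matches y z) (h' : Θ'.Matches y z') : z ≫ π = z' ≫ π := by
  obtain rfl : φ = φ' := RingHom.ext fun x => by rw [← h.left, ← h'.left]
  obtain ⟨t, ht⟩ := Θ.exists_ratio Θ'
  have h1 := h'.act_of_ratio t ht
  have h2 := h.act hg hf t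
  rw [h1.right_unique h2, hinv]

include hg in
theorem exists_matches_chart {T : Scheme.{u}} (y : T ⟶ twist deg a g f)
    (p : Spec (CommRingCat.of A)) :
    ∃ (z : chartPreimage a (y ≫ twistStr deg a g f) p ⟶ torsorSpace g f) (φ : A →+* _)
      (Θ : Frame a φ), Θ.Matches (chartPreimageι a (y ≫ twistStr deg a g f) p ≫ y) z := by
  obtain ⟨z, hz⟩ := Frame.exists_matches_right hg (preimageFrame a (y ≫ twistStr deg a g f) p)
    (chartPreimageι a (y ≫ twistStr deg a g f) p ≫ y) (fun x => by
      rw [eval_chartPreimageι, ← Category.assoc, eval_comp_twistStr]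
      rfl)
  exact ⟨z, _, _, hz⟩

include hg in
/-- Locally, the points of the twist correspond to points of `Y`. -/
theorem exists_cover_matches {T : Scheme.{u}} (y : T ⟶ twist deg a g f) :
    ∃ 𝒱 : Scheme.OpenCover.{u} T, ∀ i, ∃ (z : 𝒱.X i ⟶ torsorSpace g f) (φ : A →+* _)
      (Θ : Frame a φ), Θ.Matches (𝒱.f i ≫ y) z :=
  ⟨chartPullback a (y ≫ twistStr deg a g f), exists_matches_chart hg y⟩

/-- The morphism `ψ` is obtained from `π` by means of frames. -/
def IsFrameProjection (π : torsorSpace g f ⟶ X) (ψ : twist deg a g f ⟶ X) : Prop :=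
  ∀ {T : Scheme.{u}} {φ : A →+* Γ(T, ⊤)} (Θ : Frame a φ) (y : T ⟶ twist deg a g f)
    (z : T ⟶ torsorSpace g f), Θ.Matches y z → y ≫ ψ = z ≫ π

include hinv in
-- On a cover with frames, `π` at the matched points defines `ψ`. The independence of the frame
-- yields both the agreement on overlaps and the compatibility with every other frame.
theorem exists_isFrameProjection : ∃ ψ : twist deg a g f ⟶ X, IsFrameProjection π ψ := by
  obtain ⟨𝒱, h𝒱⟩ := exists_cover_matches (a := a) (f := f) hg (𝟙 (twist deg a g f))
  choose z φ Θ hz using h𝒱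
  simp only [Category.comp_id] at hz
  obtain ⟨ψ, hψ⟩ : ∃ ψ : twist deg a g f ⟶ X, ∀ i, 𝒱.f i ≫ ψ = z i ≫ π := by
    refine ⟨Scheme.Cover.glueMorphisms 𝒱 (fun i => z i ≫ π) fun i j => ?_,
      fun i => Scheme.Cover.ι_glueMorphisms 𝒱 _ _ i⟩
    rw [← Category.assoc, ← Category.assoc]
    have h1 := (hz i).comp (pullback.fst (𝒱.f i) (𝒱.f j))
    have h2 := (hz j).comp (pullback.snd (𝒱.f i) (𝒱.f j))
    rw [← pullback.condition] at h2
    exact h1.comp_eq hg hf hinv h2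
  refine ⟨ψ, fun {T φ} Θ y w h => hom_ext_of_pullback 𝒱 y fun i => ?_⟩
  rw [pullback.condition_assoc, hψ, ← Category.assoc, ← Category.assoc]
  have h1 := h.comp (pullback.fst y (𝒱.f i))
  have h2 := (hz i).comp (pullback.snd y (𝒱.f i))
  rw [← pullback.condition] at h2
  exact h2.comp_eq hg hf hinv h1

omit [IsDomain A] [IsFractionRing A K] in
-- The frame of a chart sends `c ∈ 𝔞^{-deg x_i}` to the function `c ρ^{deg x_i}`, so both sides
-- express the same relation between the coordinates of `y` and `z`.
theorem isChartImage_iff {B : Subalgebra A K} {ρ : Fin r → Kˣ} (h : IsGenerator a B ρ)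
    {T : Scheme.{u}} {t : T ⟶ Spec (CommRingCat.of B)} {y : T ⟶ twist deg a g f}
    (hy : t ≫ Spec.map (CommRingCat.ofHom (algebraMap A B)) = y ≫ twistStr deg a g f)
    {z : T ⟶ torsorSpace g f} :
    IsChartImage deg a g f B ρ t y z ↔ (chartFrame h (locus.eval t)).Matches y z := by
  have hφ : (locus.eval t).comp (algebraMap A B) = locus.eval (y ≫ twistStr deg a g f) := by
    rw [← hy, eval_specMap_comp]
  have hρ (n : Fin r → ℤ) : (∏ j, ρ j ^ n j : Kˣ) = multiPow ρ (- -n) := by rw [neg_neg]; rfl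
  constructor
  · rintro ⟨hz, hX⟩
    refine ⟨fun x => ?_, fun x => ?_, fun i c hc => ?_⟩
    · rw [hφ, eval_comp_twistStr]
      rfl
    · rw [hφ, ← hz, eval_comp_torsorSpaceStr]
      rfl
    · have hb := h.mul_mem hc
      rw [chartFrame_apply h _ ⟨_, hb⟩ rfl]
      refine hX i c hc _ ⟨_, hb⟩ rfl ?_
      rw [hρ]
  · intro hM
    refine ⟨eval_injective (RingHom.ext fun x => ?_), fun i c hc p b hp hb => ?_⟩
    · rw [eval_comp_torsorSpaceStr, ← hφ]
      exact hM.right x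
    · obtain rfl : p = ⟨C c * MvPolynomial.X i, C_mul_X_mem_twistRing deg a hc⟩ := Subtype.ext hp
      rw [hρ] at hb
      rw [← chartFrame_apply h (locus.eval t) b hb]
      exact hM.apply i c hc

include hg in
-- For uniqueness one choice of generators over each chart of a cover is enough. Conversely a frame
-- projection is compatible with every frame, in particular with those of all `B` and `ρ`.
theorem isTwistedProjection_iff {ψ : twist deg a g f ⟶ X} (hψ : IsFrameProjection π ψ)
    {ψ' : twist deg a g f ⟶ X} : IsTwistedProjection deg a g f π ψ' ↔ ψ' = ψ := by
  constructor
  · intro h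
    refine chart_hom_ext a (twistStr deg a g f) fun p => ?_
    obtain ⟨z, hz, hz'⟩ := h (chartRing a p) (inferInstanceAs (IsOpenImmersion (chartMap a p)))
      (chartGen a p) (chartGen_isGenerator a p) _ (pullback.snd (twistStr deg a g f) (chartMap a p))
      (pullback.fst _ _) pullback.condition.symm
    refine hz'.trans (hψ _ _ _ ((isChartImage_iff (chartGen_isGenerator a p) ?_).mp hz)).symm
    exact pullback.condition.symm
  · rintro rfl B hB ρ hρ T t y hy
    obtain ⟨z, hz⟩ := Frame.exists_matches_right hg
      (chartFrame (a := a) (B := B) (ρ := ρ) hρ (locus.eval t)) y fun x => by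
        rw [← eval_specMap_comp, hy, eval_comp_twistStr]
        rfl
    exact ⟨z, (isChartImage_iff hρ hy).mpr hz, hψ _ _ _ hz⟩

include hg in
theorem IsFrameProjection.comp_eq {ψ : twist deg a g f ⟶ X} (hψ : IsFrameProjection π ψ)
    {pX : X ⟶ Spec (CommRingCat.of A)} (hπ : π ≫ pX = torsorSpaceStr g f) :
    ψ ≫ pX = twistStr deg a g f := by
  obtain ⟨𝒱, h𝒱⟩ := exists_cover_matches (a := a) (f := f) hg (𝟙 (twist deg a g f))
  refine Scheme.Cover.hom_ext 𝒱 _ _ fun i => ?_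
  obtain ⟨z, φ, Θ, hz⟩ := h𝒱 i
  rw [Category.comp_id] at hz
  rw [← Category.assoc, hψ _ _ _ hz, Category.assoc, hπ]
  refine eval_injective (RingHom.ext fun x => ?_)
  rw [eval_comp_torsorSpaceStr, eval_comp_twistStr]
  exact (hz.right x).trans (hz.left x).symm

end TwistedProjection

/-! ### Gluing sections -/

section Glue

theorem section_ext {T : Scheme.{u}} (𝒱 : Scheme.OpenCover.{u} T) {x y : Γ(T, ⊤)}
    (h : ∀ i, (𝒱.f i).appTop.hom x = (𝒱.f i).appTop.hom y) : x = y :=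
  Scheme.OpenCover.ext_elem x y 𝒱 h

/-- Functions are morphisms to the affine line over `ℤ`, so this is an instance of gluing morphisms.
`ULift` only adjusts the universe. -/
theorem exists_section_glue {T : Scheme.{u}} (𝒱 : Scheme.OpenCover.{u} T)
    (x : ∀ i, Γ(𝒱.X i, ⊤)) (h : ∀ i j, (pullback.fst (𝒱.f i) (𝒱.f j)).appTop.hom (x i)
      = (pullback.snd (𝒱.f i) (𝒱.f j)).appTop.hom (x j)) :
    ∃ y : Γ(T, ⊤), ∀ i, (𝒱.f i).appTop.hom y = x i := by
  let B : Type u := ULift.{u} (Polynomial ℤ)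
  let ev {T : Scheme.{u}} (x : Γ(T, ⊤)) : B →+* Γ(T, ⊤) :=
    (Polynomial.eval₂RingHom (Int.castRingHom _) x).comp (ULift.ringEquiv (R := Polynomial ℤ))
  have hev {T : Scheme.{u}} (x : Γ(T, ⊤)) : ev x (ULift.up Polynomial.X) = x :=
    Polynomial.eval₂_X _ _
  have hext {R : Type u} [CommRing R] {α β : B →+* R}
      (hαβ : α (ULift.up Polynomial.X) = β (ULift.up Polynomial.X)) : α = β := by
    have : α.comp (ULift.ringEquiv (R := Polynomial ℤ)).symm.toRingHom
        = β.comp (ULift.ringEquiv (R := Polynomial ℤ)).symm.toRingHom :=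
      Polynomial.ringHom_ext' (Subsingleton.elim _ _) hαβ
    refine RingHom.ext fun b => ?_
    exact congrArg (fun φ : Polynomial ℤ →+* R => φ b.down) this
  let F : T ⟶ Spec (CommRingCat.of B) :=
    Scheme.Cover.glueMorphisms 𝒱 (fun i => locus.ofEval (ev (x i))) fun i j => by
      refine eval_injective (hext ?_)
      rw [locus.eval_comp, locus.eval_comp, locus.eval_ofEval, locus.eval_ofEval, hev, hev, h]
  have hF (i) : 𝒱.f i ≫ F = locus.ofEval (ev (x i)) := Scheme.Cover.ι_glueMorphisms 𝒱 _ _ i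
  refine ⟨locus.eval F (ULift.up Polynomial.X), fun i => ?_⟩
  rw [← locus.eval_comp, hF, locus.eval_ofEval, hev]

theorem Torus.res_apply {r : ℕ} {T T' : Scheme.{u}} (h : T' ⟶ T) (s : Torus r T) (j : Fin r) :
    ((Torus.res h s j : Γ(T', ⊤)ˣ) : Γ(T', ⊤)) = h.appTop.hom (s j) := rfl

theorem Torus.ext_of_cover {r : ℕ} {T : Scheme.{u}} (𝒱 : Scheme.OpenCover.{u} T) {s t : Torus r T}
    (h : ∀ i, Torus.res (𝒱.f i) s = Torus.res (𝒱.f i) t) : s = t := by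
  refine funext fun j => Units.ext (section_ext 𝒱 fun i => ?_)
  rw [← Torus.res_apply, ← Torus.res_apply, h i]

theorem Torus.exists_glue {r : ℕ} {T : Scheme.{u}} (𝒱 : Scheme.OpenCover.{u} T)
    (s : ∀ i, Torus r (𝒱.X i))
    (h : ∀ i j, Torus.res (pullback.fst (𝒱.f i) (𝒱.f j)) (s i)
      = Torus.res (pullback.snd (𝒱.f i) (𝒱.f j)) (s j)) :
    ∃ t : Torus r T, ∀ i, Torus.res (𝒱.f i) t = s i := by
  choose x hx using fun k => exists_section_glue 𝒱 (fun i => (s i k : Γ(𝒱.X i, ⊤))) fun i j => by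
    rw [← Torus.res_apply, ← Torus.res_apply, h]
  -- The inverses are glued separately; their products with the `x k` are one locally, hence
  -- globally.
  choose y hy using fun k => exists_section_glue 𝒱 (fun i => ((s⁻¹ i k : Γ(𝒱.X i, ⊤)ˣ) : Γ(𝒱.X i, ⊤)))
    fun i j => by
      simp only [Pi.inv_apply]
      rw [← Pi.inv_apply (s i), ← Pi.inv_apply (s j), ← Torus.res_apply, ← Torus.res_apply, map_inv,
        map_inv, h]
  have hxy (k) : x k * y k = 1 := section_ext 𝒱 fun i => by
    rw [map_mul, hx, hy, map_one]
    exact Units.mul_inv _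
  refine ⟨fun k => ⟨x k, y k, hxy k, by rw [mul_comm, hxy]⟩, fun i => funext fun k => Units.ext ?_⟩
  exact hx k i

end Glue

/-! ### Twists of torsors -/

section TwistTorsor

variable {A K : Type u} [CommRing A] [IsDomain A] [Field K] [Algebra A K] [IsFractionRing A K]
  {r N : ℕ} {deg : Fin N → Fin r → ℤ} {a : Fin r → (FractionalIdeal A⁰ K)ˣ}
  {m s : ℕ} {g : Fin s → MvPolynomial (Fin N) A} {f : Fin m → MvPolynomial (Fin N) A}
  {dg : Fin s → Fin r → ℤ} {df : Fin m → Fin r → ℤ}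
  {hg : ∀ i, IsWeightedHomogeneous deg (g i) (dg i)}
  {hf : ∀ i, IsWeightedHomogeneous deg (f i) (df i)}
  {X : Scheme.{u}} {π : torsorSpace g f ⟶ X} {ψ : twist deg a g f ⟶ X}

omit [IsDomain A] [IsFractionRing A K] in
theorem twistHom_algebraMap_eq {pX : X ⟶ Spec (CommRingCat.of A)}
    (hstr : ψ ≫ pX = twistStr deg a g f) {T : Scheme.{u}} {y y' : T ⟶ twist deg a g f}
    (h : y ≫ ψ = y' ≫ ψ) (x : A) :
    twistHom y (algebraMap A (twistRing deg a) x) = twistHom y' (algebraMap A _ x) := by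
  have := congrArg (fun q => locus.eval (q ≫ pX) x) h
  simp only [Category.assoc, hstr, eval_comp_twistStr] at this
  exact this

omit [IsDomain A] [IsFractionRing A K] in
-- As `y` and `y'` lie over the same point of `Spec A`, one frame matches both with points of `Y`.
-- These have the same image under `π`, and matching is equivariant and unique in both directions.
theorem Frame.Matches.existsUnique_act_eq (hψ : IsFrameProjection π ψ)
    (htors : IsTorsor (torsorAction deg g f hg hf) π) {pX : X ⟶ Spec (CommRingCat.of A)}
    (hstr : ψ ≫ pX = twistStr deg a g f) {T : Scheme.{u}} {φ : A →+* Γ(T, ⊤)} {Θ : Frame a φ}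
    {y y' : T ⟶ twist deg a g f} {z : T ⟶ torsorSpace g f} (h : Θ.Matches y z)
    (hy : y ≫ ψ = y' ≫ ψ) : ∃! t : Torus r T, (twistAction deg a g f).act t y = y' := by
  obtain ⟨z', h'⟩ := Θ.exists_matches_right hg y' fun x => by
    rw [← h.left, twistHom_algebraMap_eq hstr hy]
  have hz : z ≫ π = z' ≫ π := by rw [← hψ _ _ _ h, ← hψ _ _ _ h', hy]
  obtain ⟨t, ht, huniq⟩ := htors.existsUnique_act_eq z z' hz
  have ht' : (torsorAction deg g f hg hf).act t z = z' := ht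
  refine ⟨t, ?_, fun t' ht' => huniq t' ?_⟩
  · have := h.act hg hf t
    rw [ht'] at this
    exact this.left_unique h'
  · have := h.act hg hf t'
    rw [show (twistAction deg a g f).act t' y = y' from ht'] at this
    exact this.right_unique h'

omit [IsDomain A] [IsFractionRing A K] in
-- The pullback of the frame of a chart is again the frame of that chart, which makes matches over
-- different schemes comparable.
theorem chartFrame_matches_comp {B : Subalgebra A K} {ρ : Fin r → Kˣ} (h : IsGenerator a B ρ)
    {T T' : Scheme.{u}} {t : T ⟶ Spec (CommRingCat.of B)} {y : T ⟶ twist deg a g f}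
    {z : T ⟶ torsorSpace g f} (hM : (chartFrame h (locus.eval t)).Matches y z) (k : T' ⟶ T) :
    (chartFrame h (locus.eval (k ≫ t))).Matches (k ≫ y) (k ≫ z) := by
  have hk := hM.comp k
  refine ⟨fun x => ?_, fun x => ?_, fun i c hc => ?_⟩
  · exact (hk.left x).trans (locus.eval_comp k t _).symm
  · exact (hk.right x).trans (locus.eval_comp k t _).symm
  · refine (hk.apply i c hc).trans ?_
    congr 1
    rw [chartFrame_apply h _ ⟨_, h.mul_mem hc⟩ rfl, locus.eval_comp]
    exact congrArg k.appTop.hom (chartFrame_apply h _ ⟨_, h.mul_mem hc⟩ rfl)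

omit [IsDomain A] [IsFractionRing A K] in
theorem Frame.Matches.comp_str_eq {T : Scheme.{u}} {φ : A →+* Γ(T, ⊤)} {Θ : Frame a φ}
    {y : T ⟶ twist deg a g f} {z : T ⟶ torsorSpace g f} (h : Θ.Matches y z) :
    y ≫ twistStr deg a g f = z ≫ torsorSpaceStr g f := by
  refine eval_injective (RingHom.ext fun x => ?_)
  rw [eval_comp_torsorSpaceStr, eval_comp_twistStr]
  exact (h.left x).trans (h.right x).symm

variable (deg a) in
include hg hf in
/-- Over a chart, the twist is isomorphic to `Y`. -/
theorem exists_chart_iso (p : Spec (CommRingCat.of A)) :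
    ∃ e : chartPreimage a (twistStr deg a g f) p ≅ chartPreimage a (torsorSpaceStr g f) p,
      (preimageFrame a (twistStr deg a g f) p).Matches (chartPreimageι a (twistStr deg a g f) p)
        (e.hom ≫ chartPreimageι a (torsorSpaceStr g f) p) := by
  obtain ⟨z, hz⟩ := Frame.exists_matches_right hg (preimageFrame a (twistStr deg a g f) p)
    (chartPreimageι a (twistStr deg a g f) p) (fun x => by
      rw [eval_chartPreimageι, eval_comp_twistStr]
      rfl)
  obtain ⟨y, hy⟩ := Frame.exists_matches_left hf (preimageFrame a (torsorSpaceStr g f) p)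
    (chartPreimageι a (torsorSpaceStr g f) p) (fun x => by
      rw [eval_chartPreimageι, eval_comp_torsorSpaceStr]
      rfl)
  let v : chartPreimage a (twistStr deg a g f) p ⟶ chartPreimage a (torsorSpaceStr g f) p :=
    pullback.lift z (pullback.snd _ _) (hz.comp_str_eq.symm.trans pullback.condition)
  let w : chartPreimage a (torsorSpaceStr g f) p ⟶ chartPreimage a (twistStr deg a g f) p :=
    pullback.lift y (pullback.snd _ _) (hy.comp_str_eq.trans pullback.condition)
  have hv1 : v ≫ chartPreimageι a (torsorSpaceStr g f) p = z := pullback.lift_fst _ _ _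
  have hv2 : v ≫ pullback.snd _ _ = pullback.snd _ _ := pullback.lift_snd _ _ _
  have hw1 : w ≫ chartPreimageι a (twistStr deg a g f) p = y := pullback.lift_fst _ _ _
  have hw2 : w ≫ pullback.snd _ _ = pullback.snd _ _ := pullback.lift_snd _ _ _
  have h1 := chartFrame_matches_comp (chartGen_isGenerator a p) hy v
  have h2 := chartFrame_matches_comp (chartGen_isGenerator a p) hz w
  rw [hv2] at h1
  rw [hw2] at h2
  -- Both composites are identities by uniqueness of matches; this applies because `v` and `w`
  -- commute with the projections to the chart, so that the frames agree.
  have e1 : v ≫ y = chartPreimageι a (twistStr deg a g f) p :=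
    h1.left_unique (by rw [hv1]; exact hz)
  have e2 : w ≫ z = chartPreimageι a (torsorSpaceStr g f) p :=
    h2.right_unique (by rw [hw1]; exact hy)
  refine ⟨⟨v, w, pullback.hom_ext ?_ ?_, pullback.hom_ext ?_ ?_⟩, ?_⟩
  · change (v ≫ w) ≫ chartPreimageι a (twistStr deg a g f) p = _
    rw [Category.assoc, hw1, e1, Category.id_comp]
    rfl
  · rw [Category.assoc, hw2, hv2, Category.id_comp]
  · change (w ≫ v) ≫ chartPreimageι a (torsorSpaceStr g f) p = _
    rw [Category.assoc, hv1, e2, Category.id_comp]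
    rfl
  · rw [Category.assoc, hv2, hw2, Category.id_comp]
  · rw [hv1]
    exact hz

instance {T : Scheme.{u}} (t : T ⟶ Spec (CommRingCat.of A)) (p : Spec (CommRingCat.of A)) :
    IsOpenImmersion (chartPreimageι a t p) :=
  inferInstanceAs (IsOpenImmersion (pullback.fst t (chartMap a p)))

theorem exists_chartPreimageι_eq {T : Scheme.{u}} (t : T ⟶ Spec (CommRingCat.of A)) (x : T) :
    ∃ p q, chartPreimageι a t p q = x := by
  obtain ⟨q, hq⟩ := (exists_chart a (t x)).choose_spec.choose_spec.2.2
  obtain ⟨w, hw, -⟩ := Scheme.Pullback.exists_preimage_pullback (f := t) (g := chartMap a (t x))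
    x q hq.symm
  exact ⟨t x, w, hw⟩

/-- The twists of a torsor are torsors. -/
theorem IsFrameProjection.isTorsor (hψ : IsFrameProjection π ψ)
    (htors : IsTorsor (torsorAction deg g f hg hf) π) {pX : X ⟶ Spec (CommRingCat.of A)}
    (hstr : ψ ≫ pX = twistStr deg a g f) : IsTorsor (twistAction deg a g f) ψ := by
  have hflat := htors.flat
  have hsurj := htors.surjective
  have hlfp := htors.locallyOfFinitePresentation
  choose e he using exists_chart_iso deg a (hg := hg) (hf := hf)
  -- Over each chart, `ψ` is the restriction of `π` up to an isomorphism of the sources.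
  have hloc (p) : chartPreimageι a (twistStr deg a g f) p ≫ ψ
      = (e p).hom ≫ chartPreimageι a (torsorSpaceStr g f) p ≫ π := by
    rw [hψ _ _ _ (he p), Category.assoc]
  refine ⟨?_, ?_, ?_, fun {T} t y => ?_, fun {T} y y' hyy => ?_⟩
  · have hP : IsZariskiLocalAtSource @Flat.{u} :=
      HasRingHomProperty.instIsZariskiLocalAtSource (P := @Flat)
    have hcov : ∀ p : Spec (CommRingCat.of A),
        Flat (chartPreimageι a (twistStr deg a g f) p ≫ ψ) := fun p => by
      rw [hloc]
      infer_instance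
    exact (IsZariskiLocalAtSource.iff_of_openCover (P := @Flat)
      (chartPullback a (twistStr deg a g f))).mpr hcov
  · refine ⟨fun x => ?_⟩
    obtain ⟨z, rfl⟩ := hsurj.surj x
    obtain ⟨p, q, rfl⟩ := exists_chartPreimageι_eq (a := a) (torsorSpaceStr g f) z
    refine ⟨chartPreimageι a (twistStr deg a g f) p ((e p).inv q), ?_⟩
    have := congrArg (fun k => (e p).inv ≫ k) (hloc p)
    simp only [Iso.inv_hom_id_assoc] at this
    have h2 := congrArg (fun k => k q) this
    simpa using h2
  · have hP : IsZariskiLocalAtSource @LocallyOfFinitePresentation.{u} :=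
      HasRingHomProperty.instIsZariskiLocalAtSource (P := @LocallyOfFinitePresentation)
    have hcov : ∀ p : Spec (CommRingCat.of A),
        LocallyOfFinitePresentation (chartPreimageι a (twistStr deg a g f) p ≫ ψ) := fun p => by
      rw [hloc]
      infer_instance
    exact (IsZariskiLocalAtSource.iff_of_openCover (P := @LocallyOfFinitePresentation)
      (chartPullback a (twistStr deg a g f))).mpr hcov
  · obtain ⟨𝒱, h𝒱⟩ := exists_cover_matches (a := a) (f := f) hg y
    refine Scheme.Cover.hom_ext 𝒱 _ _ fun i => ?_
    obtain ⟨z, φ, Θ, hz⟩ := h𝒱 i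
    have h1 := hz.act hg hf (Torus.res (𝒱.f i) t)
    rw [← Category.assoc, (twistAction deg a g f).comp_act, hψ _ _ _ h1, htors.act_comp,
      ← hψ _ _ _ hz, Category.assoc]
  · obtain ⟨𝒱, h𝒱⟩ := exists_cover_matches (a := a) (f := f) hg y
    -- Unique existence is stated after every base change `k`, so that it also applies on overlaps
    -- when the local solutions are glued.
    have hloc' (i) {T' : Scheme.{u}} (k : T' ⟶ 𝒱.X i) :
        ∃! t : Torus r T', (twistAction deg a g f).act t (k ≫ 𝒱.f i ≫ y) = k ≫ 𝒱.f i ≫ y' := by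
      obtain ⟨z, φ, Θ, hz⟩ := h𝒱 i
      exact (hz.comp k).existsUnique_act_eq hψ htors hstr (by simp only [Category.assoc, hyy])
    choose t ht using fun i => (hloc' i (𝟙 _)).exists
    simp only [Category.id_comp] at ht
    have hres (i) {T' : Scheme.{u}} (k : T' ⟶ 𝒱.X i) :
        (twistAction deg a g f).act (Torus.res k (t i)) (k ≫ 𝒱.f i ≫ y) = k ≫ 𝒱.f i ≫ y' := by
      rw [← (twistAction deg a g f).comp_act, ht]
    obtain ⟨T0, hT0⟩ := Torus.exists_glue 𝒱 t fun i j => by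
      refine (hloc' i (pullback.fst (𝒱.f i) (𝒱.f j))).unique (hres i _) ?_
      have := hres j (pullback.snd (𝒱.f i) (𝒱.f j))
      rwa [← Category.assoc, ← Category.assoc (pullback.snd (𝒱.f i) (𝒱.f j)),
        ← pullback.condition, Category.assoc, Category.assoc] at this
    refine ⟨T0, Scheme.Cover.hom_ext 𝒱 _ _ fun i => ?_, fun t' ht' => ?_⟩
    · rw [(twistAction deg a g f).comp_act, hT0, ht]
    · refine Torus.ext_of_cover 𝒱 fun i => ?_
      have h1 := (hloc' i (𝟙 _)).unique (y₁ := Torus.res (𝒱.f i) t') (y₂ := t i)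
      simp only [Category.id_comp] at h1
      rw [hT0]
      refine h1 ?_ (ht i)
      rw [← (twistAction deg a g f).comp_act, show (twistAction deg a g f).act t' y = y' from ht']

end TwistTorsor

/-! ### Local sections of the torsor -/

section LocalSection

variable {A : Type u} [CommRing A] {r N : ℕ} {deg : Fin N → Fin r → ℤ}
  {m s : ℕ} {g : Fin s → MvPolynomial (Fin N) A} {f : Fin m → MvPolynomial (Fin N) A}
  {dg : Fin s → Fin r → ℤ} {df : Fin m → Fin r → ℤ}
  {hg : ∀ i, IsWeightedHomogeneous deg (g i) (dg i)}
  {hf : ∀ i, IsWeightedHomogeneous deg (f i) (df i)}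
  {X : Scheme.{u}} {π : torsorSpace g f ⟶ X}

theorem pointHom_ext {T : Scheme.{u}} {z z' : T ⟶ torsorSpace g f}
    (hC : ∀ x, pointHom z (C x) = pointHom z' (C x))
    (hX : ∀ i, pointHom z (MvPolynomial.X i) = pointHom z' (MvPolynomial.X i)) : z = z' :=
  pointHom_injective (MvPolynomial.ringHom_ext hC hX)

/-- As the torus acts freely, the degrees of the nonzero coordinates of a geometric point of a
torsor generate `ℤ^r`. -/
theorem single_mem_closure_deg (htors : IsTorsor (torsorAction deg g f hg hf) π) {κ : Type u}
    [Field κ] (z : Spec (CommRingCat.of κ) ⟶ torsorSpace g f) (j : Fin r) :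
    Pi.single j 1 ∈ AddSubgroup.closure (deg '' {i | pointHom z (MvPolynomial.X i) ≠ 0}) := by
  set M := AddSubgroup.closure (deg '' {i | pointHom z (MvPolynomial.X i) ≠ 0}) with hM
  -- The spectrum of `κ[ℤ^r/M]` is the subgroup of the torus where the characters in `M` are
  -- trivial, and `t` below is its tautological point. It fixes `z`, so it is trivial by freeness,
  -- and each basis vector is zero in `ℤ^r/M`.
  let Q := (Fin r → ℤ) ⧸ M
  let R := AddMonoidAlgebra κ Q
  let T := Spec (CommRingCat.of R)
  let h : T ⟶ Spec (CommRingCat.of κ) := Spec.map (CommRingCat.ofHom (algebraMap κ R))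
  let e : R ≃+* Γ(T, ⊤) := (Scheme.ΓSpecIso (CommRingCat.of R)).commRingCatIsoToRingEquiv.symm
  let χ : Multiplicative (Fin r → ℤ) →* R :=
    (AddMonoidAlgebra.of κ Q).comp (AddMonoidHom.toMultiplicative (QuotientAddGroup.mk' M))
  let χ' : Multiplicative (Fin r → ℤ) →* Γ(T, ⊤)ˣ := ((e : R →* Γ(T, ⊤)).comp χ).toHomUnits
  let t : Torus r T := fun k => χ' (Multiplicative.ofAdd (Pi.single k 1))
  have hchar (n : Fin r → ℤ) : t.char n = χ' (Multiplicative.ofAdd n) := by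
    conv_rhs => rw [← Finset.univ_sum_single n]
    rw [ofAdd_sum, map_prod]
    refine Finset.prod_congr rfl fun k _ => ?_
    rw [← map_zpow, ← ofAdd_zsmul, ← Pi.single_smul, smul_eq_mul, mul_one]
  have hone {n : Fin r → ℤ} (hn : n ∈ M) : χ' (Multiplicative.ofAdd n) = 1 := by
    refine Units.ext ?_
    change e (χ (Multiplicative.ofAdd n)) = 1
    have : χ (Multiplicative.ofAdd n) = 1 := by
      change AddMonoidAlgebra.of κ Q (Multiplicative.ofAdd (QuotientAddGroup.mk' M n)) = 1
      rw [show QuotientAddGroup.mk' M n = 0 from (QuotientAddGroup.eq_zero_iff n).mpr hn]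
      exact map_one _
    rw [this, map_one]
  have hact : (torsorAction deg g f hg hf).act t (h ≫ z) = h ≫ z := by
    refine pointHom_ext (fun x => Frame.pointHom_torsorAction_C hg hf _ _ x) fun i => ?_
    rw [Frame.pointHom_torsorAction_X, hchar, pointHom_comp]
    by_cases hi : pointHom z (MvPolynomial.X i) = 0
    · rw [hi, map_zero, mul_zero]
    · rw [hone (AddSubgroup.subset_closure ⟨i, hi, rfl⟩), Units.val_one, one_mul]
  have ht : t = 1 := (htors.existsUnique_act_eq (h ≫ z) (h ≫ z) rfl).unique hact
    ((torsorAction deg g f hg hf).one_act _)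
  have h1 : e (χ (Multiplicative.ofAdd (Pi.single j 1))) = e 1 := by
    rw [map_one]
    exact congrArg Units.val (congrFun ht j)
  have h2 := e.injective h1
  change AddMonoidAlgebra.of κ Q (Multiplicative.ofAdd (QuotientAddGroup.mk' M (Pi.single j 1))) = 1
    at h2
  rw [← map_one (AddMonoidAlgebra.of κ Q)] at h2
  have h3 := AddMonoidAlgebra.of_injective h2
  exact (QuotientAddGroup.eq_zero_iff _).mp (Multiplicative.ofAdd.injective h3)

/-- An element of the subgroup generated by the degrees in a finite set. -/
theorem exists_sum_smul_of_mem_closure {ι M : Type*} [AddCommGroup M] [Fintype ι]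
    (d : ι → M) (S : Set ι) {x : M} (hx : x ∈ AddSubgroup.closure (d '' S)) :
    ∃ n : ι → ℤ, (∀ i, i ∉ S → n i = 0) ∧ ∑ i, n i • d i = x := by
  classical
  induction hx using AddSubgroup.closure_induction with
  | mem x hx =>
    obtain ⟨i, hi, rfl⟩ := hx
    refine ⟨Pi.single i 1, fun k hk => Pi.single_eq_of_ne (fun h : k = i => hk (h.symm ▸ hi)) 1, ?_⟩
    rw [Finset.sum_eq_single i (fun k _ hk => by rw [Pi.single_eq_of_ne hk, zero_smul])
      (fun h => absurd (Finset.mem_univ i) h), Pi.single_eq_same, one_smul]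
  | zero => exact ⟨0, fun _ _ => rfl, by simp⟩
  | add x y _ _ hx hy =>
    obtain ⟨n, hn, rfl⟩ := hx
    obtain ⟨n', hn', rfl⟩ := hy
    exact ⟨n + n', fun i hi => by rw [Pi.add_apply, hn i hi, hn' i hi, add_zero],
      by simp [add_smul, Finset.sum_add_distrib]⟩
  | neg x _ hx =>
    obtain ⟨n, hn, rfl⟩ := hx
    exact ⟨-n, fun i hi => by rw [Pi.neg_apply, hn i hi, neg_zero], by simp⟩

theorem zpow_sum_eq_prod {ι G : Type*} [CommGroup G] (x : G) (n : ι → ℤ) (S : Finset ι) :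
    x ^ ∑ i ∈ S, n i = ∏ i ∈ S, x ^ n i :=
  map_prod (zpowersHom G x) (fun i => Multiplicative.ofAdd (n i)) S

theorem isUnit_of_forall_mem_basicOpen {T : Scheme.{u}} {b : Γ(T, ⊤)} (h : ∀ t, t ∈ T.basicOpen b) :
    IsUnit b :=
  T.toRingedSpace.isUnit_of_isUnit_germ ⊤ b fun t _ => (Scheme.mem_basicOpen_top T b t).mp (h t)

/-- `ρ ∈ 𝔾_m^r(T)` consists of the Laurent monomials with exponents `n` in the coordinates, supposed
to be invertible, with indices in `S` of the point `w`. -/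
def IsMonomial (S : Set (Fin N)) (n : Fin r → Fin N → ℤ) {T : Scheme.{u}}
    (w : T ⟶ torsorSpace g f) (ρ : Torus r T) : Prop :=
  ∃ v : Fin N → Γ(T, ⊤)ˣ, (∀ i ∈ S, (v i : Γ(T, ⊤)) = pointHom w (MvPolynomial.X i)) ∧
    ∀ j, ρ j = ∏ i, v i ^ n j i

section IsMonomial

variable {S : Set (Fin N)} {n : Fin r → Fin N → ℤ} {T : Scheme.{u}}
  {w : T ⟶ torsorSpace g f} {ρ ρ' : Torus r T}

/-- The units `v i` with `i ∉ S` are arbitrary, but their exponents are zero. -/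
theorem IsMonomial.unique (hn : ∀ j i, i ∉ S → n j i = 0) (h : IsMonomial S n w ρ)
    (h' : IsMonomial S n w ρ') : ρ = ρ' := by
  obtain ⟨v, hv, hρ⟩ := h
  obtain ⟨v', hv', hρ'⟩ := h'
  funext j
  rw [hρ, hρ']
  refine Finset.prod_congr rfl fun i _ => ?_
  by_cases hi : i ∈ S
  · rw [show v i = v' i from Units.ext ((hv i hi).trans (hv' i hi).symm)]
  · rw [hn j i hi, zpow_zero, zpow_zero]

theorem IsMonomial.comp (h : IsMonomial S n w ρ) {T' : Scheme.{u}} (k : T' ⟶ T) :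
    IsMonomial S n (k ≫ w) (Torus.res k ρ) := by
  obtain ⟨v, hv, hρ⟩ := h
  let κ : Γ(T, ⊤)ˣ →* Γ(T', ⊤)ˣ := Units.map (k.appTop.hom : Γ(T, ⊤) →* Γ(T', ⊤))
  refine ⟨fun i => κ (v i), fun i hi => ?_, fun j => ?_⟩
  · rw [pointHom_comp, ← hv i hi]
    rfl
  · change κ (ρ j) = _
    rw [hρ, map_prod]
    exact Finset.prod_congr rfl fun i _ => map_zpow _ _ _

/-- The `j`-th Laurent monomial has degree the `j`-th basis vector, hence is multiplied by `t_j`: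
the monomials form an equivariant map to the torus. -/
theorem IsMonomial.act (hn : ∀ j, ∑ i, n j i • deg i = Pi.single j 1) (h : IsMonomial S n w ρ)
    (t : Torus r T) : IsMonomial S n ((torsorAction deg g f hg hf).act t w) (t * ρ) := by
  obtain ⟨v, hv, hρ⟩ := h
  refine ⟨fun i => t.char (deg i) * v i, fun i hi => ?_, fun j => ?_⟩
  · rw [Frame.pointHom_torsorAction_X, ← hv i hi, Units.val_mul]
  · simp only [mul_zpow, Finset.prod_mul_distrib, Pi.mul_apply, hρ]
    congr 1
    simp only [Torus.char, ← Finset.prod_zpow]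
    rw [Finset.prod_comm]
    simp only [← zpow_mul]
    have : ∀ k, ∏ i, t k ^ (deg i k * n j i) = t k ^ (Pi.single j 1 : Fin r → ℤ) k := fun k => by
      rw [← hn j, Finset.sum_apply, zpow_sum_eq_prod]
      exact Finset.prod_congr rfl fun i _ => by rw [Pi.smul_apply, smul_eq_mul, mul_comm]
    simp only [this]
    rw [Finset.prod_eq_single j (fun k _ hk => by rw [Pi.single_eq_of_ne hk, zpow_zero])
      (fun h => absurd (Finset.mem_univ j) h), Pi.single_eq_same, zpow_one]

end IsMonomial

/-- A torsor has sections Zariski-locally. -/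
theorem IsTorsor.exists_local_section (htors : IsTorsor (torsorAction deg g f hg hf) π) (x : X) :
    ∃ (U : X.Opens) (σ : U.toScheme ⟶ torsorSpace g f), x ∈ U ∧ σ ≫ π = U.ι := by
  classical
  have hflat := htors.flat
  have hlfp := htors.locallyOfFinitePresentation
  obtain ⟨y, rfl⟩ := htors.surjective.surj x
  let κ : Type u := (torsorSpace g f).residueField y
  let z : Spec (CommRingCat.of κ) ⟶ torsorSpace g f := (torsorSpace g f).fromSpecResidueField y
  -- The coordinates that are nonzero at `y`. Their degrees generate `ℤ^r`, so there are Laurent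
  -- monomials in them, with exponents `n j`, of degree each basis vector.
  let S := {i | pointHom z (MvPolynomial.X i) ≠ 0}
  choose n hnS hn using fun j => exists_sum_smul_of_mem_closure deg _
    (single_mem_closure_deg htors z j)
  let b : Γ(torsorSpace g f, ⊤) := ∏ i with i ∈ S, pointHom (𝟙 _) (MvPolynomial.X i)
  let W : (torsorSpace g f).Opens := (torsorSpace g f).basicOpen b
  have hyW : y ∈ W := by
    have hb : IsUnit (z.appTop.hom b) := by
      rw [map_prod, IsUnit.prod_iff]
      intro i hi
      rw [← pointHom_comp, Category.comp_id]
      let e := (Scheme.ΓSpecIso (CommRingCat.of κ)).commRingCatIsoToRingEquiv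
      refine (isUnit_map_iff e _).mp (IsUnit.mk0 _ ?_)
      exact (map_ne_zero_iff e e.injective).mpr (Finset.mem_filter.mp hi).2
    have hq : z (IsLocalRing.closedPoint κ) ∈ W := by
      change IsLocalRing.closedPoint κ ∈ z ⁻¹ᵁ (torsorSpace g f).basicOpen b
      rw [Scheme.preimage_basicOpen_top, Scheme.basicOpen_of_isUnit _ hb]
      trivial
    rwa [show z (IsLocalRing.closedPoint κ) = y from Scheme.fromSpecResidueField_apply _ _] at hq
  have hW : IsUnit (W.ι.appTop.hom b) := isUnit_of_forall_mem_basicOpen fun w => by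
    have h := Scheme.preimage_basicOpen_top W.ι b
    have hw : w ∈ W.ι ⁻¹ᵁ (torsorSpace g f).basicOpen b := w.2
    rw [h] at hw
    exact hw
  have hWi (i) (hi : i ∈ S) : IsUnit (pointHom W.ι (MvPolynomial.X i)) := by
    rw [map_prod] at hW
    have := isUnit_of_dvd_unit (Finset.dvd_prod_of_mem _ (Finset.mem_filter.mpr
      ⟨Finset.mem_univ i, hi⟩)) hW
    rwa [← pointHom_comp, Category.comp_id] at this
  obtain ⟨ρ, hρ⟩ : ∃ ρ, IsMonomial S n W.ι ρ :=
    ⟨fun j => ∏ i, (if h : i ∈ S then (hWi i h).unit else 1) ^ n j i,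
      fun i => if h : i ∈ S then (hWi i h).unit else 1, fun i hi => by simp [hi], fun j => rfl⟩
  -- Dividing by the equivariant map `ρ` makes `τ` constant on the fibres of `π`: passing from a
  -- point to its translate by `t` also multiplies `ρ` by `t`.
  let τ : W.toScheme ⟶ torsorSpace g f := (torsorAction deg g f hg hf).act ρ⁻¹ W.ι
  have hτ {T : Scheme.{u}} (k₁ k₂ : T ⟶ W.toScheme) (hk : k₁ ≫ W.ι ≫ π = k₂ ≫ W.ι ≫ π) :
      k₁ ≫ τ = k₂ ≫ τ := by
    obtain ⟨t, ht, -⟩ := htors.existsUnique_act_eq (k₁ ≫ W.ι) (k₂ ≫ W.ι)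
      (by simpa only [Category.assoc] using hk)
    have ht' : (torsorAction deg g f hg hf).act t (k₁ ≫ W.ι) = k₂ ≫ W.ι := ht
    have h1 := (hρ.comp k₁).act (hg := hg) (hf := hf) hn t
    rw [ht'] at h1
    have h2 := h1.unique hnS (hρ.comp k₂)
    rw [(torsorAction deg g f hg hf).comp_act, (torsorAction deg g f hg hf).comp_act, map_inv,
      map_inv, ← h2, ← ht', ← (torsorAction deg g f hg hf).mul_act, mul_inv_rev,
      inv_mul_cancel_right]
  let U : X.Opens := ⟨Set.range (W.ι ≫ π), (W.ι ≫ π).isOpenMap.isOpen_range⟩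
  let p : W.toScheme ⟶ U.toScheme := IsOpenImmersion.lift U.ι (W.ι ≫ π) (by
    rw [Scheme.Opens.range_ι]; exact subset_rfl)
  have hp : p ≫ U.ι = W.ι ≫ π := IsOpenImmersion.lift_fac _ _ _
  -- The map `p` is the base change of `W.ι ≫ π` along `U.ι`, up to the isomorphism `e`, and so
  -- inherits flatness and finite presentation.
  let e : W.toScheme ⟶ pullback (W.ι ≫ π) U.ι := pullback.lift (𝟙 _) p (by rw [hp, Category.id_comp])
  have he : e ≫ pullback.fst _ _ = 𝟙 _ := pullback.lift_fst _ _ _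
  have he' : e ≫ pullback.snd _ _ = p := pullback.lift_snd _ _ _
  have : IsSplitEpi (pullback.fst (W.ι ≫ π) U.ι) := ⟨⟨e, he⟩⟩
  have : IsIso (pullback.fst (W.ι ≫ π) U.ι) := isIso_of_mono_of_isSplitEpi _
  have : IsIso e := IsIso.of_isIso_fac_right he
  have hp1 : Flat p := he' ▸ inferInstance
  have hp2 : LocallyOfFinitePresentation p := he' ▸ inferInstance
  have hp3 : Surjective p := ⟨fun x => by
    obtain ⟨w, hw⟩ := x.2
    refine ⟨w, U.ι.isOpenEmbedding.injective ?_⟩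
    rw [← Scheme.Hom.comp_apply, hp, hw]
    rfl⟩
  -- As `p` is flat, surjective and locally of finite presentation, `τ` descends along it.
  let σ : U.toScheme ⟶ torsorSpace g f := EffectiveEpi.desc p τ fun k₁ k₂ hk => hτ k₁ k₂ (by
    rw [← hp, ← Category.assoc, hk, Category.assoc])
  have hσ : p ≫ σ = τ := EffectiveEpi.fac p τ _
  refine ⟨U, σ, ⟨⟨y, hyW⟩, rfl⟩, ?_⟩
  rw [← cancel_epi p, ← Category.assoc, hσ, hp]
  exact htors.act_comp _ _

/-- Points of the base of a torsor with values in a local ring lift to the torsor. -/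
theorem IsTorsor.exists_lift (htors : IsTorsor (torsorAction deg g f hg hf) π) {R : Type u}
    [CommRing R] [IsLocalRing R] (x : Spec (CommRingCat.of R) ⟶ X) :
    ∃ y : Spec (CommRingCat.of R) ⟶ torsorSpace g f, y ≫ π = x := by
  obtain ⟨U, σ, hU, hσ⟩ := htors.exists_local_section (x (IsLocalRing.closedPoint R))
  -- An open set containing the image of the closed point contains the image of the whole local
  -- scheme, so the section over `U` can be used.
  have h := Scheme.preimage_eq_top_of_closedPoint_mem x hU
  refine ⟨IsOpenImmersion.lift U.ι x ?_ ≫ σ, ?_⟩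
  · rw [Scheme.Opens.range_ι]
    rintro _ ⟨q, rfl⟩
    exact (SetLike.ext_iff.mp h q).mpr trivial
  · rw [Category.assoc, hσ, IsOpenImmersion.lift_fac]

end LocalSection

/-! ### Classes of cocycles -/

section Classes

variable {r : ℕ} {X : Scheme.{u}}

theorem EtaleH1.mk_mul (𝒰 : EtaleCover X) (g h : cocycles r 𝒰) :
    EtaleH1.mk 𝒰 (g * h) = EtaleH1.mk 𝒰 g + EtaleH1.mk 𝒰 h := by
  classical exact map_add (AddCommGroup.DirectLimit.of
    (fun 𝒰 : EtaleCover X => Additive (CechH1 r 𝒰)) (transition r X) 𝒰) (Additive.ofMul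
    (QuotientGroup.mk g : cocycles r 𝒰 ⧸ coboundaries r 𝒰)) (Additive.ofMul
    (QuotientGroup.mk h : cocycles r 𝒰 ⧸ coboundaries r 𝒰))

theorem EtaleH1.mk_inv (𝒰 : EtaleCover X) (g : cocycles r 𝒰) :
    EtaleH1.mk 𝒰 g⁻¹ = -EtaleH1.mk 𝒰 g := by
  classical exact map_neg (AddCommGroup.DirectLimit.of
    (fun 𝒰 : EtaleCover X => Additive (CechH1 r 𝒰)) (transition r X) 𝒰) (Additive.ofMul
    (QuotientGroup.mk g : cocycles r 𝒰 ⧸ coboundaries r 𝒰))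

theorem EtaleH1.mk_eq_of_cohomologous {𝒰 : EtaleCover X} {g g' : cocycles r 𝒰}
    (w : ∀ i, Torus r (𝒰.X i))
    (h : ∀ i j, g.1 i j * Torus.res (pullback.snd (𝒰.f i) (𝒰.f j)) (w j)
      = Torus.res (pullback.fst (𝒰.f i) (𝒰.f j)) (w i) * g'.1 i j) :
    EtaleH1.mk 𝒰 g = EtaleH1.mk 𝒰 g' := by
  unfold EtaleH1.mk
  congr 2
  refine (QuotientGroup.eq (s := coboundaries r 𝒰)).mpr ⟨fun i => (w i)⁻¹, fun i j => ?_⟩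
  change (g.1 i j)⁻¹ * g'.1 i j = _
  rw [map_inv, map_inv, inv_inv, inv_mul_eq_iff_eq_mul, mul_left_comm, h, inv_mul_cancel_left]

theorem cocycle_mul {𝒰 : EtaleCover X} (g : cocycles r 𝒰) {i j k : 𝒰.I₀} {T : Scheme.{u}}
    {x : T ⟶ 𝒰.X i} {y : T ⟶ 𝒰.X j} {z : T ⟶ 𝒰.X k} (hxy : x ≫ 𝒰.f i = y ≫ 𝒰.f j)
    (hyz : y ≫ 𝒰.f j = z ≫ 𝒰.f k) :
    Torus.res (pullback.lift x y hxy) (g.1 i j) * Torus.res (pullback.lift y z hyz) (g.1 j k)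
      = Torus.res (pullback.lift x z (hxy.trans hyz)) (g.1 i k) :=
  g.2 i j k T x y z hxy hyz

theorem comp_pullback_lift {T T' X' Y' S : Scheme.{u}} {p : X' ⟶ S} {q : Y' ⟶ S} (k : T' ⟶ T)
    (x : T ⟶ X') (y : T ⟶ Y') (h : x ≫ p = y ≫ q) (h' : (k ≫ x) ≫ p = (k ≫ y) ≫ q) :
    pullback.lift (k ≫ x) (k ≫ y) h' = k ≫ pullback.lift x y h := by
  refine pullback.hom_ext ?_ ?_
  · rw [pullback.lift_fst, Category.assoc, pullback.lift_fst]
  · rw [pullback.lift_snd, Category.assoc, pullback.lift_snd]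

/-- Restriction of cohomology classes does not depend on the refinement. -/
theorem refineH1_eq {𝒰 𝒱 : EtaleCover X} (h h' : Refinement 𝒰 𝒱) :
    refineH1 r h = refineH1 r h' := by
  refine QuotientGroup.monoidHom_ext _ (MonoidHom.ext fun g => ?_)
  -- The coboundary comes from the entries of `g` at the pairs `(h i, h' i)`: on overlaps both
  -- `g_{hi,h'i} g_{h'i,h'j}` and `g_{hi,hj} g_{hj,h'j}` equal `g_{hi,h'j}`.
  refine (QuotientGroup.eq (s := coboundaries r 𝒱)).mpr ⟨fun i => (Torus.res (pullback.lift
    (h.h₀ i) (h'.h₀ i) ((h.w₀ i).trans (h'.w₀ i).symm)) (g.1 (h.s₀ i) (h'.s₀ i)))⁻¹,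
    fun i j => ?_⟩
  change (Torus.res (h.overlap i j) (g.1 (h.s₀ i) (h.s₀ j)))⁻¹
    * Torus.res (h'.overlap i j) (g.1 (h'.s₀ i) (h'.s₀ j)) = _
  have h1 : (pullback.fst (𝒱.f i) (𝒱.f j) ≫ h.h₀ i) ≫ 𝒰.f (h.s₀ i)
      = (pullback.fst (𝒱.f i) (𝒱.f j) ≫ h'.h₀ i) ≫ 𝒰.f (h'.s₀ i) := by simp
  have h2 : (pullback.fst (𝒱.f i) (𝒱.f j) ≫ h'.h₀ i) ≫ 𝒰.f (h'.s₀ i)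
      = (pullback.snd (𝒱.f i) (𝒱.f j) ≫ h'.h₀ j) ≫ 𝒰.f (h'.s₀ j) := by
    simp [pullback.condition]
  have h3 : (pullback.fst (𝒱.f i) (𝒱.f j) ≫ h.h₀ i) ≫ 𝒰.f (h.s₀ i)
      = (pullback.snd (𝒱.f i) (𝒱.f j) ≫ h.h₀ j) ≫ 𝒰.f (h.s₀ j) := by simp [pullback.condition]
  have h4 : (pullback.snd (𝒱.f i) (𝒱.f j) ≫ h.h₀ j) ≫ 𝒰.f (h.s₀ j)
      = (pullback.snd (𝒱.f i) (𝒱.f j) ≫ h'.h₀ j) ≫ 𝒰.f (h'.s₀ j) := by simp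
  have e1 := (cocycle_mul g h1 h2).trans (cocycle_mul g h3 h4).symm
  have l1 : pullback.lift _ _ h1 = pullback.fst (𝒱.f i) (𝒱.f j) ≫ pullback.lift
      (h.h₀ i) (h'.h₀ i) ((h.w₀ i).trans (h'.w₀ i).symm) :=
    comp_pullback_lift _ _ _ _ _
  have l4 : pullback.lift _ _ h4 = pullback.snd (𝒱.f i) (𝒱.f j) ≫ pullback.lift
      (h.h₀ j) (h'.h₀ j) ((h.w₀ j).trans (h'.w₀ j).symm) :=
    comp_pullback_lift _ _ _ _ _
  rw [l1, l4, ← Torus.res_res, ← Torus.res_res] at e1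
  change _ * Torus.res (h'.overlap i j) _ = Torus.res (h.overlap i j) _ * _ at e1
  simp only [map_inv, inv_inv]
  rw [inv_mul_eq_iff_eq_mul, mul_left_comm, eq_inv_mul_iff_mul_eq]
  exact e1

/-- The transition maps of the direct limit use a refinement picked by `Classical.choice`;
`refineH1_eq` replaces it by `h`. -/
theorem EtaleH1.mk_refine {𝒰 𝒱 : EtaleCover X} (h : Refinement 𝒰 𝒱) (g : cocycles r 𝒰) :
    EtaleH1.mk 𝒱 (refineCocycles r h g) = EtaleH1.mk 𝒰 g := by
  classical
  have hle : 𝒰 ≤ 𝒱 := ⟨h⟩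
  refine Eq.trans ?_ (AddCommGroup.DirectLimit.of_f
    (G := fun 𝒰 : EtaleCover X => Additive (CechH1 r 𝒰)) (f := transition r X) hle
    (Additive.ofMul (QuotientGroup.mk g : cocycles r 𝒰 ⧸ coboundaries r 𝒰)))
  unfold EtaleH1.mk
  congr 1
  change Additive.ofMul (refineH1 r h (QuotientGroup.mk g : cocycles r 𝒰 ⧸ coboundaries r 𝒰))
    = Additive.ofMul (refineH1 r (Classical.choice hle) _)
  rw [refineH1_eq h (Classical.choice hle)]
  rfl

/-- An étale covering from a jointly surjective family of étale morphisms. -/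
def EtaleCover.mk {I : Type u} (Z : I → Scheme.{u}) (p : ∀ i, Z i ⟶ X) (h : ∀ x : X, ∃ i y, p i y = x)
    (hp : ∀ i, Etale (p i)) : EtaleCover X :=
  Scheme.Cover.mkOfCovers (P := @Etale) I Z p h hp

theorem EtaleCover.exists_eq (𝒰 : EtaleCover X) (x : X) : ∃ i y, 𝒰.f i y = x :=
  ((Scheme.ofArrows_mem_precoverage_iff @Etale).mp 𝒰.mem₀).1 x

theorem EtaleCover.etale (𝒰 : EtaleCover X) (i : 𝒰.I₀) : Etale (𝒰.f i) :=
  ((Scheme.ofArrows_mem_precoverage_iff @Etale).mp 𝒰.mem₀).2 i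

theorem exists_common_refinement (𝒰 𝒱 : EtaleCover X) :
    ∃ 𝒲 : EtaleCover X, Nonempty (Refinement 𝒰 𝒲) ∧ Nonempty (Refinement 𝒱 𝒲) := by
  refine ⟨EtaleCover.mk (I := 𝒰.I₀ × 𝒱.I₀) (fun k => pullback (𝒰.f k.1) (𝒱.f k.2))
    (fun k => pullback.fst _ _ ≫ 𝒰.f k.1) (fun x => ?_) (fun k => ?_),
    ⟨⟨Prod.fst, fun k => pullback.fst _ _, fun k => rfl⟩⟩,
    ⟨⟨Prod.snd, fun k => pullback.snd _ _, fun k => pullback.condition.symm⟩⟩⟩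
  · obtain ⟨i, y, rfl⟩ := 𝒰.exists_eq x
    obtain ⟨j, z, hz⟩ := 𝒱.exists_eq (𝒰.f i y)
    obtain ⟨w, rfl, -⟩ := Scheme.Pullback.exists_preimage_pullback (f := 𝒰.f i) (g := 𝒱.f j) y z
      hz.symm
    exact ⟨(i, j), w, rfl⟩
  · have := 𝒰.etale k.1
    have := 𝒱.etale k.2
    infer_instance

/-- The sections over `X`-schemes of a torsor under `𝔾_m^r`. -/
structure TorsorSections (r : ℕ) (X : Scheme.{u}) where
  Sec : Scheme.{u} → Type u
  IsOver : ∀ {T : Scheme.{u}}, (T ⟶ X) → Sec T → Prop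
  res : ∀ {T T' : Scheme.{u}}, (T' ⟶ T) → Sec T → Sec T'
  act : ∀ {T : Scheme.{u}}, Torus r T → Sec T → Sec T
  res_res : ∀ {T T' T'' : Scheme.{u}} (k' : T'' ⟶ T') (k : T' ⟶ T) (σ : Sec T),
    res k' (res k σ) = res (k' ≫ k) σ
  isOver_res : ∀ {T T' : Scheme.{u}} (k : T' ⟶ T) {t : T ⟶ X} {σ : Sec T}, IsOver t σ →
    IsOver (k ≫ t) (res k σ)
  mul_act : ∀ {T : Scheme.{u}} (w w' : Torus r T) (σ : Sec T), act (w * w') σ = act w (act w' σ)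
  res_act : ∀ {T T' : Scheme.{u}} (k : T' ⟶ T) (w : Torus r T) (σ : Sec T),
    res k (act w σ) = act (Torus.res k w) (res k σ)
  existsUnique_eq_act : ∀ {T : Scheme.{u}} {t : T ⟶ X} {σ σ' : Sec T}, IsOver t σ → IsOver t σ' →
    ∃! w : Torus r T, σ = act w σ'

/-! ### Cocycles of local sections and the invariance of their class -/

namespace TorsorSections

variable (F : TorsorSections r X)

theorem act_injective {F : TorsorSections r X} {T : Scheme.{u}} {t : T ⟶ X} {σ τ : F.Sec T}
    (hσ : F.IsOver t σ) (hτ : F.IsOver t τ) {w w' : Torus r T} (hw : σ = F.act w τ)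
    (hw' : σ = F.act w' τ) : w = w' :=
  (F.existsUnique_eq_act hσ hτ).unique hw hw'

/-- `g` is the cocycle defined by the local sections `σ`. -/
def IsCocycle (𝒰 : EtaleCover X) (σ : ∀ i, F.Sec (𝒰.X i)) (g : cocycles r 𝒰) : Prop :=
  (∀ i, F.IsOver (𝒰.f i) (σ i)) ∧ ∀ i j, F.res (pullback.fst (𝒰.f i) (𝒰.f j)) (σ i)
    = F.act (g.1 i j) (F.res (pullback.snd (𝒰.f i) (𝒰.f j)) (σ j))

variable {F} {𝒰 𝒱 : EtaleCover X} {σ : ∀ i, F.Sec (𝒰.X i)} {τ : ∀ i, F.Sec (𝒱.X i)}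
  {g : cocycles r 𝒰} {g' : cocycles r 𝒱}

theorem IsCocycle.refine (h : F.IsCocycle 𝒰 σ g) (ρ : Refinement 𝒰 𝒱) :
    F.IsCocycle 𝒱 (fun i => F.res (ρ.h₀ i) (σ (ρ.s₀ i))) (refineCocycles r ρ g) := by
  refine ⟨fun i => ?_, fun i j => ?_⟩
  · rw [← ρ.w₀ i]
    exact F.isOver_res _ (h.1 _)
  · have := congrArg (F.res (ρ.overlap i j)) (h.2 (ρ.s₀ i) (ρ.s₀ j))
    rw [F.res_act, F.res_res, F.res_res, ρ.overlap_fst, ρ.overlap_snd] at this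
    rw [F.res_res, F.res_res, this]
    rfl

/-- Writing `σ_i = w_i τ_i`, the cocycles differ by the coboundary of `w`, because the torus element
relating the restrictions of `σ_i` and `τ_j` is unique. -/
theorem IsCocycle.mk_eq_mk_same {τ : ∀ i, F.Sec (𝒰.X i)} {g' : cocycles r 𝒰}
    (h : F.IsCocycle 𝒰 σ g) (h' : F.IsCocycle 𝒰 τ g') : EtaleH1.mk 𝒰 g = EtaleH1.mk 𝒰 g' := by
  choose w hw _ using fun i => F.existsUnique_eq_act (h.1 i) (h'.1 i)
  refine EtaleH1.mk_eq_of_cohomologous w fun i j => ?_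
  have hf := F.isOver_res (pullback.fst (𝒰.f i) (𝒰.f j)) (h.1 i)
  have hs := F.isOver_res (pullback.snd (𝒰.f i) (𝒰.f j)) (h'.1 j)
  rw [← pullback.condition] at hs
  refine act_injective hf hs ?_ ?_
  · rw [F.mul_act, h.2, hw j, F.res_act]
  · rw [F.mul_act, ← h'.2, ← F.res_act]
    exact congrArg _ (hw i)

/-- Both cocycles can be compared on a common refinement, so the class is an invariant of the torsor
alone. -/
theorem IsCocycle.mk_eq_mk (h : F.IsCocycle 𝒰 σ g) (h' : F.IsCocycle 𝒱 τ g') :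
    EtaleH1.mk 𝒰 g = EtaleH1.mk 𝒱 g' := by
  obtain ⟨𝒲, ⟨ρ⟩, ⟨ρ'⟩⟩ := exists_common_refinement 𝒰 𝒱
  rw [← EtaleH1.mk_refine ρ, ← EtaleH1.mk_refine ρ']
  exact (h.refine ρ).mk_eq_mk_same (h'.refine ρ')

/-- The cocycle identity follows from the uniqueness of the torus element relating two sections. -/
theorem exists_isCocycle (hσ : ∀ i, F.IsOver (𝒰.f i) (σ i)) : ∃ g, F.IsCocycle 𝒰 σ g := by
  have hs (i j) : F.IsOver (pullback.fst (𝒰.f i) (𝒰.f j) ≫ 𝒰.f i)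
      (F.res (pullback.snd (𝒰.f i) (𝒰.f j)) (σ j)) := by
    rw [pullback.condition]
    exact F.isOver_res _ (hσ j)
  choose g hg _ using fun i j => F.existsUnique_eq_act
    (F.isOver_res (pullback.fst (𝒰.f i) (𝒰.f j)) (hσ i)) (hs i j)
  refine ⟨⟨g, fun i j k T x y z hxy hyz => ?_⟩, hσ, hg⟩
  have hlift {i j} {x : T ⟶ 𝒰.X i} {y : T ⟶ 𝒰.X j} (h : x ≫ 𝒰.f i = y ≫ 𝒰.f j) :
      F.res x (σ i) = F.act (Torus.res (pullback.lift x y h) (g i j)) (F.res y (σ j)) := by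
    have := congrArg (F.res (pullback.lift x y h)) (hg i j)
    rwa [F.res_act, F.res_res, F.res_res, pullback.lift_fst, pullback.lift_snd] at this
  refine act_injective (F.isOver_res x (hσ i))
    ((hxy.trans hyz) ▸ F.isOver_res z (hσ k)) ?_ (hlift (hxy.trans hyz))
  rw [F.mul_act, ← hlift, ← hlift]

end TorsorSections

end Classes

/-! ### Classes of torsors and of fractional ideals -/

section GlueTorus

/-- Unique existence of an element of the torus with a local property can be checked locally. -/
theorem Torus.existsUnique_of_cover {r : ℕ} {T : Scheme.{u}} (𝒱 : Scheme.OpenCover.{u} T)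
    (P : ∀ {T' : Scheme.{u}}, (T' ⟶ T) → Torus r T' → Prop)
    (hres : ∀ {T' T'' : Scheme.{u}} (l : T'' ⟶ T') (k : T' ⟶ T) (w : Torus r T'), P k w →
      P (l ≫ k) (Torus.res l w))
    (hloc : ∀ i {T' : Scheme.{u}} (k : T' ⟶ 𝒱.X i), ∃! w : Torus r T', P (k ≫ 𝒱.f i) w)
    (hglue : ∀ w : Torus r T, (∀ i, P (𝒱.f i) (Torus.res (𝒱.f i) w)) → P (𝟙 T) w) :
    ∃! w : Torus r T, P (𝟙 T) w := by
  choose t ht using fun i => (hloc i (𝟙 _)).exists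
  simp only [Category.id_comp] at ht
  obtain ⟨w, hw⟩ := Torus.exists_glue 𝒱 t fun i j => by
    refine (hloc i (pullback.fst (𝒱.f i) (𝒱.f j))).unique (hres _ _ _ (ht i)) ?_
    rw [pullback.condition]
    exact hres _ _ _ (ht j)
  refine ⟨w, hglue w fun i => by rw [hw]; exact ht i, fun w' hw' => ?_⟩
  refine Torus.ext_of_cover 𝒱 fun i => ?_
  have h1 := (hloc i (𝟙 _)).unique (y₁ := Torus.res (𝒱.f i) w') (y₂ := t i)
  rw [Category.id_comp] at h1
  rw [hw]
  have h2 := hres (𝒱.f i) _ _ hw'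
  rw [Category.comp_id] at h2
  exact h1 h2 (ht i)

end GlueTorus

section TorsorClass

variable {r : ℕ} {X Y : Scheme.{u}} {α : TorusAction r Y} {π : Y ⟶ X}

/-- The sections of a torsor. -/
def IsTorsor.sections (h : IsTorsor α π) : TorsorSections r X where
  Sec T := T ⟶ Y
  IsOver t σ := σ ≫ π = t
  res k σ := k ≫ σ
  act w σ := α.act w σ
  res_res k' k σ := (Category.assoc k' k σ).symm
  isOver_res k t σ hσ := by rw [Category.assoc, hσ]
  mul_act w w' σ := α.mul_act w w' σ
  res_act k w σ := α.comp_act k w σ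
  existsUnique_eq_act {T t σ σ'} hσ hσ' := by
    obtain ⟨w, hw, huniq⟩ := h.existsUnique_act_eq σ' σ (hσ'.trans hσ.symm)
    exact ⟨w, hw.symm, fun w' hw' => huniq w' hw'.symm⟩

theorem IsTorsor.isTorsorClass_iff (h : IsTorsor α π) (z : EtaleH1 r X) :
    IsTorsorClass α π z ↔ ∃ 𝒰 σ g, h.sections.IsCocycle 𝒰 σ g ∧ z = EtaleH1.mk 𝒰 g :=
  ⟨fun ⟨𝒰, σ, g, h₁, h₂, h₃⟩ => ⟨𝒰, σ, g, ⟨h₁, h₂⟩, h₃⟩,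
    fun ⟨𝒰, σ, g, ⟨h₁, h₂⟩, h₃⟩ => ⟨𝒰, σ, g, h₁, h₂, h₃⟩⟩

end TorsorClass

/-- A single cocycle pins down the class; this turns the existential predicates `IsTorsorClass` and
`IsIdealClass` into equations. -/
theorem TorsorSections.class_iff {r : ℕ} {X : Scheme.{u}} {F : TorsorSections r X}
    {𝒰 : EtaleCover X} {σ : ∀ i, F.Sec (𝒰.X i)} {g : cocycles r 𝒰} (h : F.IsCocycle 𝒰 σ g)
    (z : EtaleH1 r X) :
    (∃ 𝒰 σ g, F.IsCocycle 𝒰 σ g ∧ z = EtaleH1.mk 𝒰 g) ↔ z = EtaleH1.mk 𝒰 g := by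
  constructor
  · rintro ⟨𝒱, τ, g', h', rfl⟩
    exact h'.mk_eq_mk h
  · intro hz
    exact ⟨𝒰, σ, g, h, hz⟩

/-! ### Trivializations of fractional ideals as a torsor -/

section IdealClass

variable {A K : Type u} [CommRing A] [Field K] [Algebra A K] {r : ℕ}
  {a : Fin r → (FractionalIdeal A⁰ K)ˣ}

theorem idealPow_single (k : Fin r) :
    idealPow a (Pi.single k 1) = (a k : FractionalIdeal A⁰ K) := by
  unfold idealPow
  rw [Finset.prod_eq_single k (fun j _ hj => by rw [Pi.single_eq_of_ne hj, zpow_zero])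
    (fun h => absurd (Finset.mem_univ k) h), Pi.single_eq_same, zpow_one]

/-- The pullback of a trivialization. -/
def Trivialization.comp {I : FractionalIdeal A⁰ K} {T T' : Scheme.{u}}
    {t : T ⟶ Spec (CommRingCat.of A)} (θ : Trivialization I t) (k : T' ⟶ T) :
    Trivialization I (k ≫ t) where
  toLinearMap :=
    { toFun := fun c => k.appTop.hom (θ.toLinearMap c)
      map_add' := fun c d => by rw [map_add, map_add]
      map_smul' := fun x c => by
        rw [map_smulₛₗ, smul_eq_mul, map_mul, locus.eval_comp, smul_eq_mul] }
  generates x := by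
    obtain ⟨c, hc⟩ := θ.generates (k x)
    refine ⟨c, ?_⟩
    change x ∈ T'.basicOpen (k.appTop.hom (θ.toLinearMap c))
    have h := Scheme.preimage_basicOpen_top k (θ.toLinearMap c)
    have hx : x ∈ k ⁻¹ᵁ T.basicOpen (θ.toLinearMap c) := hc
    rwa [h] at hx

/-- The trivializations in a frame. -/
def Frame.trivialization {T : Scheme.{u}} {φ : A →+* Γ(T, ⊤)} (Θ : Frame a φ)
    {t : T ⟶ Spec (CommRingCat.of A)} (hφ : φ = locus.eval t) (k : Fin r) :
    Trivialization (a k : FractionalIdeal A⁰ K) t where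
  toLinearMap :=
    { toFun := fun c => Θ.toFun (Pi.single k 1) c
      map_add' := fun c d => Θ.map_add (by rw [idealPow_single]; exact c.2)
        (by rw [idealPow_single]; exact d.2)
      map_smul' := fun x c => by
        rw [← hφ, Submodule.coe_smul, Algebra.smul_def, Θ.map_smul x
          (by rw [idealPow_single]; exact c.2), smul_eq_mul] }
  generates x := by
    obtain ⟨c, hc, hx⟩ := Θ.exists_notMem (Pi.single k 1) (I := vanishingAt x)
      Ideal.IsPrime.ne_top'
    rw [idealPow_single] at hc
    exact ⟨⟨c, hc⟩, (notMem_vanishingAt _ _).mp hx⟩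

/-- `Frame.exists_factor` gives `θ = w Θ` on `𝔞_k`. Since the values of `θ` generate `𝒪_T`, the
factor `w` vanishes nowhere. -/
theorem Trivialization.existsUnique_eq_mul_frame {T : Scheme.{u}} {φ : A →+* Γ(T, ⊤)}
    (Θ : Frame a φ) {t : T ⟶ Spec (CommRingCat.of A)} (hφ : φ = locus.eval t) {k : Fin r}
    (θ : Trivialization (a k : FractionalIdeal A⁰ K) t) :
    ∃ w : Γ(T, ⊤)ˣ, ∀ c, θ.toLinearMap c = w * Θ.toFun (Pi.single k 1) c := by
  classical
  let l : K → Γ(T, ⊤) := fun c =>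
    if h : c ∈ (a k : FractionalIdeal A⁰ K) then θ.toLinearMap ⟨c, h⟩ else 0
  have hl (c : (a k : FractionalIdeal A⁰ K)) : l c = θ.toLinearMap c := dif_pos c.2
  obtain ⟨w, hw⟩ := Θ.exists_factor (Pi.single k 1) (l := l) (fun c hc d hd => by
    rw [idealPow_single] at hc hd
    have := θ.toLinearMap.map_add ⟨c, hc⟩ ⟨d, hd⟩
    rw [← hl, ← hl, ← hl] at this
    exact this) (fun x c hc => by
    rw [idealPow_single] at hc
    have := θ.toLinearMap.map_smulₛₗ x ⟨c, hc⟩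
    rw [← hl, ← hl, smul_eq_mul, ← hφ, Submodule.coe_smul, Algebra.smul_def] at this
    exact this)
  have hw' (c : (a k : FractionalIdeal A⁰ K)) :
      θ.toLinearMap c = w * Θ.toFun (Pi.single k 1) c := by
    rw [← hl, hw c (by rw [idealPow_single]; exact c.2), mul_comm]
  have hu : IsUnit w := isUnit_of_forall_mem_basicOpen fun x => by
    obtain ⟨c, hc⟩ := θ.generates x
    rw [← notMem_vanishingAt, hw'] at hc
    exact (notMem_vanishingAt _ _).mp fun h => hc (Ideal.mul_mem_right _ _ h)
  exact ⟨hu.unit, hw'⟩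

variable [IsDomain A] [IsFractionRing A K]

/-- Trivializations of the pullbacks of fractional ideals form a torsor. -/
def idealSections (a : Fin r → (FractionalIdeal A⁰ K)ˣ) {X : Scheme.{u}}
    (p : X ⟶ Spec (CommRingCat.of A)) : TorsorSections r X where
  -- Sections are bare functions and only `IsOver` asks that they come from trivializations, so
  -- their type does not depend on the morphism `T ⟶ X`.
  Sec T := ∀ k, ((a k : FractionalIdeal A⁰ K) : Submodule A K) → Γ(T, ⊤)
  IsOver {T} t σ := ∀ k, ∃ θ : Trivialization (a k : FractionalIdeal A⁰ K) (t ≫ p),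
    ∀ c, θ.toLinearMap c = σ k c
  res l σ := fun k c => l.appTop.hom (σ k c)
  act w σ := fun k c => w k * σ k c
  res_res {T T' T''} k' k σ := by
    funext j c
    rw [Scheme.Hom.comp_appTop]
    rfl
  isOver_res {T T'} k t σ hσ j := by
    obtain ⟨θ, hθ⟩ := hσ j
    rw [Category.assoc]
    exact ⟨θ.comp k, fun c => congrArg k.appTop.hom (hθ c)⟩
  mul_act w w' σ := by
    funext k c
    rw [Pi.mul_apply, Units.val_mul, mul_assoc]
  res_act k w σ := by
    funext j c
    rw [map_mul]
    rfl
  existsUnique_eq_act {T t σ σ'} hσ hσ' := by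
    choose θ hθ using hσ
    choose θ' hθ' using hσ'
    suffices h : ∃! w : Torus r T, ∀ k c, (𝟙 T : T ⟶ T).appTop.hom (σ k c)
        = (w k : Γ(T, ⊤)) * (𝟙 T : T ⟶ T).appTop.hom (σ' k c) by
      obtain ⟨w, hw, hw'⟩ := h
      refine ⟨w, funext fun k => funext fun c => ?_, fun v hv => hw' v fun k c => ?_⟩
      · simpa using hw k c
      · simpa using congrFun (congrFun hv k) c
    refine Torus.existsUnique_of_cover (chartPullback a (t ≫ p))
      (P := fun {T'} l w => ∀ k c, l.appTop.hom (σ k c)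
        = (w k : Γ(T', ⊤)) * l.appTop.hom (σ' k c)) ?_ ?_ ?_
    · intro T' T'' l k w h j c
      rw [Scheme.Hom.comp_appTop]
      change l.appTop.hom (k.appTop.hom _) = _ * l.appTop.hom (k.appTop.hom _)
      rw [h, map_mul]
      rfl
    · intro (p₀ : Spec (CommRingCat.of A)) T' l
      have hover : l ≫ chartPreimageι a (t ≫ p) p₀ ≫ t ≫ p
          = (l ≫ chartPreimageι a (t ≫ p) p₀) ≫ t ≫ p := (Category.assoc _ _ _).symm
      have hφ : l.appTop.hom.comp ((locus.eval (pullback.snd (t ≫ p) (chartMap a p₀))).comp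
          (algebraMap A (chartRing a p₀)))
          = locus.eval ((l ≫ chartPreimageι a (t ≫ p) p₀) ≫ t ≫ p) := by
        rw [eval_chartPreimageι, ← hover]
        exact RingHom.ext fun x => (locus.eval_comp _ _ _).symm
      -- Over a chart both families are unit multiples of the trivializations in one frame; the
      -- quotient of these units is the only solution.
      let Θ := (preimageFrame a (t ≫ p) p₀).map l.appTop.hom
      let q : T' ⟶ T := l ≫ chartPreimageι a (t ≫ p) p₀
      choose w hw using fun k => ((θ k).comp q).existsUnique_eq_mul_frame Θ hφ
      choose w' hw' using fun k => ((θ' k).comp q).existsUnique_eq_mul_frame Θ hφ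
      have h1 (k c) : q.appTop.hom (σ k c) = w k * Θ.toFun (Pi.single k 1) c := by
        rw [← hθ]
        exact hw k c
      have h2 (k c) : q.appTop.hom (σ' k c) = w' k * Θ.toFun (Pi.single k 1) c := by
        rw [← hθ']
        exact hw' k c
      change ∃! v : Torus r T', ∀ k c, q.appTop.hom (σ k c) = v k * q.appTop.hom (σ' k c)
      refine ⟨fun k => w k * (w' k)⁻¹, fun k c => ?_, fun v hv => funext fun k => ?_⟩
      · rw [h1, h2, ← mul_assoc, Units.val_mul, Units.inv_mul_cancel_right]
      · rw [eq_mul_inv_iff_mul_eq]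
        refine Units.ext (Θ.eq_of_forall_mul_eq (Pi.single k 1) fun c hc => ?_)
        rw [idealPow_single] at hc
        have := hv k ⟨c, hc⟩
        rw [h1, h2] at this
        rw [Units.val_mul]
        linear_combination -this
    · intro w hw k c
      refine section_ext (chartPullback a (t ≫ p)) fun i => ?_
      have := hw i k c
      rw [Scheme.Hom.id_appTop]
      exact this.trans (map_mul _ _ _).symm

theorem isIdealClass_iff {X : Scheme.{u}} (p : X ⟶ Spec (CommRingCat.of A)) (z : EtaleH1 r X) :
    IsIdealClass a p z ↔ ∃ 𝒰 σ g, (idealSections a p).IsCocycle 𝒰 σ g ∧ z = EtaleH1.mk 𝒰 g := by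
  constructor
  · rintro ⟨𝒰, θ, g, h, hz⟩
    exact ⟨𝒰, fun i k c => (θ i k).toLinearMap c, g, ⟨fun i k => ⟨θ i k, fun c => rfl⟩,
      fun i j => funext fun k => funext fun c => h i j k c⟩, hz⟩
  · rintro ⟨𝒰, σ, g, ⟨h₁, h₂⟩, hz⟩
    choose θ hθ using h₁
    refine ⟨𝒰, θ, g, fun i j k c => ?_, hz⟩
    rw [hθ, hθ]
    exact congrFun (congrFun (h₂ i j) k) c

end IdealClass

/-! ### The class of a twist -/

section TwistClass

variable {A K : Type u} [CommRing A] [IsDomain A] [Field K] [Algebra A K] [IsFractionRing A K]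
  {r N : ℕ} {deg : Fin N → Fin r → ℤ} {a : Fin r → (FractionalIdeal A⁰ K)ˣ}
  {m s : ℕ} {g : Fin s → MvPolynomial (Fin N) A} {f : Fin m → MvPolynomial (Fin N) A}
  {dg : Fin s → Fin r → ℤ} {df : Fin m → Fin r → ℤ}
  {hg : ∀ i, IsWeightedHomogeneous deg (g i) (dg i)}
  {hf : ∀ i, IsWeightedHomogeneous deg (f i) (df i)}
  {X : Scheme.{u}} {π : torsorSpace g f ⟶ X} {ψ : twist deg a g f ⟶ X}

variable (a) in
/-- There is an étale (even Zariski) covering with local sections of the torsor and frames. -/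
theorem IsTorsor.exists_cover_section_frame (htors : IsTorsor (torsorAction deg g f hg hf) π)
    (pX : X ⟶ Spec (CommRingCat.of A)) :
    ∃ (𝒰 : EtaleCover X) (σ : ∀ i, 𝒰.X i ⟶ torsorSpace g f) (φ : ∀ i, A →+* Γ(𝒰.X i, ⊤))
      (_ : ∀ i, Frame a (φ i)), (∀ i, σ i ≫ π = 𝒰.f i) ∧ ∀ i, φ i = locus.eval (𝒰.f i ≫ pX) := by
  choose U σ hU hσ using htors.exists_local_section
  refine ⟨EtaleCover.mk (I := X × Spec (CommRingCat.of A))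
    (fun i => chartPreimage a ((U i.1).ι ≫ pX) i.2)
    (fun i => chartPreimageι a ((U i.1).ι ≫ pX) i.2 ≫ (U i.1).ι) (fun x => ?_)
    (fun i => inferInstance), fun i => chartPreimageι a ((U i.1).ι ≫ pX) i.2 ≫ σ i.1, fun i => _,
    fun i => preimageFrame a ((U i.1).ι ≫ pX) i.2, fun i => ?_, fun i => ?_⟩
  · obtain ⟨p, q, hq⟩ := exists_chartPreimageι_eq (a := a) ((U x).ι ≫ pX) ⟨x, hU x⟩
    exact ⟨(x, p), q, congrArg (U x).ι hq⟩
  · exact (Category.assoc _ _ _).trans (congrArg _ (hσ _))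
  · exact (eval_chartPreimageι a ((U i.1).ι ≫ pX) i.2).trans
      (congrArg locus.eval (Category.assoc _ _ _).symm)

omit [IsDomain A] [IsFractionRing A K] in
-- Under `Θ'`, the point `z` is matched with `t y` by the change of frame and with `w y'` by
-- equivariance, so `t y = w y'`. This produces the minus sign in the class of the twist.
theorem Frame.Matches.eq_act {T : Scheme.{u}} {φ φ' : A →+* Γ(T, ⊤)} {Θ : Frame a φ}
    {Θ' : Frame a φ'} {y y' : T ⟶ twist deg a g f} {z z' : T ⟶ torsorSpace g f}
    (h : Θ.Matches y z) (h' : Θ'.Matches y' z') (hφ : φ = φ') {w t : Torus r T}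
    (hz : z = (torsorAction deg g f hg hf).act w z')
    (ht : ∀ k, ∀ c ∈ (a k : FractionalIdeal A⁰ K),
      Θ.toFun (Pi.single k 1) c = t k * Θ'.toFun (Pi.single k 1) c) :
    y = (twistAction deg a g f).act (w * t⁻¹) y' := by
  subst hφ
  obtain ⟨t', ht'⟩ := Θ'.exists_ratio Θ
  obtain rfl : t = t' := funext fun k => Units.ext <|
    Θ'.eq_of_forall_mul_eq (Pi.single k 1) fun c hc => by
      have h1 := ht' _ c hc
      rw [idealPow_single] at hc
      rw [ht k c hc, Finset.prod_eq_single k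
        (fun j _ hj => by rw [Pi.single_eq_of_ne hj, zpow_zero])
        (fun h => absurd (Finset.mem_univ k) h), Pi.single_eq_same, zpow_one] at h1
      rw [← h1, mul_comm]
  have h1 := h.act_of_ratio t ht'
  have h2 := h'.act hg hf w
  rw [← hz] at h2
  rw [mul_comm, (twistAction deg a g f).mul_act, ← h1.left_unique h2,
    ← (twistAction deg a g f).mul_act, inv_mul_cancel, (twistAction deg a g f).one_act]

/-- The class of the twist is the difference of the class of the torsor and that of the fractional
ideals. -/
theorem IsFrameProjection.exists_classes (hψ : IsFrameProjection π ψ)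
    (htors : IsTorsor (torsorAction deg g f hg hf) π) {pX : X ⟶ Spec (CommRingCat.of A)}
    (hπ : π ≫ pX = torsorSpaceStr g f) (htwist : IsTorsor (twistAction deg a g f) ψ) :
    ∃ y z : EtaleH1 r X, (∀ c, IsTorsorClass (torsorAction deg g f hg hf) π c ↔ c = y) ∧
      (∀ c, IsIdealClass a pX c ↔ c = z) ∧
      (∀ c, IsTorsorClass (twistAction deg a g f) ψ c ↔ c = y - z) := by
  obtain ⟨𝒰, σ, φ, Θ, hσ, hφ⟩ := htors.exists_cover_section_frame a pX
  obtain ⟨γ, hγ⟩ := htors.sections.exists_isCocycle (𝒰 := 𝒰) (σ := σ) hσ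
  obtain ⟨η, hη⟩ := (idealSections a pX).exists_isCocycle (𝒰 := 𝒰)
    (σ := fun i k c => Θ i |>.toFun (Pi.single k 1) c)
    (fun i k => ⟨(Θ i).trivialization (hφ i) k, fun c => rfl⟩)
  -- The sections of the twist matched with the `σ i`. By `Frame.Matches.eq_act` their cocycle is `γ
  -- η⁻¹`.
  choose y hy using fun i => (Θ i).exists_matches_left (a := a) hf (σ i) fun x => by
    rw [hφ, ← hσ, Category.assoc, hπ, eval_comp_torsorSpaceStr]
    rfl
  have hyψ (i) : y i ≫ ψ = 𝒰.f i := by rw [hψ _ _ _ (hy i), hσ]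
  have hcoc : htwist.sections.IsCocycle 𝒰 y (γ * η⁻¹) := by
    refine ⟨hyψ, fun i j => ?_⟩
    refine ((hy i).comp (pullback.fst (𝒰.f i) (𝒰.f j))).eq_act (hg := hg) (hf := hf)
      ((hy j).comp (pullback.snd (𝒰.f i) (𝒰.f j))) (RingHom.ext fun x => ?_) (hγ.2 i j)
      (fun k c hc => congrFun (congrFun (hη.2 i j) k) ⟨c, hc⟩)
    rw [hφ, hφ]
    change (pullback.fst (𝒰.f i) (𝒰.f j)).appTop.hom (locus.eval (𝒰.f i ≫ pX) x)
      = (pullback.snd (𝒰.f i) (𝒰.f j)).appTop.hom (locus.eval (𝒰.f j ≫ pX) x)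
    rw [← locus.eval_comp, ← locus.eval_comp, pullback.condition_assoc]
  refine ⟨EtaleH1.mk 𝒰 γ, EtaleH1.mk 𝒰 η, fun c => ?_, fun c => ?_, fun c => ?_⟩
  · rw [htors.isTorsorClass_iff, TorsorSections.class_iff hγ]
  · rw [isIdealClass_iff, TorsorSections.class_iff hη]
  · rw [htwist.isTorsorClass_iff, TorsorSections.class_iff hcoc, EtaleH1.mk_mul, EtaleH1.mk_inv,
      sub_eq_add_neg]

end TwistClass

/-! ### Coordinates of integral points -/

section SpecPoints

/-- The global functions on an affine scheme. -/
def ΓSpec (R : Type u) [CommRing R] : Γ(Spec (CommRingCat.of R), ⊤) ≃+* R :=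
  (Scheme.ΓSpecIso (CommRingCat.of R)).commRingCatIsoToRingEquiv

theorem ΓSpec_specMap {R S : Type u} [CommRing R] [CommRing S] (φ : R →+* S)
    (x : Γ(Spec (CommRingCat.of R), ⊤)) :
    ΓSpec S ((Spec.map (CommRingCat.ofHom φ)).appTop.hom x) = φ (ΓSpec R x) :=
  congrArg (fun h => h.hom x) (Scheme.ΓSpecIso_naturality (CommRingCat.ofHom φ))

theorem eval_specMap {R S : Type u} [CommRing R] [CommRing S] (φ : R →+* S) :
    locus.eval (Spec.map (CommRingCat.ofHom φ)) = ((ΓSpec S).symm : S →+* _).comp φ := by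
  refine RingHom.ext fun x => (ΓSpec S).injective ?_
  refine (ΓSpec_specMap φ _).trans ?_
  change φ (ΓSpec R ((ΓSpec R).symm x)) = ΓSpec S ((ΓSpec S).symm (φ x))
  rw [RingEquiv.apply_symm_apply, RingEquiv.apply_symm_apply]

theorem eval_id (R : Type u) [CommRing R] :
    locus.eval (𝟙 (Spec (CommRingCat.of R))) = ((ΓSpec R).symm : R →+* _) := by
  refine RingHom.ext fun x => ?_
  change (𝟙 (Spec (CommRingCat.of R)) : _ ⟶ _).appTop.hom ((ΓSpec R).symm x) = _
  rw [Scheme.Hom.id_appTop]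
  rfl

theorem notMem_vanishingAt_comp {T T' : Scheme.{u}} (k : T' ⟶ T) (x : T') (b : Γ(T, ⊤)) :
    k.appTop.hom b ∉ vanishingAt x ↔ b ∉ vanishingAt (k x) := by
  rw [notMem_vanishingAt, notMem_vanishingAt, ← Scheme.preimage_basicOpen_top]
  rfl

theorem mem_vanishingAt_spec {R : Type u} [CommRing R] (t : PrimeSpectrum R)
    (b : Γ(Spec (CommRingCat.of R), ⊤)) :
    b ∈ vanishingAt (T := Spec (CommRingCat.of R)) t ↔ ΓSpec R b ∈ t.asIdeal := by
  have key (t : Spec (CommRingCat.of R)) : b ∉ vanishingAt t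
      ↔ t ∈ (PrimeSpectrum.basicOpen (ΓSpec R b) : (Spec (.of R)).Opens) := by
    have h := locus.mem_basicOpen_eval (𝟙 (Spec (CommRingCat.of R))) t (ΓSpec R b)
    rw [eval_id, ← notMem_vanishingAt, RingEquiv.coe_toRingHom, RingEquiv.symm_apply_apply] at h
    exact h
  exact not_iff_not.mp (key t)

end SpecPoints

section Coordinates

variable {A K : Type u} [CommRing A] [Field K] [Algebra A K] {r N : ℕ}
  {deg : Fin N → Fin r → ℤ} {a : Fin r → (FractionalIdeal A⁰ K)ˣ}
  {m s : ℕ} {g : Fin s → MvPolynomial (Fin N) A} {f : Fin m → MvPolynomial (Fin N) A}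
  {dg : Fin s → Fin r → ℤ} {df : Fin m → Fin r → ℤ}

/-- The coordinates of a point with values in an affine scheme. -/
def coord {R : Type u} [CommRing R] (z : Spec (CommRingCat.of R) ⟶ torsorSpace g f) : Fin N → R :=
  fun i => ΓSpec R (pointHom z (X i))

theorem exists_ne_zero_mem_idealPow (a : Fin r → (FractionalIdeal A⁰ K)ˣ) (n : Fin r → ℤ) :
    ∃ c ∈ idealPow a n, c ≠ 0 :=
  (fieldFrame a (RingHom.id K)).exists_notMem n (I := ⊥) bot_ne_top

/-- Because `1 ∈ 𝔞^{-n} 𝔞^n`, the element `x` is a sum of terms `(c x) d` with `c x ∈ A` and `d ∈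
𝔞^n`. -/
theorem mem_idealPow_of_forall {n : Fin r → ℤ} {x : K}
    (h : ∀ c ∈ idealPow a (-n), ∃ b : A, algebraMap A K b = c * x) : x ∈ idealPow a n := by
  have key : ∀ y : K, y ∈ idealPow a (-n + n) → y * x ∈ idealPow a n := by
    intro y hy
    refine idealPow_add_induction (P := fun y => y * x ∈ idealPow a n) ?_ ?_ hy
    · intro c hc d hd
      obtain ⟨b, hb⟩ := h c hc
      rw [mul_right_comm, ← hb]
      exact algebraMap_mul_mem_idealPow b hd
    · intro c _ d _ hc hd
      rw [add_mul]
      exact add_mem_idealPow hc hd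
  have h1 := key 1 (by
    rw [neg_add_cancel, ← (algebraMap A K).map_one]
    exact algebraMap_mem_idealPow_zero a 1)
  rwa [one_mul] at h1

/-- For the tautological frame the lift is evaluation of polynomials over `K`, from which the
coordinates of integral points are read off. -/
theorem fieldFrame_lift {R : Type*} [CommRing R] (t : K →+* R)
    (ψ : MvPolynomial (Fin N) A →+* R) (hψ : ∀ x, ψ (C x) = t (algebraMap A K x)) :
    (fieldFrame a t).lift (deg := deg) ψ hψ
      = (eval₂Hom t fun i => ψ (X i)).comp (twistRing deg a).val.toRingHom := by
  refine twistRing_hom_ext (fun x => ?_) fun i c hc => ?_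
  · rw [Frame.lift_algebraMap]
    exact (eval₂_C t _ _).symm
  · rw [Frame.lift_C_mul_X _ _ _ hc]
    change t c * ψ (X i) = eval₂ t _ (C c * X i)
    rw [eval₂_mul, eval₂_C, eval₂_X]

/-- The generic fibre of an integral point in coordinates. -/
theorem algebraMap_twistHom (y : Spec (CommRingCat.of A) ⟶ twist deg a g f)
    {z : Spec (CommRingCat.of K) ⟶ torsorSpace g f}
    (hz : (fieldFrame a ((ΓSpec K).symm : K →+* _)).Matches (genericPt A K ≫ y) z)
    (p : twistRing deg a) :
    algebraMap A K (ΓSpec A (twistHom y p)) = eval (coord z) (p : MvPolynomial (Fin N) K) := by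
  rw [← ΓSpec_specMap]
  change ΓSpec K ((genericPt A K).appTop.hom (twistHom y p)) = _
  rw [← twistHom_comp, hz.hom_eq, fieldFrame_lift]
  change ΓSpec K (eval₂ ((ΓSpec K).symm : K →+* _) _ (p : MvPolynomial (Fin N) K)) = _
  rw [show ΓSpec K (eval₂ ((ΓSpec K).symm : K →+* _) (fun i => pointHom z (X i))
    (p : MvPolynomial (Fin N) K)) = (ΓSpec K : _ →+* K) (eval₂ ((ΓSpec K).symm : K →+* _)
    (fun i => pointHom z (X i)) (p : MvPolynomial (Fin N) K)) from rfl, hom_eval₂]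
  have : (ΓSpec K : Γ(Spec (CommRingCat.of K), ⊤) →+* K).comp ((ΓSpec K).symm : K →+* _)
      = RingHom.id K :=
    RingHom.ext fun x => (ΓSpec K).apply_symm_apply x
  rw [this]
  rfl

theorem exists_matches_genericPt (hg : ∀ i, IsWeightedHomogeneous deg (g i) (dg i))
    (y : IntegralPoint A (twistStr deg a g f)) :
    ∃ z : Spec (CommRingCat.of K) ⟶ torsorSpace g f,
      (fieldFrame a ((ΓSpec K).symm : K →+* _)).Matches (genericPt A K ≫ y.1) z := by
  refine Frame.exists_matches_right hg _ _ fun x => ?_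
  have h := congrArg (fun q => locus.eval q x) (congrArg (fun q => genericPt A K ≫ q) y.2)
  simp only [Category.comp_id] at h
  rw [← Category.assoc, eval_comp_twistStr] at h
  refine h.trans ?_
  unfold genericPt
  rw [eval_specMap]

/-- A nonzero `c ∈ 𝔞^{-deg x_i}` recovers `v_i` from the value `c v_i` of `c x_i`. -/
theorem isCoordinateVector_iff (y : IntegralPoint A (twistStr deg a g f))
    {z : Spec (CommRingCat.of K) ⟶ torsorSpace g f}
    (hz : (fieldFrame a ((ΓSpec K).symm : K →+* _)).Matches (genericPt A K ≫ y.1) z)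
    (v : Fin N → K) : IsCoordinateVector deg a g f y v ↔ v = coord z := by
  constructor
  · intro h
    funext i
    obtain ⟨c, hc, hc0⟩ := exists_ne_zero_mem_idealPow a (-(deg i))
    have h1 := (h ⟨_, C_mul_X_mem_twistRing deg a hc⟩).symm.trans
      (algebraMap_twistHom y.1 hz ⟨_, C_mul_X_mem_twistRing deg a hc⟩)
    simpa [hc0] using h1
  · rintro rfl p
    exact algebraMap_twistHom y.1 hz p

theorem eval_map_eq_aeval (v : Fin N → K) (p : MvPolynomial (Fin N) A) :
    eval v (MvPolynomial.map (algebraMap A K) p) = aeval v p := by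
  rw [MvPolynomial.eval_map, aeval_def]

theorem sum_le_of_forall_mem [IsFractionRing A K] {J : FractionalIdeal A⁰ K} {x : Fin m → K}
    (h : ∀ i, ∀ c ∈ idealPow a (-(df i)), x i * c ∈ J) :
    ∑ i, FractionalIdeal.spanSingleton A⁰ (x i) * idealPow a (-(df i)) ≤ J := by
  refine Finset.sum_induction _ (· ≤ J) (fun I I' hI hI' => ?_) (FractionalIdeal.zero_le J)
    fun i _ => FractionalIdeal.spanSingleton_mul_le_iff.mpr (h i)
  rw [← FractionalIdeal.sup_eq_add]
  exact sup_le hI hI'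

variable [IsDomain A] [IsFractionRing A K]

/-- The points of a twist are nonzero at the given equations. -/
theorem exists_twistHom_C_mul_map_notMem (hg : ∀ i, IsWeightedHomogeneous deg (g i) (dg i))
    (hf : ∀ i, IsWeightedHomogeneous deg (f i) (df i)) {T : Scheme.{u}}
    (y : T ⟶ twist deg a g f) (t : T) :
    ∃ (i : Fin m) (c : K) (hc : c ∈ idealPow a (-(df i))),
      twistHom y ⟨_, C_mul_map_mem_twistRing hc (hf i)⟩ ∉ vanishingAt t := by
  -- The twisted ideal is generated by `c h` for all homogeneous `h` in the ideal of the `f_i`.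
  -- Locally, a matched point of `Y` allows `h` to be one of the `f_i`.
  obtain ⟨𝒱, h𝒱⟩ := exists_cover_matches (a := a) (f := f) hg y
  obtain ⟨j, x, rfl⟩ := 𝒱.exists_eq t
  obtain ⟨z, φ, Θ, hz⟩ := h𝒱 j
  obtain ⟨i, hi⟩ := exists_pointHom_notMem z x
  obtain ⟨c, hc, hcx⟩ := Θ.exists_notMem (-(df i)) (I := vanishingAt x) Ideal.IsPrime.ne_top'
  refine ⟨i, c, hc, ?_⟩
  rw [← notMem_vanishingAt_comp, ← twistHom_comp, hz.hom_eq,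
    Frame.lift_C_mul_map _ _ _ hc (hf i) _ rfl]
  exact fun h => (Ideal.IsPrime.mem_or_mem inferInstance h).elim hcx hi

/-- All conditions are read off from values of functions at `y`, which lie in `A`: those of `c x_i`,
of `c f_i`, and of `c g_j`, which are zero. -/
theorem coord_mem_integralCoordinates (hg : ∀ i, IsWeightedHomogeneous deg (g i) (dg i))
    (hf : ∀ i, IsWeightedHomogeneous deg (f i) (df i))
    (y : IntegralPoint A (twistStr deg a g f))
    {z : Spec (CommRingCat.of K) ⟶ torsorSpace g f}
    (hz : (fieldFrame a ((ΓSpec K).symm : K →+* _)).Matches (genericPt A K ≫ y.1) z) :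
    coord z ∈ integralCoordinates deg a g f df := by
  have hval (i : Fin m) {c : K} (hc : c ∈ idealPow a (-(df i))) :
      algebraMap A K (ΓSpec A (twistHom y.1 ⟨_, C_mul_map_mem_twistRing hc (hf i)⟩))
        = aeval (coord z) (f i) * c := by
    rw [algebraMap_twistHom y.1 hz, map_mul, eval_C, eval_map_eq_aeval, mul_comm]
  refine ⟨fun i => mem_idealPow_of_forall fun c hc => ?_, le_antisymm ?_ ?_, fun j => ?_⟩
  · refine ⟨_, (algebraMap_twistHom y.1 hz ⟨_, C_mul_X_mem_twistRing deg a hc⟩).trans ?_⟩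
    rw [map_mul, eval_C, eval_X]
  · refine sum_le_of_forall_mem fun i c hc => ?_
    rw [← hval i hc]
    exact FractionalIdeal.coe_mem_one _ _
  · let J : FractionalIdeal A⁰ K :=
      ∑ i, FractionalIdeal.spanSingleton A⁰ (aeval (coord z) (f i)) * idealPow a (-(df i))
    -- If the sum were smaller than `A`, the values of all `c f_i` would lie in some maximal ideal
    -- `q`, but at `q` one of them is nonzero.
    let J' : Ideal A := (J : Submodule A K).comap (Algebra.linearMap A K)
    have hJ' : J' = ⊤ := by
      by_contra hne
      obtain ⟨q, hq, hJq⟩ := Ideal.exists_le_maximal J' hne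
      obtain ⟨i, c, hc, hnot⟩ := exists_twistHom_C_mul_map_notMem hg hf y.1
        (⟨q, hq.isPrime⟩ : PrimeSpectrum A)
      refine hnot ((mem_vanishingAt_spec _ _).mpr (hJq ?_))
      change algebraMap A K _ ∈ J
      rw [hval i hc]
      have hle : FractionalIdeal.spanSingleton A⁰ (aeval (coord z) (f i)) * idealPow a (-(df i))
          ≤ J := by
        change _ ≤ ∑ i, _
        rw [← Finset.add_sum_erase _ _ (Finset.mem_univ i), ← FractionalIdeal.sup_eq_add]
        exact le_sup_left
      exact hle (FractionalIdeal.mul_mem_mul (FractionalIdeal.mem_spanSingleton_self _ _) hc)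
    change 1 ≤ J
    rw [FractionalIdeal.one_le]
    have h1 : (1 : A) ∈ J' := hJ' ▸ Submodule.mem_top
    have h2 : algebraMap A K 1 ∈ J := h1
    rwa [map_one] at h2
  · obtain ⟨c, hc, hc0⟩ := exists_ne_zero_mem_idealPow a (-(dg j))
    have h1 := algebraMap_twistHom y.1 hz ⟨_, C_mul_map_mem_twistRing hc (hg j)⟩
    rw [twistHom_eq_zero y.1 (Ideal.subset_span
      ⟨dg j, c, hc, g j, Ideal.subset_span ⟨j, rfl⟩, hg j, rfl⟩), map_zero, map_zero, map_mul,
      eval_C, eval_map_eq_aeval] at h1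
    exact (mul_eq_zero.mp h1.symm).resolve_left hc0

omit [IsDomain A] [IsFractionRing A K] in
-- A monomial `c x^d` takes the value `c v^d`, which lies in `𝔞^{-deg d} 𝔞^{deg d} = A`.
theorem eval_mem_range {v : Fin N → K} (hv : ∀ i, v i ∈ idealPow a (deg i)) (p : twistRing deg a) :
    ∃ b, algebraMap A K b = eval v (p : MvPolynomial (Fin N) K) := by
  have hpow (d : Fin N →₀ ℕ) : (d.prod fun i e => v i ^ e) ∈ idealPow a (Finsupp.weight deg d) := by
    induction d using Finsupp.induction_linear with
    | zero =>
      rw [Finsupp.prod_zero_index, map_zero, ← (algebraMap A K).map_one]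
      exact algebraMap_mem_idealPow_zero a 1
    | add d d' hd hd' =>
      rw [Finsupp.prod_add_index' (fun i => pow_zero _) (fun i e e' => pow_add _ _ _), map_add]
      exact mul_mem_idealPow hd hd'
    | single i e =>
      rw [Finsupp.prod_single_index (h := fun i e => v i ^ e) (pow_zero _), Finsupp.weight_single]
      induction e with
      | zero =>
        rw [pow_zero, zero_smul, ← (algebraMap A K).map_one]
        exact algebraMap_mem_idealPow_zero a 1
      | succ e he =>
        rw [pow_succ, succ_nsmul]
        exact mul_mem_idealPow he (hv i)
  induction p using twistRing_induction with
  | hmon d c hc =>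
    have h := mul_mem_idealPow hc (hpow d)
    rw [neg_add_cancel, idealPow_zero, FractionalIdeal.mem_one_iff] at h
    obtain ⟨b, hb⟩ := h
    exact ⟨b, hb.trans (eval_monomial (f := v)).symm⟩
  | hadd p q hp hq =>
    obtain ⟨b, hb⟩ := hp
    obtain ⟨c, hc⟩ := hq
    exact ⟨b + c, by rw [map_add, hb, hc]; exact (map_add (eval v) _ _).symm⟩

omit [IsDomain A] in
/-- The integral point with given coordinates. -/
theorem exists_isCoordinateVector (hf : ∀ i, IsWeightedHomogeneous deg (f i) (df i))
    {v : Fin N → K} (hv : v ∈ integralCoordinates deg a g f df) :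
    ∃ y : IntegralPoint A (twistStr deg a g f), IsCoordinateVector deg a g f y v := by
  obtain ⟨hv, hfv, hgv⟩ := hv
  choose χ₀ hχ₀ using eval_mem_range (a := a) hv
  have hinj := IsFractionRing.injective A K
  let χ : twistRing deg a →+* A :=
    { toFun := χ₀
      map_one' := hinj (by rw [hχ₀, map_one]; exact map_one (eval v))
      map_mul' := fun p q => hinj (by rw [hχ₀, map_mul, hχ₀, hχ₀]; exact map_mul (eval v) _ _)
      map_zero' := hinj (by rw [hχ₀, map_zero]; exact map_zero (eval v))
      map_add' := fun p q => hinj (by rw [hχ₀, map_add, hχ₀, hχ₀]; exact map_add (eval v) _ _) }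
  have hχ (p : twistRing deg a) : algebraMap A K (χ p) = eval v (p : MvPolynomial (Fin N) K) :=
    hχ₀ p
  obtain ⟨y, hy⟩ := exists_twistHom_eq (deg := deg) (a := a) (g := g) (f := f)
    (T := Spec (CommRingCat.of A)) (((ΓSpec A).symm : A →+* _).comp χ)
    (fun n c hc h hh hhn p hp => by
      have : χ p = 0 := hinj (by
        have hh' : aeval v h = 0 := by
          refine (Ideal.span_le (I := RingHom.ker (aeval v).toRingHom)).mpr ?_ hh
          rintro _ ⟨j, rfl⟩
          exact RingHom.mem_ker.mpr (hgv j)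
        rw [hχ, hp, map_mul, eval_map_eq_aeval, hh', mul_zero, map_zero])
      rw [RingHom.comp_apply, this, map_zero])
    fun t => by
      -- If all of the twisted ideal vanished at the prime `q`, every `f_i(v) 𝔞^{-deg f_i}` would
      -- lie in `q`, against coprimality.
      by_contra! hcon
      let q : PrimeSpectrum A := t
      have hle : (1 : FractionalIdeal A⁰ K) ≤ (q.asIdeal : FractionalIdeal A⁰ K) := by
        rw [← hfv]
        refine sum_le_of_forall_mem fun i c hc => ?_
        have h1 := hcon ⟨_, C_mul_map_mem_twistRing hc (hf i)⟩ (Ideal.subset_span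
          ⟨df i, c, hc, f i, Ideal.subset_span ⟨i, rfl⟩, hf i, rfl⟩)
        have h2 := (mem_vanishingAt_spec q _).mp h1
        rw [RingHom.comp_apply] at h2
        rw [FractionalIdeal.mem_coeIdeal]
        refine ⟨_, h2, ?_⟩
        change algebraMap A K (ΓSpec A ((ΓSpec A).symm _)) = _
        rw [RingEquiv.apply_symm_apply, hχ, map_mul, eval_C, eval_map_eq_aeval, mul_comm]
      rw [FractionalIdeal.one_le, FractionalIdeal.mem_coeIdeal] at hle
      obtain ⟨b, hb, hb1⟩ := hle
      rw [← (algebraMap A K).map_one] at hb1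
      exact q.2.ne_top ((Ideal.eq_top_iff_one _).mpr (hinj hb1 ▸ hb))
  refine ⟨⟨y, eval_injective (RingHom.ext fun x => ?_)⟩, fun p => ?_⟩
  · rw [eval_comp_twistStr, hy, eval_id]
    change (ΓSpec A).symm (χ (algebraMap A _ x)) = (ΓSpec A).symm x
    congr 1
    refine hinj ((hχ _).trans ?_)
    exact eval_C _
  · change algebraMap A K (ΓSpec A (twistHom y p)) = _
    rw [hy, ← hχ]
    exact congrArg _ ((ΓSpec A).apply_symm_apply _)

omit [IsDomain A] in
theorem IsCoordinateVector.left_unique {y y' : IntegralPoint A (twistStr deg a g f)} {v : Fin N → K}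
    (h : IsCoordinateVector deg a g f y v) (h' : IsCoordinateVector deg a g f y' v) : y = y' := by
  refine Subtype.ext (twistHom_injective (RingHom.ext fun p => (ΓSpec A).injective ?_))
  exact IsFractionRing.injective A K ((h p).trans (h' p).symm)

/-- The integral points of a twist in coordinates. -/
theorem exists_equiv_integralCoordinates (hg : ∀ i, IsWeightedHomogeneous deg (g i) (dg i))
    (hf : ∀ i, IsWeightedHomogeneous deg (f i) (df i)) :
    ∃ e : IntegralPoint A (twistStr deg a g f) ≃ integralCoordinates deg a g f df,
      ∀ y v, IsCoordinateVector deg a g f y v ↔ v = (e y : Fin N → K) := by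
  choose z hz using exists_matches_genericPt (K := K) (a := a) (f := f) hg
  refine ⟨Equiv.ofBijective
    (fun y => ⟨coord (z y), coord_mem_integralCoordinates hg hf y (hz y)⟩) ⟨fun y y' h => ?_,
      fun v => ?_⟩, fun y v => isCoordinateVector_iff y (hz y) v⟩
  · have h1 := (isCoordinateVector_iff y (hz y) _).mpr rfl
    rw [show coord (z y) = coord (z y') from congrArg Subtype.val h] at h1
    exact h1.left_unique ((isCoordinateVector_iff y' (hz y') _).mpr rfl)
  · obtain ⟨y, hy⟩ := exists_isCoordinateVector hf v.2
    exact ⟨y, Subtype.ext ((isCoordinateVector_iff y (hz y) _).mp hy).symm⟩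

end Coordinates

/-! ### Local conditions on the coordinates -/

section IdealValuation

open IsDedekindDomain WithZero

variable {A K : Type u} [CommRing A] [IsDedekindDomain A] [Field K] [Algebra A K]
  [IsFractionRing A K] (w : HeightOneSpectrum A)

theorem valuation_eq_exp_count {x : K} (hx : x ≠ 0) :
    w.valuation K x = exp (-(FractionalIdeal.count K w (FractionalIdeal.spanSingleton A⁰ x))) := by
  classical
  obtain ⟨n, d, rfl⟩ := IsLocalization.exists_mk'_eq A⁰ x
  have hn : n ≠ 0 := by
    rintro rfl
    exact hx (IsLocalization.mk'_zero d)
  have hd : (d : A) ≠ 0 := nonZeroDivisors.ne_zero d.2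
  have h : FractionalIdeal.spanSingleton A⁰ (IsLocalization.mk' K n d)
      = FractionalIdeal.spanSingleton A⁰ ((algebraMap A K) d)⁻¹
        * ((Ideal.span {n} : Ideal A) : FractionalIdeal A⁰ K) := by
    rw [FractionalIdeal.coeIdeal_span_singleton, FractionalIdeal.spanSingleton_mul_spanSingleton,
      IsFractionRing.mk'_eq_div, div_eq_inv_mul]
  rw [FractionalIdeal.count_well_defined K w (FractionalIdeal.spanSingleton_ne_zero_iff.mpr hx) h,
    HeightOneSpectrum.valuation_of_mk', HeightOneSpectrum.intValuation_if_neg _ hn,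
    HeightOneSpectrum.intValuation_if_neg _ hd, ← exp_sub]
  congr 1
  ring

theorem valuation_le_exp_count {I : FractionalIdeal A⁰ K} {x : K} (hx : x ∈ I) :
    w.valuation K x ≤ exp (-(FractionalIdeal.count K w I)) := by
  by_cases h0 : x = 0
  · rw [h0, map_zero]
    exact zero_le
  · rw [valuation_eq_exp_count w h0, exp_le_exp, neg_le_neg_iff]
    exact FractionalIdeal.count_mono K w (FractionalIdeal.spanSingleton_ne_zero_iff.mpr h0)
      (FractionalIdeal.spanSingleton_le_iff_mem.mpr hx)

theorem eq_of_forall_count_eq {I J : (FractionalIdeal A⁰ K)ˣ}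
    (h : ∀ w : HeightOneSpectrum A,
      FractionalIdeal.count K w (I : FractionalIdeal A⁰ K) = FractionalIdeal.count K w J) :
    I = J := by
  refine Units.ext ?_
  rw [← FractionalIdeal.finprod_heightOneSpectrum_factorization' K I.ne_zero,
    ← FractionalIdeal.finprod_heightOneSpectrum_factorization' K J.ne_zero]
  exact finprod_congr fun w => by rw [h w]

theorem exists_count_eq {e : HeightOneSpectrum A → ℤ} (he : ∀ᶠ w in Filter.cofinite, e w = 0) :
    ∃ I : (FractionalIdeal A⁰ K)ˣ, ∀ w, FractionalIdeal.count K w (I : FractionalIdeal A⁰ K)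
      = e w := by
  refine ⟨∏ᶠ w : HeightOneSpectrum A, (Units.mk0 (w.asIdeal : FractionalIdeal A⁰ K)
    (FractionalIdeal.coeIdeal_ne_zero.mpr w.ne_bot)) ^ e w, fun w => ?_⟩
  rw [← FractionalIdeal.count_finprod K w e he]
  congr 1
  refine ((Units.coeHom (FractionalIdeal A⁰ K)).map_finprod_of_injective Units.val_injective
    _).trans (finprod_congr fun w => ?_)
  rw [map_zpow]
  rfl

theorem count_toPrincipalIdeal_mul (x : Kˣ) (I : (FractionalIdeal A⁰ K)ˣ) :
    FractionalIdeal.count K w ((toPrincipalIdeal A K x * I : (FractionalIdeal A⁰ K)ˣ) :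
      FractionalIdeal A⁰ K) = FractionalIdeal.count K w (FractionalIdeal.spanSingleton A⁰ (x : K))
        + FractionalIdeal.count K w (I : FractionalIdeal A⁰ K) := by
  rw [Units.val_mul, coe_toPrincipalIdeal, FractionalIdeal.count_mul K w
    (FractionalIdeal.spanSingleton_ne_zero_iff.mpr x.ne_zero) I.ne_zero]

theorem ClassGroup.mk_eq_mk_iff {I J : (FractionalIdeal A⁰ K)ˣ} :
    ClassGroup.mk K I = ClassGroup.mk K J ↔ ∃ x : Kˣ, J = toPrincipalIdeal A K x * I := by
  rw [← (ClassGroup.equiv K).injective.eq_iff, ClassGroup.equiv_mk, ClassGroup.equiv_mk,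
    FractionalIdeal.canonicalEquiv_self]
  have h (I : (FractionalIdeal A⁰ K)ˣ) :
      Units.mapEquiv (↑(RingEquiv.refl (FractionalIdeal A⁰ K)) :
        FractionalIdeal A⁰ K ≃* FractionalIdeal A⁰ K) I = I := Units.ext rfl
  rw [h, h, QuotientGroup.mk'_eq_mk']
  constructor
  · rintro ⟨_, ⟨x, rfl⟩, rfl⟩
    exact ⟨x, mul_comm _ _⟩
  · rintro ⟨x, rfl⟩
    exact ⟨_, ⟨x, rfl⟩, mul_comm _ _⟩

variable {r : ℕ}

theorem count_idealPow (a : Fin r → (FractionalIdeal A⁰ K)ˣ) (n : Fin r → ℤ) :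
    FractionalIdeal.count K w (idealPow a n)
      = n ⬝ᵥ fun j => FractionalIdeal.count K w (a j : FractionalIdeal A⁰ K) := by
  classical
  unfold idealPow
  rw [Units.coe_prod, FractionalIdeal.count_prod K w _ _ fun j _ => Units.ne_zero _]
  refine Finset.sum_congr rfl fun j _ => ?_
  rw [Units.val_zpow_eq_zpow_val, FractionalIdeal.count_zpow]

theorem idealPow_ne_zero (a : Fin r → (FractionalIdeal A⁰ K)ˣ) (n : Fin r → ℤ) :
    idealPow a n ≠ 0 :=
  Units.ne_zero _

/-- For the converse direction, `x ∈ 𝔞^n` follows from `𝔞^{-n} x ⊆ A`, and membership in `A` is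
detected by the valuations. -/
theorem mem_idealPow_iff {a : Fin r → (FractionalIdeal A⁰ K)ˣ} {n : Fin r → ℤ} {x : K} :
    x ∈ idealPow a n ↔ ∀ w : HeightOneSpectrum A, w.valuation K x
      ≤ exp (-(n ⬝ᵥ fun j => FractionalIdeal.count K w (a j : FractionalIdeal A⁰ K))) := by
  constructor
  · intro hx w
    rw [← count_idealPow]
    exact valuation_le_exp_count w hx
  · intro h
    refine mem_idealPow_of_forall fun c hc => ?_
    refine HeightOneSpectrum.mem_integers_of_valuation_le_one K (c * x) fun w => ?_
    have hc' := valuation_le_exp_count w hc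
    rw [count_idealPow] at hc'
    rw [map_mul]
    refine (mul_le_mul' hc' (h w)).trans ?_
    rw [← exp_add, neg_dotProduct, neg_neg, add_neg_cancel, exp_zero]

theorem valuation_multiPow {ρ : Fin r → Kˣ} {e : Fin r → ℤ}
    (h : ∀ j, w.valuation K (ρ j : K) = exp (-(e j))) (n : Fin r → ℤ) :
    w.valuation K ((multiPow ρ n : Kˣ) : K) = exp (-(n ⬝ᵥ e)) := by
  unfold multiPow dotProduct
  rw [Units.coe_prod, map_prod, ← Finset.sum_neg_distrib]
  have hsum (S : Finset (Fin r)) (k : Fin r → ℤ) :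
      ∏ j ∈ S, (exp (k j) : ℤᵐ⁰) = exp (∑ j ∈ S, k j) := by
    induction S using Finset.cons_induction with
    | empty => simp
    | cons j S hj ih => rw [Finset.prod_cons, Finset.sum_cons, ih, exp_add]
  rw [← hsum]
  refine Finset.prod_congr rfl fun j _ => ?_
  rw [Units.val_zpow_eq_zpow_val, map_zpow₀, h j, ← exp_zsmul]
  congr 1
  simp

variable {N m s : ℕ} (deg : Fin N → Fin r → ℤ) (f : Fin m → MvPolynomial (Fin N) A)
  (df : Fin m → Fin r → ℤ)

/-- The local condition at `w` on the coordinates of a point, with respect to the ideals of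
order `e_j` at `w`. -/
def IsPrimitiveAt (e : Fin r → ℤ) (v : Fin N → K) : Prop :=
  (∀ i, w.valuation K (v i) ≤ exp (-(deg i ⬝ᵥ e))) ∧
    ∃ i, w.valuation K (aeval v (f i)) = exp (-(df i ⬝ᵥ e))

variable {deg f df}

/-- The bounds on the coordinates multiply up to the exponent `n ⬝ᵥ e` on each monomial of degree
`n`, and coefficients in `A` have valuation at most one. -/
theorem valuation_aeval_le {p : MvPolynomial (Fin N) A} {n e : Fin r → ℤ}
    (hp : IsWeightedHomogeneous deg p n) {v : Fin N → K}
    (hv : ∀ i, w.valuation K (v i) ≤ exp (-(deg i ⬝ᵥ e))) :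
    w.valuation K (aeval v p) ≤ exp (-(n ⬝ᵥ e)) := by
  have hpow (d : Fin N →₀ ℕ) : w.valuation K (d.prod fun i k => v i ^ k)
      ≤ exp (-(Finsupp.weight deg d ⬝ᵥ e)) := by
    induction d using Finsupp.induction_linear with
    | zero => simp
    | add d d' hd hd' =>
      rw [Finsupp.prod_add_index' (fun i => pow_zero _) (fun i k k' => pow_add _ _ _), map_add,
        map_mul, add_dotProduct, neg_add, exp_add]
      exact mul_le_mul' hd hd'
    | single i k =>
      rw [Finsupp.prod_single_index (h := fun i k => v i ^ k) (pow_zero _), Finsupp.weight_single,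
        map_pow, smul_dotProduct, ← smul_neg, exp_nsmul]
      exact pow_le_pow_left' (hv i) k
  rw [aeval_def, eval₂_eq']
  refine Valuation.map_sum_le _ fun d hd => ?_
  rw [map_mul, ← hp (mem_support_iff.mp hd)]
  refine (mul_le_mul' (w.valuation_le_one _) ?_).trans_eq (one_mul _)
  refine le_trans (le_of_eq ?_) (hpow d)
  rw [Finsupp.prod_fintype _ _ fun i => pow_zero _]

/-- A nonzero fractional ideal is `A` if its order at every prime is zero, and a sum of ideals
inside `A` has order zero exactly when some summand does. The hypothesis `hx` makes the sum nonzero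
even when `A` is a field and there are no primes. -/
theorem sum_spanSingleton_eq_one_iff {a : Fin r → (FractionalIdeal A⁰ K)ˣ} {x : Fin m → K}
    (hx : ∃ i, x i ≠ 0) :
    ∑ i, FractionalIdeal.spanSingleton A⁰ (x i) * idealPow a (-(df i)) = 1 ↔
      (∀ i, x i ∈ idealPow a (df i)) ∧ ∀ w : HeightOneSpectrum A, ∃ i, w.valuation K (x i)
        = exp (-(df i ⬝ᵥ fun j => FractionalIdeal.count K w (a j : FractionalIdeal A⁰ K))) := by
  have hle (i : Fin m) : FractionalIdeal.spanSingleton A⁰ (x i) * idealPow a (-(df i))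
      ≤ ∑ i, FractionalIdeal.spanSingleton A⁰ (x i) * idealPow a (-(df i)) := by
    rw [← Finset.add_sum_erase _ _ (Finset.mem_univ i), ← FractionalIdeal.sup_eq_add]
    exact le_sup_left
  constructor
  · intro h
    have hmem (i : Fin m) : x i ∈ idealPow a (df i) := by
      refine mem_idealPow_of_forall fun c hc => ?_
      have h1 := (hle i).trans h.le (FractionalIdeal.mul_mem_mul
        (FractionalIdeal.mem_spanSingleton_self _ _) hc)
      obtain ⟨b, hb⟩ := (FractionalIdeal.mem_one_iff _).mp h1
      exact ⟨b, by rw [hb, mul_comm]⟩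
    refine ⟨hmem, fun w => ?_⟩
    by_contra! hcon
    -- If at `w` every `x_i` had a larger order than prescribed, all summands would lie in the prime
    -- ideal of `w`.
    have h1 : (1 : FractionalIdeal A⁰ K) ≤ (w.asIdeal : FractionalIdeal A⁰ K) := by
      rw [← h]
      refine sum_le_of_forall_mem fun i c hc => ?_
      have h2 := FractionalIdeal.mul_mem_mul (hmem i) hc
      rw [← idealPow_add, add_neg_cancel, idealPow_zero, FractionalIdeal.mem_one_iff] at h2
      obtain ⟨b, hb⟩ := h2
      rw [FractionalIdeal.mem_coeIdeal]
      refine ⟨b, ?_, hb⟩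
      refine (HeightOneSpectrum.valuation_lt_one_iff_mem (K := K) w b).mp ?_
      change w.valuation K (algebraMap A K b) < 1
      rw [hb, map_mul]
      have hlt := (mem_idealPow_iff.mp (hmem i) w).lt_of_ne (hcon i)
      have hc' := mem_idealPow_iff.mp hc w
      refine (mul_le_mul_right hc' _).trans_lt ((mul_lt_mul_of_pos_right hlt exp_pos).trans_le ?_)
      rw [← exp_add, neg_dotProduct, neg_neg, neg_add_cancel, exp_zero]
    rw [FractionalIdeal.one_le, FractionalIdeal.mem_coeIdeal] at h1
    obtain ⟨b, hb, hb1⟩ := h1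
    rw [← (algebraMap A K).map_one] at hb1
    exact w.isPrime.ne_top ((Ideal.eq_top_iff_one _).mpr (IsFractionRing.injective A K hb1 ▸ hb))
  · rintro ⟨hmem, h⟩
    have h1 : ∑ i, FractionalIdeal.spanSingleton A⁰ (x i) * idealPow a (-(df i)) ≤ 1 := by
      refine sum_le_of_forall_mem fun i c hc => ?_
      have h2 := FractionalIdeal.mul_mem_mul (hmem i) hc
      rwa [← idealPow_add, add_neg_cancel, idealPow_zero] at h2
    have hne (i : Fin m) (hi : x i ≠ 0) :
        FractionalIdeal.spanSingleton A⁰ (x i) * idealPow a (-(df i)) ≠ 0 :=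
      mul_ne_zero (FractionalIdeal.spanSingleton_ne_zero_iff.mpr hi) (idealPow_ne_zero a _)
    have h0 : ∑ i, FractionalIdeal.spanSingleton A⁰ (x i) * idealPow a (-(df i)) ≠ 0 := by
      obtain ⟨i, hi⟩ := hx
      intro h0
      exact hne i hi (FractionalIdeal.le_zero_iff.mp ((hle i).trans h0.le))
    refine congrArg Units.val (eq_of_forall_count_eq (I := Units.mk0 _ h0) (J := 1) fun w => ?_)
    rw [Units.val_mk0, Units.val_one, FractionalIdeal.count_one]
    refine le_antisymm ?_ ?_
    · obtain ⟨i, hi⟩ := h w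
      have hi0 : x i ≠ 0 := by
        intro h0
        rw [h0, map_zero] at hi
        exact exp_ne_zero hi.symm
      refine (FractionalIdeal.count_mono K w (hne i hi0) (hle i)).trans ?_
      rw [FractionalIdeal.count_mul K w (FractionalIdeal.spanSingleton_ne_zero_iff.mpr hi0)
        (idealPow_ne_zero a _), count_idealPow, neg_dotProduct]
      rw [valuation_eq_exp_count w hi0, exp_inj] at hi
      lia
    · rw [← FractionalIdeal.count_one K w]
      exact FractionalIdeal.count_mono K w h0 h1

/-- Integrality splits into separate conditions at the primes, depending on `𝔞` only through its
orders. That `f_i(v) ∈ 𝔞^{deg f_i}` is automatic by homogeneity. -/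
theorem mem_integralCoordinates_iff {a : Fin r → (FractionalIdeal A⁰ K)ˣ}
    {g : Fin s → MvPolynomial (Fin N) A} {v : Fin N → K} (hv : ∃ i, aeval v (f i) ≠ 0)
    (hf : ∀ i, IsWeightedHomogeneous deg (f i) (df i))
    (hgv : ∀ j, aeval v (g j) = 0) :
    v ∈ integralCoordinates deg a g f df ↔ ∀ w : HeightOneSpectrum A, IsPrimitiveAt w deg f df
      (fun j => FractionalIdeal.count K w (a j : FractionalIdeal A⁰ K)) v := by
  change (∀ i, v i ∈ idealPow a (deg i)) ∧ _ ∧ _ ↔ _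
  rw [sum_spanSingleton_eq_one_iff hv]
  constructor
  · rintro ⟨h, ⟨-, h'⟩, -⟩ w
    exact ⟨fun i => mem_idealPow_iff.mp (h i) w, h' w⟩
  · intro h
    exact ⟨fun i => mem_idealPow_iff.mpr fun w => (h w).1 i,
      ⟨fun i => mem_idealPow_iff.mpr fun w => valuation_aeval_le w (hf i) (h w).1, fun w => (h w).2⟩, hgv⟩

end IdealValuation

/-! ### Rational points -/

section FieldPoints

variable {A K : Type u} [CommRing A] [Field K] [Algebra A K] {r N : ℕ}
  {deg : Fin N → Fin r → ℤ} {a : Fin r → (FractionalIdeal A⁰ K)ˣ}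
  {m s : ℕ} {g : Fin s → MvPolynomial (Fin N) A} {f : Fin m → MvPolynomial (Fin N) A}
  {dg : Fin s → Fin r → ℤ} {df : Fin m → Fin r → ℤ}

/-- The point of the torus with given coordinates. -/
def specTorus {R : Type u} [CommRing R] : (Fin r → Rˣ) →* Torus r (Spec (CommRingCat.of R)) :=
  MonoidHom.compLeft (Units.map ((ΓSpec R).symm : R →* Γ(Spec (CommRingCat.of R), ⊤))) (Fin r)

theorem ΓSpec_specTorus_char {R : Type u} [CommRing R] (ρ : Fin r → Rˣ) (n : Fin r → ℤ) :
    ΓSpec R ((specTorus ρ).char n : Γ(Spec (CommRingCat.of R), ⊤)ˣ) = (multiPow ρ n : Rˣ) := by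
  have h : (specTorus ρ).char n = Units.map ((ΓSpec R).symm : R →* _) (multiPow ρ n) := by
    simp [Torus.char, multiPow, specTorus, map_prod, map_zpow]
  rw [h]
  exact (ΓSpec R).apply_symm_apply _

theorem exists_specTorus_eq {R : Type u} [CommRing R] (t : Torus r (Spec (CommRingCat.of R))) :
    ∃ ρ : Fin r → Rˣ, specTorus ρ = t := by
  refine ⟨fun j => Units.map (ΓSpec R).toRingHom.toMonoidHom (t j), funext fun j => Units.ext ?_⟩
  exact (ΓSpec R).symm_apply_apply _

theorem res_specTorus {R S : Type u} [CommRing R] [CommRing S] (φ : R →+* S) (ρ : Fin r → Rˣ) :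
    Torus.res (Spec.map (CommRingCat.ofHom φ)) (specTorus ρ)
      = specTorus fun j => Units.map (φ : R →* S) (ρ j) := by
  funext j
  refine Units.ext ((ΓSpec S).injective ?_)
  refine (ΓSpec_specMap φ _).trans ?_
  change φ (ΓSpec R ((ΓSpec R).symm _)) = ΓSpec S ((ΓSpec S).symm (φ _))
  rw [RingEquiv.apply_symm_apply, RingEquiv.apply_symm_apply]

theorem specTorus_injective {R : Type u} [CommRing R] :
    Function.Injective (specTorus (r := r) (R := R)) := by
  intro ρ ρ' h
  funext j
  refine Units.ext ((ΓSpec R).symm.injective ?_)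
  exact congrArg Units.val (congrFun h j)

theorem pointHom_torsorAction (hg : ∀ i, IsWeightedHomogeneous deg (g i) (dg i))
    (hf : ∀ i, IsWeightedHomogeneous deg (f i) (df i)) {T : Scheme.{u}} (t : Torus r T)
    (z : T ⟶ torsorSpace g f) {p : MvPolynomial (Fin N) A} {n : Fin r → ℤ}
    (hp : IsWeightedHomogeneous deg p n) :
    pointHom ((torsorAction deg g f hg hf).act t z) p = t.char n * pointHom z p := by
  let := weightedGradedAlgebra A deg
  exact gradedAction_apply (weightedHomogeneousSubmodule A deg) (span_isHomogeneous deg hg)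
    (span_isHomogeneous deg hf) t z hp

theorem pointHom_C {R : Type u} [CommRing R] {φ : A →+* R}
    {z : Spec (CommRingCat.of R) ⟶ torsorSpace g f}
    (hz : z ≫ torsorSpaceStr g f = Spec.map (CommRingCat.ofHom φ)) (x : A) :
    pointHom z (C x) = (ΓSpec R).symm (φ x) := by
  have h := congrArg (fun q => locus.eval q x) hz
  simp only [eval_comp_torsorSpaceStr, eval_specMap] at h
  exact h

theorem ΓSpec_pointHom {z : Spec (CommRingCat.of K) ⟶ torsorSpace g f}
    (hz : z ≫ torsorSpaceStr g f = genericPt A K) (p : MvPolynomial (Fin N) A) :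
    ΓSpec K (pointHom z p) = aeval (coord z) p := by
  have h : ((ΓSpec K : _ →+* K).comp (pointHom z)) = (aeval (coord z)).toRingHom := by
    refine MvPolynomial.ringHom_ext (fun x => ?_) fun i => ?_
    · change ΓSpec K (pointHom z (C x)) = aeval (coord z) (C x)
      rw [pointHom_C hz, RingEquiv.apply_symm_apply, aeval_C]
    · exact (aeval_X (coord z) i).symm
  exact congrArg (fun q => q p) h

theorem eq_of_coord_eq {z z' : Spec (CommRingCat.of K) ⟶ torsorSpace g f}
    (hz : z ≫ torsorSpaceStr g f = genericPt A K) (hz' : z' ≫ torsorSpaceStr g f = genericPt A K)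
    (h : coord z = coord z') : z = z' := by
  refine pointHom_ext (fun x => ?_) fun i => (ΓSpec K).injective (congrFun h i)
  rw [pointHom_C hz, pointHom_C hz']

theorem aeval_coord_eq_zero {z : Spec (CommRingCat.of K) ⟶ torsorSpace g f}
    (hz : z ≫ torsorSpaceStr g f = genericPt A K) (j : Fin s) : aeval (coord z) (g j) = 0 := by
  rw [← ΓSpec_pointHom hz, pointHom_eq_zero z (Ideal.subset_span ⟨j, rfl⟩), map_zero]

theorem exists_aeval_coord_ne_zero {z : Spec (CommRingCat.of K) ⟶ torsorSpace g f}
    (hz : z ≫ torsorSpaceStr g f = genericPt A K) : ∃ i, aeval (coord z) (f i) ≠ 0 := by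
  obtain ⟨i, hi⟩ := exists_pointHom_notMem z (⊥ : PrimeSpectrum K)
  refine ⟨i, fun h => hi ((mem_vanishingAt_spec _ _).mpr ?_)⟩
  rw [ΓSpec_pointHom hz, h]
  exact Ideal.zero_mem _

omit [Algebra A K] in
theorem coord_act (hg : ∀ i, IsWeightedHomogeneous deg (g i) (dg i))
    (hf : ∀ i, IsWeightedHomogeneous deg (f i) (df i)) (ρ : Fin r → Kˣ)
    (z : Spec (CommRingCat.of K) ⟶ torsorSpace g f) (i : Fin N) :
    coord ((torsorAction deg g f hg hf).act (specTorus ρ) z) i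
      = (multiPow ρ (deg i) : Kˣ) * coord z i := by
  unfold coord
  rw [Frame.pointHom_torsorAction_X, map_mul, ΓSpec_specTorus_char]

theorem act_comp_torsorSpaceStr (hg : ∀ i, IsWeightedHomogeneous deg (g i) (dg i))
    (hf : ∀ i, IsWeightedHomogeneous deg (f i) (df i)) {T : Scheme.{u}} (t : Torus r T)
    (z : T ⟶ torsorSpace g f) :
    (torsorAction deg g f hg hf).act t z ≫ torsorSpaceStr g f = z ≫ torsorSpaceStr g f := by
  refine eval_injective (RingHom.ext fun x => ?_)
  rw [eval_comp_torsorSpaceStr, eval_comp_torsorSpaceStr]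
  exact Frame.pointHom_torsorAction_C hg hf t z x

theorem aeval_coord_act (hg : ∀ i, IsWeightedHomogeneous deg (g i) (dg i))
    (hf : ∀ i, IsWeightedHomogeneous deg (f i) (df i)) (ρ : Fin r → Kˣ)
    {z : Spec (CommRingCat.of K) ⟶ torsorSpace g f}
    (hz : z ≫ torsorSpaceStr g f = genericPt A K) (i : Fin m) :
    aeval (coord ((torsorAction deg g f hg hf).act (specTorus ρ) z)) (f i)
      = (multiPow ρ (df i) : Kˣ) * aeval (coord z) (f i) := by
  rw [← ΓSpec_pointHom ((act_comp_torsorSpaceStr hg hf _ z).trans hz), ← ΓSpec_pointHom hz,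
    pointHom_torsorAction hg hf _ _ (hf i), map_mul, ΓSpec_specTorus_char]

theorem valuationSubring_isUnit_iff {Γ₀ : Type*} [LinearOrderedCommGroupWithZero Γ₀]
    (ν : Valuation K Γ₀) (x : ν.valuationSubring) : IsUnit x ↔ ν (x : K) = 1 :=
  Valuation.Integers.isUnit_iff_valuation_eq_one (v := ν) (O := ν.valuationSubring)
    ⟨Subtype.val_injective, fun x => x.2, fun x hx => ⟨⟨x, hx⟩, rfl⟩⟩

/-- A rational point extends to a point with values in a valuation ring if and only if its
coordinates are integral and primitive. -/
theorem exists_valuationSubring_comp_eq_iff {Γ₀ : Type*} [LinearOrderedCommGroupWithZero Γ₀]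
    (ν : Valuation K Γ₀) (hν : ∀ x : A, ν (algebraMap A K x) ≤ 1)
    {z : Spec (CommRingCat.of K) ⟶ torsorSpace g f}
    (hz : z ≫ torsorSpaceStr g f = genericPt A K) :
    (∃ z' : Spec (CommRingCat.of ν.valuationSubring) ⟶ torsorSpace g f,
      Spec.map (CommRingCat.ofHom (algebraMap ν.valuationSubring K)) ≫ z' = z) ↔
      (∀ i, ν (coord z i) ≤ 1) ∧ ∃ i, ν (aeval (coord z) (f i)) = 1 := by
  let φ : A →+* ν.valuationSubring := (algebraMap A K).codRestrict ν.valuationSubring.toSubring hν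
  constructor
  · rintro ⟨z', rfl⟩
    have h (p : MvPolynomial (Fin N) A) : ΓSpec K (pointHom
        (Spec.map (CommRingCat.ofHom (algebraMap ν.valuationSubring K)) ≫ z') p)
        = (ΓSpec ν.valuationSubring (pointHom z' p) : K) := by
      rw [pointHom_comp, ΓSpec_specMap]
      rfl
    refine ⟨fun i => ?_, ?_⟩
    · unfold coord
      rw [h]
      exact (ΓSpec ν.valuationSubring (pointHom z' (X i))).2
    · obtain ⟨i, hi⟩ := exists_pointHom_notMem z'
        (⟨IsLocalRing.maximalIdeal _, inferInstance⟩ : PrimeSpectrum ν.valuationSubring)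
      rw [mem_vanishingAt_spec, IsLocalRing.mem_maximalIdeal, mem_nonunits_iff, not_not] at hi
      refine ⟨i, ?_⟩
      rw [← ΓSpec_pointHom hz, h]
      exact (valuationSubring_isUnit_iff ν _).mp hi
  · rintro ⟨hX, i, hi⟩
    -- Integral coordinates define a point of affine space over the valuation ring. One `f_i` is a
    -- unit on it, so the point avoids the removed locus everywhere.
    let ψ : MvPolynomial (Fin N) A →+* ν.valuationSubring := eval₂Hom φ fun i => ⟨coord z i, hX i⟩
    have hψ (p : MvPolynomial (Fin N) A) : (ψ p : K) = aeval (coord z) p := by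
      have : (algebraMap ν.valuationSubring K).comp ψ = (aeval (coord z)).toRingHom := by
        refine MvPolynomial.ringHom_ext (fun x => ?_) fun i => ?_
        · change ((ψ (C x) : ν.valuationSubring) : K) = aeval (coord z) (C x)
          rw [aeval_C]
          exact congrArg Subtype.val (eval₂_C φ _ x)
        · change ((ψ (X i) : ν.valuationSubring) : K) = aeval (coord z) (X i)
          rw [aeval_X]
          exact congrArg Subtype.val (eval₂_X φ _ i)
      exact congrArg (fun q => q p) this
    suffices h : ∃ z' : Spec (CommRingCat.of ν.valuationSubring) ⟶ torsorSpace g f,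
        pointHom z' = ((ΓSpec ν.valuationSubring).symm : ν.valuationSubring →+* _).comp ψ by
      obtain ⟨z', hz'⟩ := h
      have key (p : MvPolynomial (Fin N) A) : ΓSpec K (pointHom
          (Spec.map (CommRingCat.ofHom (algebraMap ν.valuationSubring K)) ≫ z') p)
          = aeval (coord z) p := by
        rw [pointHom_comp, ΓSpec_specMap, hz', ← hψ]
        exact congrArg Subtype.val ((ΓSpec ν.valuationSubring).apply_symm_apply (ψ p))
      refine ⟨z', pointHom_injective (RingHom.ext fun p => (ΓSpec K).injective ?_)⟩
      rw [key, ΓSpec_pointHom hz]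
    refine exists_pointHom_eq _ (fun j => ?_) fun t => ⟨f i, Ideal.subset_span ⟨i, rfl⟩, ?_⟩
    · rw [RingHom.comp_apply, show ψ (g j) = 0 from Subtype.ext ((hψ _).trans
        (aeval_coord_eq_zero hz j)), map_zero]
    · have hu : IsUnit (ψ (f i)) := by
        refine (valuationSubring_isUnit_iff ν _).mpr ?_
        rw [hψ, hi]
      exact fun h => Ideal.IsPrime.ne_top' (Ideal.eq_top_of_isUnit_mem _ h
        (RingHom.isUnit_map ((ΓSpec ν.valuationSubring).symm.toRingHom) hu))

end FieldPoints

/-! ### Rational points of the quotient -/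

section RationalPoints

open IsDedekindDomain WithZero

variable {A K : Type u} [CommRing A] [IsDedekindDomain A] [Field K] [Algebra A K]
  [IsFractionRing A K] {r N : ℕ}
  {deg : Fin N → Fin r → ℤ} {a : Fin r → (FractionalIdeal A⁰ K)ˣ}
  {m s : ℕ} {g : Fin s → MvPolynomial (Fin N) A} {f : Fin m → MvPolynomial (Fin N) A}
  {dg : Fin s → Fin r → ℤ} {df : Fin m → Fin r → ℤ}
  {hg : ∀ i, IsWeightedHomogeneous deg (g i) (dg i)}
  {hf : ∀ i, IsWeightedHomogeneous deg (f i) (df i)}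
  (w : HeightOneSpectrum A) {z z' : Spec (CommRingCat.of K) ⟶ torsorSpace g f}

/-- Acting by `ρ` multiplies values of degree `n` by `ρ^n`, which shifts `e` by the orders `d` of
`ρ`. This reduces questions to `e = 0`. -/
theorem isPrimitiveAt_act_iff {ρ : Fin r → Kˣ} {d : Fin r → ℤ}
    (hρ : ∀ j, w.valuation K (ρ j : K) = exp (-(d j))) (e : Fin r → ℤ)
    (hz : z ≫ torsorSpaceStr g f = genericPt A K) :
    IsPrimitiveAt w deg f df (e + d)
        (coord ((torsorAction deg g f hg hf).act (specTorus ρ) z)) ↔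
      IsPrimitiveAt w deg f df e (coord z) := by
  have h (n : Fin r → ℤ) : (exp (-(n ⬝ᵥ (e + d))) : ℤᵐ⁰)
      = exp (-(n ⬝ᵥ d)) * exp (-(n ⬝ᵥ e)) := by
    rw [← exp_add, dotProduct_add]
    congr 1
    ring
  unfold IsPrimitiveAt
  refine and_congr (forall_congr' fun i => ?_) (exists_congr fun i => ?_)
  · rw [coord_act, map_mul, valuation_multiPow w hρ, h]
    exact mul_le_mul_iff_right₀ exp_pos
  · rw [aeval_coord_act hg hf ρ hz, map_mul, valuation_multiPow w hρ, h]
    exact mul_right_inj' exp_ne_zero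

/-- The morphism of the generic point of the local scheme at `w`. -/
def localGenericPt (K : Type u) [Field K] [Algebra A K] [IsFractionRing A K]
    (w : HeightOneSpectrum A) :
    Spec (CommRingCat.of K) ⟶ Spec (CommRingCat.of (w.valuation K).valuationSubring) :=
  Spec.map (CommRingCat.ofHom (algebraMap (w.valuation K).valuationSubring K))

/-- The morphism of the local scheme at `w` to the spectrum of the Dedekind domain. -/
def localMap (K : Type u) [Field K] [Algebra A K] [IsFractionRing A K]
    (w : HeightOneSpectrum A) :
    Spec (CommRingCat.of (w.valuation K).valuationSubring) ⟶ Spec (CommRingCat.of A) :=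
  Spec.map (CommRingCat.ofHom ((algebraMap A K).codRestrict
    (w.valuation K).valuationSubring.toSubring w.valuation_le_one))

theorem localGenericPt_comp_localMap : localGenericPt K w ≫ localMap K w = genericPt A K := by
  unfold localGenericPt localMap genericPt
  rw [← Spec.map_comp, ← CommRingCat.ofHom_comp]
  rfl

/-- For `e = 0` the condition acquires a geometric meaning, to which the valuative criteria for `X`
can be applied. -/
theorem isPrimitiveAt_zero_iff (hz : z ≫ torsorSpaceStr g f = genericPt A K) :
    IsPrimitiveAt w deg f df 0 (coord z) ↔
      ∃ y : Spec (CommRingCat.of (w.valuation K).valuationSubring) ⟶ torsorSpace g f,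
        localGenericPt K w ≫ y = z := by
  unfold localGenericPt
  rw [exists_valuationSubring_comp_eq_iff (w.valuation K) w.valuation_le_one hz]
  simp [IsPrimitiveAt]

theorem exists_valuation_eq (d : Fin r → ℤ) :
    ∃ ρ : Fin r → Kˣ, ∀ j, w.valuation K (ρ j : K) = exp (-(d j)) := by
  choose x hx using fun j => w.valuation_surjective K (exp (-(d j)))
  refine ⟨fun j => Units.mk0 (x j) fun h => ?_, hx⟩
  have := hx j
  rw [h, map_zero] at this
  exact exp_ne_zero this.symm

theorem exists_exp_eq_valuation (x : Kˣ) : ∃ d : ℤ, w.valuation K (x : K) = exp (-d) :=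
  ⟨_, valuation_eq_exp_count w x.ne_zero⟩

theorem eq_of_localGenericPt_comp_eq {X : Scheme.{u}} {p : X ⟶ Spec (CommRingCat.of A)}
    [IsSeparated p] {y y' : Spec (CommRingCat.of (w.valuation K).valuationSubring) ⟶ X}
    (h : localGenericPt K w ≫ y = localGenericPt K w ≫ y')
    (hy : y ≫ p = localMap K w) (hy' : y' ≫ p = localMap K w) : y = y' := by
  have hs := IsSeparated.valuativeCriterion p
    { R := (w.valuation K).valuationSubring, K := K, i₁ := localGenericPt K w ≫ y,
      i₂ := localMap K w, commSq := ⟨by rw [Category.assoc, hy]; rfl⟩ }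
  exact congrArg CommSq.LiftStruct.l (hs.elim ⟨y, rfl, hy⟩ ⟨y', h.symm, hy'⟩)

variable {X : Scheme.{u}} {π : torsorSpace g f ⟶ X} {pX : X ⟶ Spec (CommRingCat.of A)}

theorem torsorSpace_comp_eq (hπ : π ≫ pX = torsorSpaceStr g f)
    {y : Spec (CommRingCat.of (w.valuation K).valuationSubring) ⟶ torsorSpace g f}
    (hz : (localGenericPt K w ≫ y) ≫ torsorSpaceStr g f = genericPt A K) :
    (y ≫ π) ≫ pX = localMap K w := by
  rw [Category.assoc, hπ]
  refine eval_injective (RingHom.ext fun x => (ΓSpec _).injective (Subtype.ext ?_))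
  have h := congrArg (fun q => ΓSpec K (locus.eval q x)) hz
  simp only [Category.assoc] at h
  rw [locus.eval_comp] at h
  refine ((ΓSpec_specMap _ _).symm.trans h).trans ?_
  unfold genericPt localMap
  rw [eval_specMap, eval_specMap]
  change ΓSpec K ((ΓSpec K).symm _) = ((ΓSpec _ ((ΓSpec (w.valuation K).valuationSubring).symm _) :
    (w.valuation K).valuationSubring) : K)
  rw [RingEquiv.apply_symm_apply, RingEquiv.apply_symm_apply]
  rfl

/-- Properness extends `π(z)` over the valuation ring, and the extension lifts to `Y` since that
ring is local. Generically the lift is `ρ z` for some `ρ ∈ (Kˣ)^r`, so `z` is primitive for minus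
the orders of `ρ`. -/
theorem IsTorsor.exists_isPrimitiveAt (htors : IsTorsor (torsorAction deg g f hg hf) π)
    (hπ : π ≫ pX = torsorSpaceStr g f) [IsProper pX]
    (hz : z ≫ torsorSpaceStr g f = genericPt A K) :
    ∃ e, IsPrimitiveAt w deg f df e (coord z) := by
  have hX : (z ≫ π) ≫ pX = localGenericPt K w ≫ localMap K w := by
    rw [Category.assoc, hπ, hz, localGenericPt_comp_localMap]
  have hex := (UniversallyClosed.eq_valuativeCriterion ▸ (inferInstance : UniversallyClosed pX) :
    (ValuativeCriterion.Existence ⊓ @QuasiCompact) pX).1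
    { R := (w.valuation K).valuationSubring, K := K, i₁ := z ≫ π, i₂ := localMap K w,
      commSq := ⟨hX⟩ }
  obtain ⟨⟨l, hl, -⟩⟩ := hex
  obtain ⟨y, hy⟩ := htors.exists_lift l
  have hl' : localGenericPt K w ≫ l = z ≫ π := hl
  obtain ⟨t, ht, -⟩ := htors.existsUnique_act_eq z (localGenericPt K w ≫ y) (by
    rw [Category.assoc, hy, hl'])
  obtain ⟨ρ, rfl⟩ := exists_specTorus_eq t
  choose d hd using fun j => exists_exp_eq_valuation w (ρ j)
  refine ⟨-d, (isPrimitiveAt_act_iff (hg := hg) (hf := hf) w hd _ hz).mp ?_⟩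
  rw [neg_add_cancel, isPrimitiveAt_zero_iff w ((act_comp_torsorSpaceStr hg hf _ z).trans hz)]
  exact ⟨y, ht.symm⟩

/-- Scaling `z` to `e = 0` and to `e' = 0` gives two points that extend to `Y` over the valuation
ring. Their images in `X` agree generically, hence agree by separatedness, so the extensions differ
by units and the two scalings have the same orders. -/
theorem IsTorsor.isPrimitiveAt_unique (htors : IsTorsor (torsorAction deg g f hg hf) π)
    (hπ : π ≫ pX = torsorSpaceStr g f) [IsSeparated pX]
    (hz : z ≫ torsorSpaceStr g f = genericPt A K) {e e' : Fin r → ℤ}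
    (h : IsPrimitiveAt w deg f df e (coord z)) (h' : IsPrimitiveAt w deg f df e' (coord z)) :
    e = e' := by
  have key (e : Fin r → ℤ) (h : IsPrimitiveAt w deg f df e (coord z)) :
      ∃ (ρ : Fin r → Kˣ) (y : Spec (CommRingCat.of (w.valuation K).valuationSubring) ⟶
        torsorSpace g f), (∀ j, w.valuation K (ρ j : K) = exp (-((-e) j))) ∧
        localGenericPt K w ≫ y = (torsorAction deg g f hg hf).act (specTorus ρ) z ∧
        (y ≫ π) ≫ pX = localMap K w := by
    obtain ⟨ρ, hρ⟩ := exists_valuation_eq (K := K) w (-e)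
    have hz' := (act_comp_torsorSpaceStr hg hf (specTorus ρ) z).trans hz
    have h1 := (isPrimitiveAt_act_iff (hg := hg) (hf := hf) w hρ e hz).mpr h
    rw [add_neg_cancel, isPrimitiveAt_zero_iff w hz'] at h1
    obtain ⟨y, hy⟩ := h1
    refine ⟨ρ, y, hρ, hy, torsorSpace_comp_eq w hπ ?_⟩
    rw [hy, hz']
  obtain ⟨ρ, y, hρ, hy, hyX⟩ := key e h
  obtain ⟨ρ', y', hρ', hy', hyX'⟩ := key e' h'
  have hyy : y ≫ π = y' ≫ π := by
    refine eq_of_localGenericPt_comp_eq w ?_ hyX hyX'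
    rw [← Category.assoc, ← Category.assoc, hy, hy', htors.act_comp, htors.act_comp]
  obtain ⟨t, ht, -⟩ := htors.existsUnique_act_eq y y' hyy
  obtain ⟨τ, rfl⟩ := exists_specTorus_eq t
  have h1 : (torsorAction deg g f hg hf).act (specTorus ρ') z
      = (torsorAction deg g f hg hf).act (specTorus ((fun j => Units.map
        (algebraMap (w.valuation K).valuationSubring K : _ →* K) (τ j)) * ρ)) z := by
    rw [← hy', ← ht, (torsorAction deg g f hg hf).comp_act, hy, map_mul,
      (torsorAction deg g f hg hf).mul_act, ← res_specTorus]
    rfl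
  have h2 := (htors.existsUnique_act_eq z _ (htors.act_comp _ z).symm).unique h1 rfl
  have h3 := specTorus_injective h2
  funext j
  have h4 := congrArg (fun q : Kˣ => w.valuation K (q : K)) (congrFun h3 j)
  have h5 : w.valuation K (((τ j : (w.valuation K).valuationSubring)) : K) = 1 :=
    (valuationSubring_isUnit_iff (w.valuation K) _).mp (τ j).isUnit
  simp only [Pi.mul_apply, Units.val_mul, map_mul, hρ, hρ'] at h4
  rw [show w.valuation K ((Units.map (algebraMap (w.valuation K).valuationSubring K : _ →* K)
    (τ j) : Kˣ) : K) = 1 from h5, one_mul, exp_inj] at h4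
  simpa using h4.symm

omit [IsDedekindDomain A] [IsFractionRing A K] in
theorem torsorSpace_eq_genericPt (hπ : π ≫ pX = torsorSpaceStr g f) (x : RationalPoint A K pX)
    (hz : z ≫ π = x.1 ≫ pullback.fst pX (genericPt A K)) :
    z ≫ torsorSpaceStr g f = genericPt A K := by
  rw [← hπ, ← Category.assoc, hz, Category.assoc, pullback.condition, ← Category.assoc]
  have := x.2
  rw [this, Category.id_comp]

/-- The tautological frame matches the generic fibre of an integral point of the twist with a
`K`-point of `Y` having the same coordinates and the same image in `X`. -/
theorem IsFrameProjection.mem_imageOfIntegralPoints_iff {ψ : twist deg a g f ⟶ X}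
    (hψ : IsFrameProjection π ψ) (hg : ∀ i, IsWeightedHomogeneous deg (g i) (dg i))
    (hf : ∀ i, IsWeightedHomogeneous deg (f i) (df i)) (hπ : π ≫ pX = torsorSpaceStr g f)
    (x : RationalPoint A K pX) :
    x ∈ imageOfIntegralPoints A K pX (twistStr deg a g f) ψ ↔
      ∃ z : Spec (CommRingCat.of K) ⟶ torsorSpace g f,
        z ≫ π = x.1 ≫ pullback.fst pX (genericPt A K) ∧
        coord z ∈ integralCoordinates deg a g f df := by
  constructor
  · rintro ⟨y, hy⟩
    obtain ⟨z, hz⟩ := exists_matches_genericPt (K := K) hg y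
    refine ⟨z, ?_, coord_mem_integralCoordinates hg hf y hz⟩
    rw [hy, ← Category.assoc, hψ _ _ _ hz]
  · rintro ⟨z, hz, hz'⟩
    obtain ⟨y, hy⟩ := exists_isCoordinateVector hf hz'
    obtain ⟨z₁, hz₁⟩ := exists_matches_genericPt (K := K) hg y
    have h := (isCoordinateVector_iff y hz₁ _).mp hy
    have hstr : z₁ ≫ torsorSpaceStr g f = genericPt A K := by
      refine eval_injective (RingHom.ext fun b => ?_)
      rw [eval_comp_torsorSpaceStr]
      refine (hz₁.right b).trans ?_
      unfold genericPt
      rw [eval_specMap]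
    obtain rfl := eq_of_coord_eq (torsorSpace_eq_genericPt hπ x hz) hstr h
    exact ⟨y, by rw [← hz, ← Category.assoc, hψ _ _ _ hz₁]⟩

/-- Only finitely many primes occur in the nonzero coordinates or in one chosen nonzero value
`f_i(v)`. -/
theorem eventually_isPrimitiveAt_zero {v : Fin N → K} (hv : ∃ i, aeval v (f i) ≠ 0) :
    ∀ᶠ w : HeightOneSpectrum A in Filter.cofinite, IsPrimitiveAt w deg f df 0 v := by
  have h1 (x : K) (hx : x ≠ 0) : ∀ᶠ w : HeightOneSpectrum A in Filter.cofinite,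
      w.valuation K x = 1 := by
    filter_upwards [FractionalIdeal.finite_factors (FractionalIdeal.spanSingleton A⁰ x)] with w hw
    rw [valuation_eq_exp_count w hx, hw, neg_zero, exp_zero]
  have h2 : ∀ᶠ w : HeightOneSpectrum A in Filter.cofinite, ∀ i, w.valuation K (v i) ≤ 1 := by
    refine Filter.eventually_all.mpr fun i => ?_
    by_cases hi : v i = 0
    · refine Filter.Eventually.of_forall fun w => ?_
      rw [hi, map_zero]
      exact zero_le
    · filter_upwards [h1 _ hi] with w hw using hw.le
  obtain ⟨i, hi⟩ := hv
  filter_upwards [h2, h1 _ hi] with w hw hw'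
  exact ⟨fun i => by simpa using hw i, i, by simpa using hw'⟩

theorem mem_integralCoordinates_coord_iff (hf : ∀ i, IsWeightedHomogeneous deg (f i) (df i))
    (hz : z ≫ torsorSpaceStr g f = genericPt A K) :
    coord z ∈ integralCoordinates deg a g f df ↔ ∀ w : HeightOneSpectrum A,
      IsPrimitiveAt w deg f df
        (fun j => FractionalIdeal.count K w (a j : FractionalIdeal A⁰ K)) (coord z) :=
  mem_integralCoordinates_iff (exists_aeval_coord_ne_zero hz) hf (aeval_coord_eq_zero hz)

/-- At each prime, multiplying `𝔞_j` by `ρ_j` adds the order of `ρ_j`, which is the shift in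
`isPrimitiveAt_act_iff`. -/
theorem coord_act_mem_integralCoordinates_iff (hg : ∀ i, IsWeightedHomogeneous deg (g i) (dg i))
    (hf : ∀ i, IsWeightedHomogeneous deg (f i) (df i))
    (hz : z ≫ torsorSpaceStr g f = genericPt A K) (ρ : Fin r → Kˣ) :
    coord ((torsorAction deg g f hg hf).act (specTorus ρ) z)
        ∈ integralCoordinates deg (fun j => toPrincipalIdeal A K (ρ j) * a j) g f df ↔
      coord z ∈ integralCoordinates deg a g f df := by
  rw [mem_integralCoordinates_coord_iff hf hz,
    mem_integralCoordinates_coord_iff hf ((act_comp_torsorSpaceStr hg hf _ z).trans hz)]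
  refine forall_congr' fun w => ?_
  rw [← isPrimitiveAt_act_iff (hg := hg) (hf := hf) (ρ := ρ) w
    (fun j => valuation_eq_exp_count w (ρ j).ne_zero) _ hz]
  have : (fun j => FractionalIdeal.count K w ((toPrincipalIdeal A K (ρ j) * a j :
      (FractionalIdeal A⁰ K)ˣ) : FractionalIdeal A⁰ K))
      = (fun j => FractionalIdeal.count K w (a j : FractionalIdeal A⁰ K))
        + fun j => FractionalIdeal.count K w (FractionalIdeal.spanSingleton A⁰ (ρ j : K)) :=
    funext fun j => (count_toPrincipalIdeal_mul w _ _).trans (add_comm _ _)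
  rw [this]

/-- The lifts of a rational point are integral on some twist. -/
theorem IsTorsor.exists_mem_integralCoordinates
    (htors : IsTorsor (torsorAction deg g f hg hf) π) (hπ : π ≫ pX = torsorSpaceStr g f)
    [IsProper pX] (hz : z ≫ torsorSpaceStr g f = genericPt A K) :
    ∃ a : Fin r → (FractionalIdeal A⁰ K)ˣ, coord z ∈ integralCoordinates deg a g f df := by
  classical
  -- Choosing `e = 0` wherever it is admissible makes the exponents zero at almost all primes, so
  -- they are the orders of fractional ideals.
  have hex (w : HeightOneSpectrum A) : ∃ e, IsPrimitiveAt w deg f df e (coord z) ∧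
      (IsPrimitiveAt w deg f df 0 (coord z) → e = 0) := by
    by_cases h : IsPrimitiveAt w deg f df 0 (coord z)
    · exact ⟨0, h, fun _ => rfl⟩
    · obtain ⟨e, he⟩ := htors.exists_isPrimitiveAt w hπ hz
      exact ⟨e, he, fun h' => absurd h' h⟩
  choose e he he' using hex
  have hfin : ∀ᶠ w in Filter.cofinite, e w = 0 :=
    (eventually_isPrimitiveAt_zero (exists_aeval_coord_ne_zero hz)).mono he'
  choose a ha using fun j => exists_count_eq (K := K) (e := fun w => e w j)
    (hfin.mono fun w hw => congrFun hw j)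
  refine ⟨a, (mem_integralCoordinates_coord_iff hf hz).mpr fun w => ?_⟩
  rw [show (fun j => FractionalIdeal.count K w (a j : FractionalIdeal A⁰ K)) = e w from
    funext fun j => ha j w]
  exact he w

theorem IsTorsor.integralCoordinates_unique
    (htors : IsTorsor (torsorAction deg g f hg hf) π) (hπ : π ≫ pX = torsorSpaceStr g f)
    [IsSeparated pX] (hz : z ≫ torsorSpaceStr g f = genericPt A K)
    {a' : Fin r → (FractionalIdeal A⁰ K)ˣ} (h : coord z ∈ integralCoordinates deg a g f df)
    (h' : coord z ∈ integralCoordinates deg a' g f df) : a = a' := by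
  rw [mem_integralCoordinates_coord_iff hf hz] at h h'
  exact funext fun j => eq_of_forall_count_eq fun w =>
    congrFun (htors.isPrimitiveAt_unique w hπ hz (h w) (h' w)) j

variable {ψ : ∀ a : Fin r → (FractionalIdeal A⁰ K)ˣ, twist deg a g f ⟶ X}
  {S : Set (FractionalIdeal A⁰ K)ˣ}

/-- Every rational point is the image of an integral point of some twist. -/
theorem IsTorsor.iUnion_imageOfIntegralPoints
    (htors : IsTorsor (torsorAction deg g f hg hf) π) (hπ : π ≫ pX = torsorSpaceStr g f)
    [IsProper pX] (hψ : ∀ a, IsFrameProjection π (ψ a))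
    (hS : ∀ x : ClassGroup A, ∃ c ∈ S, ClassGroup.mk K c = x) :
    ⋃ c ∈ {c : Fin r → (FractionalIdeal A⁰ K)ˣ | ∀ j, c j ∈ S},
      imageOfIntegralPoints A K pX (twistStr deg c g f) (ψ c) = Set.univ := by
  refine Set.eq_univ_of_forall fun x => ?_
  obtain ⟨z, hz⟩ := htors.exists_lift (x.1 ≫ pullback.fst pX (genericPt A K))
  have hzK := torsorSpace_eq_genericPt hπ x hz
  obtain ⟨a, ha⟩ := htors.exists_mem_integralCoordinates hπ hzK
  -- The representative of the class of `a j` is `ρ j` times `a j`; correspondingly the lift `z` is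
  -- replaced by `ρ z`, which has the same image in `X`.
  choose c hc hca using fun j => hS (ClassGroup.mk K (a j))
  choose ρ hρ using fun j => ClassGroup.mk_eq_mk_iff.mp (hca j).symm
  obtain rfl : c = fun j => toPrincipalIdeal A K (ρ j) * a j := funext hρ
  refine Set.mem_biUnion hc ((IsFrameProjection.mem_imageOfIntegralPoints_iff (hψ _) hg hf hπ x).mpr ⟨_, ?_,
    (coord_act_mem_integralCoordinates_iff hg hf hzK ρ).mpr ha⟩)
  rw [htors.act_comp, hz]

/-- The images of the integral points of twists by different ideal classes are disjoint. -/
theorem IsTorsor.pairwiseDisjoint_imageOfIntegralPoints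
    (htors : IsTorsor (torsorAction deg g f hg hf) π) (hπ : π ≫ pX = torsorSpaceStr g f)
    [IsSeparated pX] (hψ : ∀ a, IsFrameProjection π (ψ a)) (hS : S.InjOn (ClassGroup.mk K)) :
    {c : Fin r → (FractionalIdeal A⁰ K)ˣ | ∀ j, c j ∈ S}.PairwiseDisjoint fun c =>
      imageOfIntegralPoints A K pX (twistStr deg c g f) (ψ c) := by
  intro c hc c' hc' hne
  refine Set.disjoint_left.mpr fun x hx hx' => hne (funext fun j => hS (hc j) (hc' j) ?_)
  obtain ⟨z, hz, hzc⟩ := (IsFrameProjection.mem_imageOfIntegralPoints_iff (hψ c) hg hf hπ x).mp hx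
  obtain ⟨z', hz', hzc'⟩ := (IsFrameProjection.mem_imageOfIntegralPoints_iff (hψ c') hg hf hπ x).mp hx'
  have hzK := torsorSpace_eq_genericPt hπ x hz
  -- Two lifts of one rational point differ by some `ρ ∈ (Kˣ)^r`. Uniqueness of the tuple for `ρ z`
  -- forces `c' = ρ c`, so the classes agree.
  obtain ⟨t, rfl, -⟩ := htors.existsUnique_act_eq z z' (hz.trans hz'.symm)
  obtain ⟨ρ, rfl⟩ := exists_specTorus_eq t
  have h := htors.integralCoordinates_unique hπ (torsorSpace_eq_genericPt hπ x hz') hzc'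
    ((coord_act_mem_integralCoordinates_iff hg hf hzK ρ).mpr hzc)
  exact ClassGroup.mk_eq_mk_iff.mpr ⟨ρ j, congrFun h j⟩

end RationalPoints

end

end TwistedTorsor

/-! ### The main theorem -/

theorem theorem2p6 {A K : Type u} [CommRing A] [IsDedekindDomain A] [Field K] [Algebra A K]
    [IsFractionRing A K] {r N m s : ℕ} (deg : Fin N → Fin r → ℤ)
    (g : Fin s → MvPolynomial (Fin N) A) (dg : Fin s → Fin r → ℤ)
    (hg : ∀ i, MvPolynomial.IsWeightedHomogeneous deg (g i) (dg i))
    (f : Fin m → MvPolynomial (Fin N) A) (df : Fin m → Fin r → ℤ)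
    (hf : ∀ i, MvPolynomial.IsWeightedHomogeneous deg (f i) (df i))
    (X : Scheme.{u}) (pX : X ⟶ Spec (CommRingCat.of A)) [IsSeparated pX]
    [LocallyOfFiniteType pX] [QuasiCompact pX]
    (π : TwistedTorsor.torsorSpace g f ⟶ X)
    (hπ : π ≫ pX = TwistedTorsor.torsorSpaceStr g f)
    (htors : TwistedTorsor.IsTorsor (TwistedTorsor.torsorAction deg g f hg hf) π) :
    ∃ twistπ : ∀ a : Fin r → (FractionalIdeal A⁰ K)ˣ, TwistedTorsor.twist deg a g f ⟶ X,
      -- the twists of `π` are well defined morphisms of `A`-schemes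
      (∀ a ψ, TwistedTorsor.IsTwistedProjection deg a g f π ψ ↔ ψ = twistπ a) ∧
      (∀ a, twistπ a ≫ pX = TwistedTorsor.twistStr deg a g f) ∧
      -- (i) they are torsors of class `[Y] - [𝔞]`
      (∀ a, TwistedTorsor.IsTorsor (TwistedTorsor.twistAction deg a g f) (twistπ a) ∧
        ∃ y z : TwistedTorsor.EtaleH1 r X,
          (∀ c, TwistedTorsor.IsTorsorClass (TwistedTorsor.torsorAction deg g f hg hf) π c ↔
            c = y) ∧
          (∀ c, TwistedTorsor.IsIdealClass a pX c ↔ c = z) ∧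
          (∀ c, TwistedTorsor.IsTorsorClass (TwistedTorsor.twistAction deg a g f) (twistπ a) c ↔
            c = y - z)) ∧
      -- (ii) decomposition of the set of rational points
      (IsProper pX → ∀ C : Set (FractionalIdeal A⁰ K)ˣ,
        (∀ x : ClassGroup A, ∃! c, c ∈ C ∧ ClassGroup.mk K c = x) →
        (⋃ c ∈ {c : Fin r → (FractionalIdeal A⁰ K)ˣ | ∀ j, c j ∈ C},
          TwistedTorsor.imageOfIntegralPoints A K pX (TwistedTorsor.twistStr deg c g f)
            (twistπ c)) = Set.univ ∧
        {c : Fin r → (FractionalIdeal A⁰ K)ˣ | ∀ j, c j ∈ C}.PairwiseDisjoint fun c =>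
          TwistedTorsor.imageOfIntegralPoints A K pX (TwistedTorsor.twistStr deg c g f)
            (twistπ c)) ∧
      -- (iii) coordinates of the integral points
      (∀ c : Fin r → (FractionalIdeal A⁰ K)ˣ,
        ∃ e : TwistedTorsor.IntegralPoint A (TwistedTorsor.twistStr deg c g f) ≃
            TwistedTorsor.integralCoordinates deg c g f df,
          ∀ y v, TwistedTorsor.IsCoordinateVector deg c g f y v ↔ v = (e y : Fin N → K)) := by
  choose ψ hψ using fun a : Fin r → (FractionalIdeal A⁰ K)ˣ =>
    TwistedTorsor.exists_isFrameProjection (a := a) hg hf htors.act_comp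
  have hstr a : ψ a ≫ pX = TwistedTorsor.twistStr deg a g f :=
    TwistedTorsor.IsFrameProjection.comp_eq hg (hψ a) hπ
  have htor a : TwistedTorsor.IsTorsor (TwistedTorsor.twistAction deg a g f) (ψ a) :=
    TwistedTorsor.IsFrameProjection.isTorsor (hψ a) htors (hstr a)
  refine ⟨ψ, fun a _ => TwistedTorsor.isTwistedProjection_iff hg (hψ a), hstr,
    fun a => ⟨htor a, TwistedTorsor.IsFrameProjection.exists_classes (hψ a) htors hπ (htor a)⟩,
    fun hX C hC => ⟨?_, ?_⟩,
    fun c => TwistedTorsor.exists_equiv_integralCoordinates hg hf⟩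
  · exact htors.iUnion_imageOfIntegralPoints hπ hψ fun x => (hC x).exists
  · exact htors.pairwiseDisjoint_imageOfIntegralPoints hπ hψ fun c hc c' hc' h =>
      (hC _).unique ⟨hc, h⟩ ⟨hc', rfl⟩
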